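/- **Language.** $\mathsf F^\mu$ is the call-by-value System F (left-to-right evaluation, terms up to renaming of bound variables) with types $$\tau ::= \alpha \mid \mathsf{unit}\mid\mathsf{int}\mid\mathsf{bool}\mid\tau_1\times\tau_2\mid\tau_1+\tau_2\mid\tau_1\to\tau_2\mid\forall\alpha.\tau\mid\exists\alpha.\tau\mid\mu\alpha.\tau ,$$ the usual introduction and elimination forms (injections, packages and $\mathsf{roll}$ carry type annotations; $\mathsf{unroll}(\mathsf{roll}_\tau\,v)\leadsto v$ for recursive types), integer literals, and the primitive integer operations $+,-,=,<,\le$, with the standard typing rules $\Gamma\vdash e:\tau$ and the standard small-step semantics $E[e]\leadsto E[e']$ given by reduction axioms and evaluation contexts $E$. Values include type abstractions and (for open terms) variables. Write $e\Downarrow$ if $e\leadsto^* v$ for some value $v$, and $e\leadsto^0 e'$ (resp. $e\leadsto^1 e'$) if $e\leadsto^* e'$ by a reduction sequence with no (resp. exactly one) $\mathsf{unroll}$-$\mathsf{roll}$ reduction. A context $C$ is a term with one hole, and $\vdash C:(\Gamma\vdash\tau)\rightsquigarrow(\Gamma'\vdash\tau')$ is its standard (syntax-directed) typing, with rule $\vdash[\cdot]:(\Gamma\vdash\tau)\rightsquigarrow(\Gamma'\vdash\tau)$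 for $\Gamma\subseteq\Gamma'$; $\vdash E:\tau\rightsquigarrow\tau'$ means $\vdash E:(\cdot\vdash\tau)\rightsquigarrow(\cdot\vdash\tau')$. **Contextual and ciu approximation.** Let $\Gamma\vdash e_1:\tau$ and $\Gamma\vdash e_2:\tau$. * $\Gamma\vdash e_1\preceq^{ctx}e_2:\tau$ means: for all $C,\tau'$ with $\vdash C:(\Gamma\vdash\tau)\rightsquigarrow(\cdot\vdash\tau')$, if $C[e_1]\Downarrow$ then $C[e_2]\Downarrow$. * For closed terms $e_1,e_2$ of type $\tau$, $\vdash e_1\preceq^{ciu}e_2:\tau$ means: for all evaluation contexts $E$ and types $\tau'$ with $\vdash E:\tau\rightsquigarrow\tau'$, if $E[e_1]\Downarrow$ then $E[e_2]\Downarrow$. For open terms, $\Gamma\vdash e_1\preceq^{ciu}e_2:\tau$ means $\vdash\gamma e_1\preceq^{ciu}\gamma e_2:\gamma\tau$ for every substitution $\gamma$ that maps the type variables of $\Gamma$ to closed types and each $x:\sigma$ in $\Gamma$ to a closed value of type $\gamma\sigma$. **The logic LSLR.** Its relations (propositions are the nullary relations) are $$r\mid A\mid\top\mid\bot\mid P\wedge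 Q\mid P\vee Q\mid P\Rightarrow Q\mid\forall\mathcal X.P\mid\exists\mathcal X.P\mid\forall\mathcal R.P\mid\exists\mathcal R.P\mid\bar x.P\mid\bar e\in R\mid\mu r.R\mid\triangleright P ,$$ where $\mathcal X$ ranges over contexts of type and term variables, $\mathcal R$ over contexts of relation variables, in $\mu r.R$ the variable $r$ may occur in $R$ only under $\triangleright$, and the atomic relations $A$ are $e_1=e_2$, $\mathrm{Val}$, $e:\tau$, $C:\tau\rightsquigarrow\tau'$ (for evaluation contexts), $e_1\leadsto^{*}e_2$, $e_1\leadsto^{0}e_2$, $e_1\leadsto^{1}e_2$ and $e_1\preceq e_2$ (meaning $\vdash e_1\preceq^{ciu}e_2:\tau$ for some $\tau$). They are interpreted in the Kripke model whose worlds are the natural numbers, with $k<n$ strictly in the future of $n$: in world $0$ everything is true; in a world $n>0$, atomic relations have their meaning, $P\Rightarrow Q$ means that $P$ implies $Q$ in every world $k\le n$, $\triangleright P$ means $P$ in world $n-1$, variables in $\mathcal X$ range over closed types and arbitrary closed terms, those in $\mathcal R$ over monotone world-indexed relations on closed terms (true in $n$ implies true in all $k\le n$), $\mu r.R$ means $R[\mu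 r.R/r]$, and the remaining connectives are read pointwise. $\mathcal X;\mathcal R;\mathcal P\vdash P$ means that in every world, under all closing interpretations of $\mathcal X$ and $\mathcal R$, if all propositions of $\mathcal P$ hold then $P$ holds. Write $e\downarrow\tau$ for $e:\tau\wedge e\in\mathrm{Val}$, $t\Downarrow^0x$ for $t\leadsto^0x\wedge x\in\mathrm{Val}$, and $R:\mathrm{VRel}(\tau_1,\tau_2)$ for $\forall x_1,x_2.\,(x_1,x_2)\in R\Rightarrow x_1\downarrow\tau_1\wedge x_2\downarrow\tau_2$. **The logical relation.** Let $\rho$ map type variables to triples $(\tau_1,\tau_2,R)$, and let $\rho_1,\rho_2$ be the induced type substitutions. By induction on $\tau$, define binary LSLR relations: $\mathcal V[\![\alpha]\!]\rho=R$ if $\rho(\alpha)=(\tau_1,\tau_2,R)$; for the other types except $\mu$-types, $(x_1,x_2)\in\mathcal V[\![\tau]\!]\rho$ iff $x_1\downarrow\rho_1\tau$, $x_2\downarrow\rho_2\tau$ and * $\mathsf{unit},\mathsf{int},\mathsf{bool}$: $x_1=x_2$; * $\tau'\times\tau''$: $x_1=\langle x_1',x_1''\rangle$ and $x_2=\langle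 x_2',x_2''\rangle$ for some $(x_1',x_2')\in\mathcal V[\![\tau']\!]\rho$ and $(x_1'',x_2'')\in\mathcal V[\![\tau'']\!]\rho$; * $\tau'+\tau''$: $x_1,x_2$ are left injections of some $(x_1',x_2')\in\mathcal V[\![\tau']\!]\rho$, or right injections of some $(x_1'',x_2'')\in\mathcal V[\![\tau'']\!]\rho$; * $\tau'\to\tau''$: $\forall y_1,y_2.\,(y_1,y_2)\in\mathcal V[\![\tau']\!]\rho\Rightarrow(x_1y_1,x_2y_2)\in\mathcal E[\![\tau'']\!]\rho$; * $\forall\alpha.\tau'$: $\forall\alpha_1,\alpha_2.\forall r.\ r:\mathrm{VRel}(\alpha_1,\alpha_2)\Rightarrow(x_1[\alpha_1],x_2[\alpha_2])\in\mathcal E[\![\tau']\!](\rho,\alpha\mapsto(\alpha_1,\alpha_2,r))$; * $\exists\alpha.\tau'$: $\exists\alpha_1,\alpha_2,y_1,y_2.\exists r.\ r:\mathrm{VRel}(\alpha_1,\alpha_2)$, $x_i=\mathsf{pack}\ \alpha_i,y_i\ \mathsf{as}\ \exists\alpha.\rho_i\tau'$ for $i=1,2$, and $(y_1,y_2)\in\mathcal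 V[\![\tau']\!](\rho,\alpha\mapsto(\alpha_1,\alpha_2,r))$. Finally $$\begin{aligned}\mathcal V[\![\mu\alpha.\tau]\!]\rho=\mu r.\,(x_1\downarrow\rho_1(\mu\alpha.\tau),\,x_2\downarrow\rho_2(\mu\alpha.\tau)).\ &\exists y_1,y_2.\ x_1=\mathsf{roll}\,y_1\wedge x_2=\mathsf{roll}\,y_2\\ &\wedge\triangleright\,(y_1,y_2)\in\mathcal V[\![\tau]\!](\rho,\alpha\mapsto(\rho_1(\mu\alpha.\tau),\rho_2(\mu\alpha.\tau),r)),\end{aligned}$$ $$\begin{aligned}\mathcal E[\![\tau]\!]\rho=\mu r.\,(t_1:\rho_1\tau,\,t_2:\rho_2\tau).\ &(\forall x_1.\ t_1\Downarrow^0x_1\Rightarrow\exists x_2.\ x_2\preceq t_2\wedge(x_1,x_2)\in\mathcal V[\![\tau]\!]\rho)\\ &\wedge(\forall t_1'.\ t_1\leadsto^1t_1'\Rightarrow\triangleright\,(t_1',t_2)\in r).\end{aligned}$$ **Logical approximation.** Let $\Gamma=\alpha_1,\dots,\alpha_n,x_1:\tau_1,\dots,x_m:\tau_m$, $\Gamma\vdash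 e_1:\tau$ and $\Gamma\vdash e_2:\tau$. Put $\mathcal X=\alpha_1^1,\alpha_1^2,\dots,\alpha_n^1,\alpha_n^2,x_1^1,x_1^2,\dots,x_m^1,x_m^2$, $\mathcal R=r_1,\dots,r_n$ (binary), $\rho=\{\alpha_i\mapsto(\alpha_i^1,\alpha_i^2,r_i)\}_i$, $\gamma_j=\{x_i\mapsto x_i^j\}_i$ for $j=1,2$, and let $\mathcal P$ consist of all $r_i:\mathrm{VRel}(\alpha_i^1,\alpha_i^2)$ and all $(x_i^1,x_i^2)\in\mathcal V[\![\tau_i]\!]\rho$. Then $\Gamma\vdash e_1\preceq^{log}e_2:\tau$ means $\mathcal X;\mathcal R;\mathcal P\vdash(\rho_1\gamma_1e_1,\rho_2\gamma_2e_2)\in\mathcal E[\![\tau]\!]\rho$. **Corollary.** If $\Gamma\vdash e_1:\tau$ and $\Gamma\vdash e_2:\tau$, then $$\Gamma\vdash e_1\preceq^{ctx}e_2:\tau\iff\Gamma\vdash e_1\preceq^{ciu}e_2:\tau\iff\Gamma\vdash e_1\preceq^{log}e_2:\tau .$$ In particular, the logical relation is sound and complete for contextual approximation. -/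

import Mathlib

/-! # The language F^μ

Call-by-value System F with existential and iso-recursive types.  Terms are taken up to
renaming of bound variables: type variables and term variables are de Bruijn indices (two
separate index spaces), and types and terms are well scoped by construction. -/

namespace FMu

/-- Add a new variable, which gets index `0`. -/
abbrev push {A : Type} {n : ℕ} (a : A) (f : Fin n → A) : Fin (n + 1) → A :=
  Fin.cons (α := fun _ => A) a f

/-- Lift a renaming under one binder. -/
abbrev liftRen {n n' : ℕ} (f : Fin n → Fin n') : Fin (n + 1) → Fin (n' + 1) :=
  push 0 (fun i => (f i).succ)

/-- Types with free type variables among `0, …, n - 1`. The last three constructors bind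
one type variable. -/
inductive Ty : ℕ → Type
  | var {n : ℕ} (i : Fin n) : Ty n
  | unit {n : ℕ} : Ty n
  | int {n : ℕ} : Ty n
  | bool {n : ℕ} : Ty n
  | prod {n : ℕ} (a b : Ty n) : Ty n
  | sum {n : ℕ} (a b : Ty n) : Ty n
  | arr {n : ℕ} (a b : Ty n) : Ty n
  | all {n : ℕ} (a : Ty (n + 1)) : Ty n
  | ex {n : ℕ} (a : Ty (n + 1)) : Ty n
  | mu {n : ℕ} (a : Ty (n + 1)) : Ty n

def Ty.rename : {n n' : ℕ} → (Fin n → Fin n') → Ty n → Ty n'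
  | _, _, f, .var i => .var (f i)
  | _, _, _, .unit => .unit
  | _, _, _, .int => .int
  | _, _, _, .bool => .bool
  | _, _, f, .prod a b => .prod (a.rename f) (b.rename f)
  | _, _, f, .sum a b => .sum (a.rename f) (b.rename f)
  | _, _, f, .arr a b => .arr (a.rename f) (b.rename f)
  | _, _, f, .all a => .all (a.rename (liftRen f))
  | _, _, f, .ex a => .ex (a.rename (liftRen f))
  | _, _, f, .mu a => .mu (a.rename (liftRen f))

/-- Lift a type substitution under a type binder. -/
def liftTy {n n' : ℕ} (σ : Fin n → Ty n') : Fin (n + 1) → Ty (n' + 1) :=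
  push (.var 0) (fun i => (σ i).rename Fin.succ)

/-- Simultaneous capture-avoiding substitution of types for type variables. -/
def Ty.subst : {n n' : ℕ} → (Fin n → Ty n') → Ty n → Ty n'
  | _, _, σ, .var i => σ i
  | _, _, _, .unit => .unit
  | _, _, _, .int => .int
  | _, _, _, .bool => .bool
  | _, _, σ, .prod a b => .prod (a.subst σ) (b.subst σ)
  | _, _, σ, .sum a b => .sum (a.subst σ) (b.subst σ)
  | _, _, σ, .arr a b => .arr (a.subst σ) (b.subst σ)
  | _, _, σ, .all a => .all (a.subst (liftTy σ))
  | _, _, σ, .ex a => .ex (a.subst (liftTy σ))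
  | _, _, σ, .mu a => .mu (a.subst (liftTy σ))

/-- `a[b/α]`, where `α` is the variable `0` of `a`. -/
def Ty.inst {n : ℕ} (a : Ty (n + 1)) (b : Ty n) : Ty n :=
  a.subst (push b .var)

/-- Primitive (integer) operations. -/
inductive PrimOp : Type
  | plus | minus | eq | lt | le

/-- Terms with free type variables `0, …, n - 1` and free term variables `0, …, m - 1`. -/
inductive Tm : ℕ → ℕ → Type
  | var {n m : ℕ} (i : Fin m) : Tm n m
  | unit {n m : ℕ} : Tm n m
  | int {n m : ℕ} (z : ℤ) : Tm n m
  | prim {n m : ℕ} (o : PrimOp) (e₁ e₂ : Tm n m) : Tm n m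
  | bool {n m : ℕ} (b : Bool) : Tm n m
  | ite {n m : ℕ} (e e₁ e₂ : Tm n m) : Tm n m
  | pair {n m : ℕ} (e₁ e₂ : Tm n m) : Tm n m
  | fst {n m : ℕ} (e : Tm n m) : Tm n m
  | snd {n m : ℕ} (e : Tm n m) : Tm n m
  | inl {n m : ℕ} (τ : Ty n) (e : Tm n m) : Tm n m
  | inr {n m : ℕ} (τ : Ty n) (e : Tm n m) : Tm n m
  /-- `case e of inl x₁ ⇒ e₁ | inr x₂ ⇒ e₂` -/
  | case {n m : ℕ} (e : Tm n m) (e₁ e₂ : Tm n (m + 1)) : Tm n m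
  | lam {n m : ℕ} (τ : Ty n) (e : Tm n (m + 1)) : Tm n m
  | app {n m : ℕ} (e₁ e₂ : Tm n m) : Tm n m
  | tlam {n m : ℕ} (e : Tm (n + 1) m) : Tm n m
  | tapp {n m : ℕ} (e : Tm n m) (τ : Ty n) : Tm n m
  /-- `pack τ, e as ∃α. τ'` -/
  | pack {n m : ℕ} (τ : Ty n) (e : Tm n m) (τ' : Ty (n + 1)) : Tm n m
  /-- `unpack e₁ as α, x in e₂` -/
  | unpack {n m : ℕ} (e₁ : Tm n m) (e₂ : Tm (n + 1) (m + 1)) : Tm n m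
  /-- `roll_τ e` -/
  | roll {n m : ℕ} (τ : Ty n) (e : Tm n m) : Tm n m
  | unroll {n m : ℕ} (e : Tm n m) : Tm n m

def Tm.rename : {n n' m m' : ℕ} → (Fin n → Fin n') → (Fin m → Fin m') → Tm n m → Tm n' m'
  | _, _, _, _, _, g, .var i => .var (g i)
  | _, _, _, _, _, _, .unit => .unit
  | _, _, _, _, _, _, .int z => .int z
  | _, _, _, _, f, g, .prim o e₁ e₂ => .prim o (e₁.rename f g) (e₂.rename f g)
  | _, _, _, _, _, _, .bool b => .bool b
  | _, _, _, _, f, g, .ite e e₁ e₂ => .ite (e.rename f g) (e₁.rename f g) (e₂.rename f g)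
  | _, _, _, _, f, g, .pair e₁ e₂ => .pair (e₁.rename f g) (e₂.rename f g)
  | _, _, _, _, f, g, .fst e => .fst (e.rename f g)
  | _, _, _, _, f, g, .snd e => .snd (e.rename f g)
  | _, _, _, _, f, g, .inl τ e => .inl (τ.rename f) (e.rename f g)
  | _, _, _, _, f, g, .inr τ e => .inr (τ.rename f) (e.rename f g)
  | _, _, _, _, f, g, .case e e₁ e₂ =>
      .case (e.rename f g) (e₁.rename f (liftRen g)) (e₂.rename f (liftRen g))
  | _, _, _, _, f, g, .lam τ e => .lam (τ.rename f) (e.rename f (liftRen g))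
  | _, _, _, _, f, g, .app e₁ e₂ => .app (e₁.rename f g) (e₂.rename f g)
  | _, _, _, _, f, g, .tlam e => .tlam (e.rename (liftRen f) g)
  | _, _, _, _, f, g, .tapp e τ => .tapp (e.rename f g) (τ.rename f)
  | _, _, _, _, f, g, .pack τ e τ' =>
      .pack (τ.rename f) (e.rename f g) (τ'.rename (liftRen f))
  | _, _, _, _, f, g, .unpack e₁ e₂ =>
      .unpack (e₁.rename f g) (e₂.rename (liftRen f) (liftRen g))
  | _, _, _, _, f, g, .roll τ e => .roll (τ.rename f) (e.rename f g)
  | _, _, _, _, f, g, .unroll e => .unroll (e.rename f g)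

/-- Lift a term substitution under a term binder. -/
def liftTm {n m m' : ℕ} (s : Fin m → Tm n m') : Fin (m + 1) → Tm n (m' + 1) :=
  push (.var 0) (fun i => (s i).rename id Fin.succ)

/-- Move a term substitution under a type binder. -/
def shiftTm {n m m' : ℕ} (s : Fin m → Tm n m') : Fin m → Tm (n + 1) m' :=
  fun i => (s i).rename Fin.succ id

/-- Simultaneous capture-avoiding substitution of types for type variables and terms for
term variables. -/
def Tm.subst : {n n' m m' : ℕ} → (Fin n → Ty n') → (Fin m → Tm n' m') → Tm n m → Tm n' m'
  | _, _, _, _, _, s, .var i => s i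
  | _, _, _, _, _, _, .unit => .unit
  | _, _, _, _, _, _, .int z => .int z
  | _, _, _, _, σ, s, .prim o e₁ e₂ => .prim o (e₁.subst σ s) (e₂.subst σ s)
  | _, _, _, _, _, _, .bool b => .bool b
  | _, _, _, _, σ, s, .ite e e₁ e₂ => .ite (e.subst σ s) (e₁.subst σ s) (e₂.subst σ s)
  | _, _, _, _, σ, s, .pair e₁ e₂ => .pair (e₁.subst σ s) (e₂.subst σ s)
  | _, _, _, _, σ, s, .fst e => .fst (e.subst σ s)
  | _, _, _, _, σ, s, .snd e => .snd (e.subst σ s)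
  | _, _, _, _, σ, s, .inl τ e => .inl (τ.subst σ) (e.subst σ s)
  | _, _, _, _, σ, s, .inr τ e => .inr (τ.subst σ) (e.subst σ s)
  | _, _, _, _, σ, s, .case e e₁ e₂ =>
      .case (e.subst σ s) (e₁.subst σ (liftTm s)) (e₂.subst σ (liftTm s))
  | _, _, _, _, σ, s, .lam τ e => .lam (τ.subst σ) (e.subst σ (liftTm s))
  | _, _, _, _, σ, s, .app e₁ e₂ => .app (e₁.subst σ s) (e₂.subst σ s)
  | _, _, _, _, σ, s, .tlam e => .tlam (e.subst (liftTy σ) (shiftTm s))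
  | _, _, _, _, σ, s, .tapp e τ => .tapp (e.subst σ s) (τ.subst σ)
  | _, _, _, _, σ, s, .pack τ e τ' =>
      .pack (τ.subst σ) (e.subst σ s) (τ'.subst (liftTy σ))
  | _, _, _, _, σ, s, .unpack e₁ e₂ =>
      .unpack (e₁.subst σ s) (e₂.subst (liftTy σ) (liftTm (shiftTm s)))
  | _, _, _, _, σ, s, .roll τ e => .roll (τ.subst σ) (e.subst σ s)
  | _, _, _, _, σ, s, .unroll e => .unroll (e.subst σ s)

/-! ## Static semantics -/

/-- The result type of a primitive operation; both arguments are integers. -/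
def PrimOp.ty {n : ℕ} : PrimOp → Ty n
  | .plus | .minus => .int
  | .eq | .lt | .le => .bool

/-- Typing contexts: `n` type variables, and `m` term variables with types over them. -/
abbrev TyCtx (n m : ℕ) : Type := Fin m → Ty n

/-- The empty typing context. -/
def TyCtx.empty : TyCtx 0 0 := Fin.elim0

/-- `Γ, α` -/
def TyCtx.bindTy {n m : ℕ} (Γ : TyCtx n m) : TyCtx (n + 1) m :=
  fun i => (Γ i).rename Fin.succ

/-- `Γ, x : τ` -/
def TyCtx.bindTm {n m : ℕ} (Γ : TyCtx n m) (τ : Ty n) : TyCtx n (m + 1) :=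
  push τ Γ

/-- The typing judgment `Γ ⊢ e : τ`. -/
inductive HasTy : {n m : ℕ} → TyCtx n m → Tm n m → Ty n → Prop
  | var {n m : ℕ} {Γ : TyCtx n m} (i : Fin m) : HasTy Γ (.var i) (Γ i)
  | unit {n m : ℕ} {Γ : TyCtx n m} : HasTy Γ .unit .unit
  | int {n m : ℕ} {Γ : TyCtx n m} (z : ℤ) : HasTy Γ (.int z) .int
  | prim {n m : ℕ} {Γ : TyCtx n m} {o : PrimOp} {e₁ e₂ : Tm n m} :
      HasTy Γ e₁ .int → HasTy Γ e₂ .int → HasTy Γ (.prim o e₁ e₂) o.ty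
  | bool {n m : ℕ} {Γ : TyCtx n m} (b : Bool) : HasTy Γ (.bool b) .bool
  | ite {n m : ℕ} {Γ : TyCtx n m} {e e₁ e₂ : Tm n m} {τ : Ty n} :
      HasTy Γ e .bool → HasTy Γ e₁ τ → HasTy Γ e₂ τ → HasTy Γ (.ite e e₁ e₂) τ
  | pair {n m : ℕ} {Γ : TyCtx n m} {e₁ e₂ : Tm n m} {τ₁ τ₂ : Ty n} :
      HasTy Γ e₁ τ₁ → HasTy Γ e₂ τ₂ → HasTy Γ (.pair e₁ e₂) (.prod τ₁ τ₂)
  | fst {n m : ℕ} {Γ : TyCtx n m} {e : Tm n m} {τ₁ τ₂ : Ty n} :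
      HasTy Γ e (.prod τ₁ τ₂) → HasTy Γ (.fst e) τ₁
  | snd {n m : ℕ} {Γ : TyCtx n m} {e : Tm n m} {τ₁ τ₂ : Ty n} :
      HasTy Γ e (.prod τ₁ τ₂) → HasTy Γ (.snd e) τ₂
  | inl {n m : ℕ} {Γ : TyCtx n m} {e : Tm n m} {τ₁ τ₂ : Ty n} :
      HasTy Γ e τ₁ → HasTy Γ (.inl (.sum τ₁ τ₂) e) (.sum τ₁ τ₂)
  | inr {n m : ℕ} {Γ : TyCtx n m} {e : Tm n m} {τ₁ τ₂ : Ty n} :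
      HasTy Γ e τ₂ → HasTy Γ (.inr (.sum τ₁ τ₂) e) (.sum τ₁ τ₂)
  | case {n m : ℕ} {Γ : TyCtx n m} {e : Tm n m} {e₁ e₂ : Tm n (m + 1)} {τ₁ τ₂ τ : Ty n} :
      HasTy Γ e (.sum τ₁ τ₂) → HasTy (Γ.bindTm τ₁) e₁ τ → HasTy (Γ.bindTm τ₂) e₂ τ →
      HasTy Γ (.case e e₁ e₂) τ
  | lam {n m : ℕ} {Γ : TyCtx n m} {e : Tm n (m + 1)} {τ₁ τ₂ : Ty n} :
      HasTy (Γ.bindTm τ₁) e τ₂ → HasTy Γ (.lam τ₁ e) (.arr τ₁ τ₂)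
  | app {n m : ℕ} {Γ : TyCtx n m} {e₁ e₂ : Tm n m} {τ₂ τ : Ty n} :
      HasTy Γ e₁ (.arr τ₂ τ) → HasTy Γ e₂ τ₂ → HasTy Γ (.app e₁ e₂) τ
  | tlam {n m : ℕ} {Γ : TyCtx n m} {e : Tm (n + 1) m} {τ : Ty (n + 1)} :
      HasTy Γ.bindTy e τ → HasTy Γ (.tlam e) (.all τ)
  | tapp {n m : ℕ} {Γ : TyCtx n m} {e : Tm n m} {τ : Ty (n + 1)} (τ₁ : Ty n) :
      HasTy Γ e (.all τ) → HasTy Γ (.tapp e τ₁) (τ.inst τ₁)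
  | pack {n m : ℕ} {Γ : TyCtx n m} {e : Tm n m} {τ₁ : Ty n} {τ : Ty (n + 1)} :
      HasTy Γ e (τ.inst τ₁) → HasTy Γ (.pack τ₁ e τ) (.ex τ)
  | unpack {n m : ℕ} {Γ : TyCtx n m} {e₁ : Tm n m} {e₂ : Tm (n + 1) (m + 1)}
      {τ₁ : Ty (n + 1)} {τ : Ty n} :
      HasTy Γ e₁ (.ex τ₁) → HasTy (Γ.bindTy.bindTm τ₁) e₂ (τ.rename Fin.succ) →
      HasTy Γ (.unpack e₁ e₂) τ
  | roll {n m : ℕ} {Γ : TyCtx n m} {e : Tm n m} {τ : Ty (n + 1)} :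
      HasTy Γ e (τ.inst (.mu τ)) → HasTy Γ (.roll (.mu τ) e) (.mu τ)
  | unroll {n m : ℕ} {Γ : TyCtx n m} {e : Tm n m} {τ : Ty (n + 1)} :
      HasTy Γ e (.mu τ) → HasTy Γ (.unroll e) (τ.inst (.mu τ))

/-! ## Contexts -/

/-- Contexts: terms of scope `(n, m)` with one hole, to be filled with a term of scope
`(p, q)`. Filling captures variables; with de Bruijn indices the hole therefore records
which variable in scope at the hole each free variable of the filling term denotes. -/
inductive Ctxt (p q : ℕ) : ℕ → ℕ → Type
  | hole {n m : ℕ} (f : Fin p → Fin n) (g : Fin q → Fin m) : Ctxt p q n m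
  | primL {n m : ℕ} (o : PrimOp) (C : Ctxt p q n m) (e₂ : Tm n m) : Ctxt p q n m
  | primR {n m : ℕ} (o : PrimOp) (e₁ : Tm n m) (C : Ctxt p q n m) : Ctxt p q n m
  | iteC {n m : ℕ} (C : Ctxt p q n m) (e₁ e₂ : Tm n m) : Ctxt p q n m
  | iteT {n m : ℕ} (e : Tm n m) (C : Ctxt p q n m) (e₂ : Tm n m) : Ctxt p q n m
  | iteE {n m : ℕ} (e e₁ : Tm n m) (C : Ctxt p q n m) : Ctxt p q n m
  | pairL {n m : ℕ} (C : Ctxt p q n m) (e₂ : Tm n m) : Ctxt p q n m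
  | pairR {n m : ℕ} (e₁ : Tm n m) (C : Ctxt p q n m) : Ctxt p q n m
  | fst {n m : ℕ} (C : Ctxt p q n m) : Ctxt p q n m
  | snd {n m : ℕ} (C : Ctxt p q n m) : Ctxt p q n m
  | inl {n m : ℕ} (τ : Ty n) (C : Ctxt p q n m) : Ctxt p q n m
  | inr {n m : ℕ} (τ : Ty n) (C : Ctxt p q n m) : Ctxt p q n m
  | caseC {n m : ℕ} (C : Ctxt p q n m) (e₁ e₂ : Tm n (m + 1)) : Ctxt p q n m
  | caseL {n m : ℕ} (e : Tm n m) (C : Ctxt p q n (m + 1)) (e₂ : Tm n (m + 1)) : Ctxt p q n m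
  | caseR {n m : ℕ} (e : Tm n m) (e₁ : Tm n (m + 1)) (C : Ctxt p q n (m + 1)) : Ctxt p q n m
  | lam {n m : ℕ} (τ : Ty n) (C : Ctxt p q n (m + 1)) : Ctxt p q n m
  | appL {n m : ℕ} (C : Ctxt p q n m) (e₂ : Tm n m) : Ctxt p q n m
  | appR {n m : ℕ} (e₁ : Tm n m) (C : Ctxt p q n m) : Ctxt p q n m
  | tlam {n m : ℕ} (C : Ctxt p q (n + 1) m) : Ctxt p q n m
  | tapp {n m : ℕ} (C : Ctxt p q n m) (τ : Ty n) : Ctxt p q n m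
  | pack {n m : ℕ} (τ : Ty n) (C : Ctxt p q n m) (τ' : Ty (n + 1)) : Ctxt p q n m
  | unpackL {n m : ℕ} (C : Ctxt p q n m) (e₂ : Tm (n + 1) (m + 1)) : Ctxt p q n m
  | unpackR {n m : ℕ} (e₁ : Tm n m) (C : Ctxt p q (n + 1) (m + 1)) : Ctxt p q n m
  | roll {n m : ℕ} (τ : Ty n) (C : Ctxt p q n m) : Ctxt p q n m
  | unroll {n m : ℕ} (C : Ctxt p q n m) : Ctxt p q n m

/-- `C[e]` -/
def Ctxt.fill {p q : ℕ} (t : Tm p q) : {n m : ℕ} → Ctxt p q n m → Tm n m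
  | _, _, .hole f g => t.rename f g
  | _, _, .primL o C e₂ => .prim o (C.fill t) e₂
  | _, _, .primR o e₁ C => .prim o e₁ (C.fill t)
  | _, _, .iteC C e₁ e₂ => .ite (C.fill t) e₁ e₂
  | _, _, .iteT e C e₂ => .ite e (C.fill t) e₂
  | _, _, .iteE e e₁ C => .ite e e₁ (C.fill t)
  | _, _, .pairL C e₂ => .pair (C.fill t) e₂
  | _, _, .pairR e₁ C => .pair e₁ (C.fill t)
  | _, _, .fst C => .fst (C.fill t)
  | _, _, .snd C => .snd (C.fill t)
  | _, _, .inl τ C => .inl τ (C.fill t)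
  | _, _, .inr τ C => .inr τ (C.fill t)
  | _, _, .caseC C e₁ e₂ => .case (C.fill t) e₁ e₂
  | _, _, .caseL e C e₂ => .case e (C.fill t) e₂
  | _, _, .caseR e e₁ C => .case e e₁ (C.fill t)
  | _, _, .lam τ C => .lam τ (C.fill t)
  | _, _, .appL C e₂ => .app (C.fill t) e₂
  | _, _, .appR e₁ C => .app e₁ (C.fill t)
  | _, _, .tlam C => .tlam (C.fill t)
  | _, _, .tapp C τ => .tapp (C.fill t) τ
  | _, _, .pack τ C τ' => .pack τ (C.fill t) τ'
  | _, _, .unpackL C e₂ => .unpack (C.fill t) e₂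
  | _, _, .unpackR e₁ C => .unpack e₁ (C.fill t)
  | _, _, .roll τ C => .roll τ (C.fill t)
  | _, _, .unroll C => .unroll (C.fill t)

/-- The typing judgment for contexts, `⊢ C : (Γ ⊢ τ) ⇝ (Γ' ⊢ τ')`. In the rule for the hole,
the premise `Γ ⊆ Γ'` says that the variables of `Γ` are distinct variables of `Γ'`, with the
same types. -/
inductive CtxtTy {p q : ℕ} (Γ : TyCtx p q) (τ : Ty p) :
    {n m : ℕ} → Ctxt p q n m → TyCtx n m → Ty n → Prop
  | hole {n m : ℕ} {Γ' : TyCtx n m} {f : Fin p → Fin n} {g : Fin q → Fin m} :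
      Function.Injective f → Function.Injective g → (∀ i, Γ' (g i) = (Γ i).rename f) →
      CtxtTy Γ τ (.hole f g) Γ' (τ.rename f)
  | primL {n m : ℕ} {Γ' : TyCtx n m} {o : PrimOp} {C : Ctxt p q n m} {e₂ : Tm n m} :
      CtxtTy Γ τ C Γ' .int → HasTy Γ' e₂ .int → CtxtTy Γ τ (.primL o C e₂) Γ' o.ty
  | primR {n m : ℕ} {Γ' : TyCtx n m} {o : PrimOp} {e₁ : Tm n m} {C : Ctxt p q n m} :
      HasTy Γ' e₁ .int → CtxtTy Γ τ C Γ' .int → CtxtTy Γ τ (.primR o e₁ C) Γ' o.ty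
  | iteC {n m : ℕ} {Γ' : TyCtx n m} {C : Ctxt p q n m} {e₁ e₂ : Tm n m} {τ' : Ty n} :
      CtxtTy Γ τ C Γ' .bool → HasTy Γ' e₁ τ' → HasTy Γ' e₂ τ' →
      CtxtTy Γ τ (.iteC C e₁ e₂) Γ' τ'
  | iteT {n m : ℕ} {Γ' : TyCtx n m} {e : Tm n m} {C : Ctxt p q n m} {e₂ : Tm n m} {τ' : Ty n} :
      HasTy Γ' e .bool → CtxtTy Γ τ C Γ' τ' → HasTy Γ' e₂ τ' →
      CtxtTy Γ τ (.iteT e C e₂) Γ' τ'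
  | iteE {n m : ℕ} {Γ' : TyCtx n m} {e e₁ : Tm n m} {C : Ctxt p q n m} {τ' : Ty n} :
      HasTy Γ' e .bool → HasTy Γ' e₁ τ' → CtxtTy Γ τ C Γ' τ' →
      CtxtTy Γ τ (.iteE e e₁ C) Γ' τ'
  | pairL {n m : ℕ} {Γ' : TyCtx n m} {C : Ctxt p q n m} {e₂ : Tm n m} {τ₁ τ₂ : Ty n} :
      CtxtTy Γ τ C Γ' τ₁ → HasTy Γ' e₂ τ₂ → CtxtTy Γ τ (.pairL C e₂) Γ' (.prod τ₁ τ₂)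
  | pairR {n m : ℕ} {Γ' : TyCtx n m} {e₁ : Tm n m} {C : Ctxt p q n m} {τ₁ τ₂ : Ty n} :
      HasTy Γ' e₁ τ₁ → CtxtTy Γ τ C Γ' τ₂ → CtxtTy Γ τ (.pairR e₁ C) Γ' (.prod τ₁ τ₂)
  | fst {n m : ℕ} {Γ' : TyCtx n m} {C : Ctxt p q n m} {τ₁ τ₂ : Ty n} :
      CtxtTy Γ τ C Γ' (.prod τ₁ τ₂) → CtxtTy Γ τ (.fst C) Γ' τ₁
  | snd {n m : ℕ} {Γ' : TyCtx n m} {C : Ctxt p q n m} {τ₁ τ₂ : Ty n} :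
      CtxtTy Γ τ C Γ' (.prod τ₁ τ₂) → CtxtTy Γ τ (.snd C) Γ' τ₂
  | inl {n m : ℕ} {Γ' : TyCtx n m} {C : Ctxt p q n m} {τ₁ τ₂ : Ty n} :
      CtxtTy Γ τ C Γ' τ₁ → CtxtTy Γ τ (.inl (.sum τ₁ τ₂) C) Γ' (.sum τ₁ τ₂)
  | inr {n m : ℕ} {Γ' : TyCtx n m} {C : Ctxt p q n m} {τ₁ τ₂ : Ty n} :
      CtxtTy Γ τ C Γ' τ₂ → CtxtTy Γ τ (.inr (.sum τ₁ τ₂) C) Γ' (.sum τ₁ τ₂)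
  | caseC {n m : ℕ} {Γ' : TyCtx n m} {C : Ctxt p q n m} {e₁ e₂ : Tm n (m + 1)}
      {τ₁ τ₂ τ' : Ty n} :
      CtxtTy Γ τ C Γ' (.sum τ₁ τ₂) → HasTy (Γ'.bindTm τ₁) e₁ τ' →
      HasTy (Γ'.bindTm τ₂) e₂ τ' → CtxtTy Γ τ (.caseC C e₁ e₂) Γ' τ'
  | caseL {n m : ℕ} {Γ' : TyCtx n m} {e : Tm n m} {C : Ctxt p q n (m + 1)}
      {e₂ : Tm n (m + 1)} {τ₁ τ₂ τ' : Ty n} :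
      HasTy Γ' e (.sum τ₁ τ₂) → CtxtTy Γ τ C (Γ'.bindTm τ₁) τ' →
      HasTy (Γ'.bindTm τ₂) e₂ τ' → CtxtTy Γ τ (.caseL e C e₂) Γ' τ'
  | caseR {n m : ℕ} {Γ' : TyCtx n m} {e : Tm n m} {e₁ : Tm n (m + 1)}
      {C : Ctxt p q n (m + 1)} {τ₁ τ₂ τ' : Ty n} :
      HasTy Γ' e (.sum τ₁ τ₂) → HasTy (Γ'.bindTm τ₁) e₁ τ' →
      CtxtTy Γ τ C (Γ'.bindTm τ₂) τ' → CtxtTy Γ τ (.caseR e e₁ C) Γ' τ'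
  | lam {n m : ℕ} {Γ' : TyCtx n m} {C : Ctxt p q n (m + 1)} {τ₁ τ₂ : Ty n} :
      CtxtTy Γ τ C (Γ'.bindTm τ₁) τ₂ → CtxtTy Γ τ (.lam τ₁ C) Γ' (.arr τ₁ τ₂)
  | appL {n m : ℕ} {Γ' : TyCtx n m} {C : Ctxt p q n m} {e₂ : Tm n m} {τ₂ τ' : Ty n} :
      CtxtTy Γ τ C Γ' (.arr τ₂ τ') → HasTy Γ' e₂ τ₂ → CtxtTy Γ τ (.appL C e₂) Γ' τ'
  | appR {n m : ℕ} {Γ' : TyCtx n m} {e₁ : Tm n m} {C : Ctxt p q n m} {τ₂ τ' : Ty n} :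
      HasTy Γ' e₁ (.arr τ₂ τ') → CtxtTy Γ τ C Γ' τ₂ → CtxtTy Γ τ (.appR e₁ C) Γ' τ'
  | tlam {n m : ℕ} {Γ' : TyCtx n m} {C : Ctxt p q (n + 1) m} {τ' : Ty (n + 1)} :
      CtxtTy Γ τ C Γ'.bindTy τ' → CtxtTy Γ τ (.tlam C) Γ' (.all τ')
  | tapp {n m : ℕ} {Γ' : TyCtx n m} {C : Ctxt p q n m} {τ' : Ty (n + 1)} (τ₁ : Ty n) :
      CtxtTy Γ τ C Γ' (.all τ') → CtxtTy Γ τ (.tapp C τ₁) Γ' (τ'.inst τ₁)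
  | pack {n m : ℕ} {Γ' : TyCtx n m} {C : Ctxt p q n m} {τ₁ : Ty n} {τ' : Ty (n + 1)} :
      CtxtTy Γ τ C Γ' (τ'.inst τ₁) → CtxtTy Γ τ (.pack τ₁ C τ') Γ' (.ex τ')
  | unpackL {n m : ℕ} {Γ' : TyCtx n m} {C : Ctxt p q n m} {e₂ : Tm (n + 1) (m + 1)}
      {τ₁ : Ty (n + 1)} {τ' : Ty n} :
      CtxtTy Γ τ C Γ' (.ex τ₁) → HasTy (Γ'.bindTy.bindTm τ₁) e₂ (τ'.rename Fin.succ) →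
      CtxtTy Γ τ (.unpackL C e₂) Γ' τ'
  | unpackR {n m : ℕ} {Γ' : TyCtx n m} {e₁ : Tm n m} {C : Ctxt p q (n + 1) (m + 1)}
      {τ₁ : Ty (n + 1)} {τ' : Ty n} :
      HasTy Γ' e₁ (.ex τ₁) → CtxtTy Γ τ C (Γ'.bindTy.bindTm τ₁) (τ'.rename Fin.succ) →
      CtxtTy Γ τ (.unpackR e₁ C) Γ' τ'
  | roll {n m : ℕ} {Γ' : TyCtx n m} {C : Ctxt p q n m} {τ' : Ty (n + 1)} :
      CtxtTy Γ τ C Γ' (τ'.inst (.mu τ')) → CtxtTy Γ τ (.roll (.mu τ') C) Γ' (.mu τ')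
  | unroll {n m : ℕ} {Γ' : TyCtx n m} {C : Ctxt p q n m} {τ' : Ty (n + 1)} :
      CtxtTy Γ τ C Γ' (.mu τ') → CtxtTy Γ τ (.unroll C) Γ' (τ'.inst (.mu τ'))

/-- Substitution for the free variables of a context whose hole takes closed terms. -/
def Ctxt.subst : {n n' m m' : ℕ} → (Fin n → Ty n') → (Fin m → Tm n' m') →
    Ctxt 0 0 n m → Ctxt 0 0 n' m'
  | _, _, _, _, _, _, .hole _ _ => .hole Fin.elim0 Fin.elim0
  | _, _, _, _, σ, s, .primL o C e₂ => .primL o (C.subst σ s) (e₂.subst σ s)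
  | _, _, _, _, σ, s, .primR o e₁ C => .primR o (e₁.subst σ s) (C.subst σ s)
  | _, _, _, _, σ, s, .iteC C e₁ e₂ => .iteC (C.subst σ s) (e₁.subst σ s) (e₂.subst σ s)
  | _, _, _, _, σ, s, .iteT e C e₂ => .iteT (e.subst σ s) (C.subst σ s) (e₂.subst σ s)
  | _, _, _, _, σ, s, .iteE e e₁ C => .iteE (e.subst σ s) (e₁.subst σ s) (C.subst σ s)
  | _, _, _, _, σ, s, .pairL C e₂ => .pairL (C.subst σ s) (e₂.subst σ s)
  | _, _, _, _, σ, s, .pairR e₁ C => .pairR (e₁.subst σ s) (C.subst σ s)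
  | _, _, _, _, σ, s, .fst C => .fst (C.subst σ s)
  | _, _, _, _, σ, s, .snd C => .snd (C.subst σ s)
  | _, _, _, _, σ, s, .inl τ C => .inl (τ.subst σ) (C.subst σ s)
  | _, _, _, _, σ, s, .inr τ C => .inr (τ.subst σ) (C.subst σ s)
  | _, _, _, _, σ, s, .caseC C e₁ e₂ =>
      .caseC (C.subst σ s) (e₁.subst σ (liftTm s)) (e₂.subst σ (liftTm s))
  | _, _, _, _, σ, s, .caseL e C e₂ =>
      .caseL (e.subst σ s) (C.subst σ (liftTm s)) (e₂.subst σ (liftTm s))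
  | _, _, _, _, σ, s, .caseR e e₁ C =>
      .caseR (e.subst σ s) (e₁.subst σ (liftTm s)) (C.subst σ (liftTm s))
  | _, _, _, _, σ, s, .lam τ C => .lam (τ.subst σ) (C.subst σ (liftTm s))
  | _, _, _, _, σ, s, .appL C e₂ => .appL (C.subst σ s) (e₂.subst σ s)
  | _, _, _, _, σ, s, .appR e₁ C => .appR (e₁.subst σ s) (C.subst σ s)
  | _, _, _, _, σ, s, .tlam C => .tlam (C.subst (liftTy σ) (shiftTm s))
  | _, _, _, _, σ, s, .tapp C τ => .tapp (C.subst σ s) (τ.subst σ)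
  | _, _, _, _, σ, s, .pack τ C τ' =>
      .pack (τ.subst σ) (C.subst σ s) (τ'.subst (liftTy σ))
  | _, _, _, _, σ, s, .unpackL C e₂ =>
      .unpackL (C.subst σ s) (e₂.subst (liftTy σ) (liftTm (shiftTm s)))
  | _, _, _, _, σ, s, .unpackR e₁ C =>
      .unpackR (e₁.subst σ s) (C.subst (liftTy σ) (liftTm (shiftTm s)))
  | _, _, _, _, σ, s, .roll τ C => .roll (τ.subst σ) (C.subst σ s)
  | _, _, _, _, σ, s, .unroll C => .unroll (C.subst σ s)

/-! ## Dynamic semantics -/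

inductive IsVal : {n m : ℕ} → Tm n m → Prop
  | var {n m : ℕ} (i : Fin m) : IsVal (.var i : Tm n m)
  | unit {n m : ℕ} : IsVal (.unit : Tm n m)
  | int {n m : ℕ} (z : ℤ) : IsVal (.int z : Tm n m)
  | bool {n m : ℕ} (b : Bool) : IsVal (.bool b : Tm n m)
  | pair {n m : ℕ} {v₁ v₂ : Tm n m} : IsVal v₁ → IsVal v₂ → IsVal (.pair v₁ v₂)
  | inl {n m : ℕ} {τ : Ty n} {v : Tm n m} : IsVal v → IsVal (.inl τ v)
  | inr {n m : ℕ} {τ : Ty n} {v : Tm n m} : IsVal v → IsVal (.inr τ v)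
  | lam {n m : ℕ} (τ : Ty n) (e : Tm n (m + 1)) : IsVal (.lam τ e)
  | tlam {n m : ℕ} (e : Tm (n + 1) m) : IsVal (.tlam e)
  | pack {n m : ℕ} {τ : Ty n} {v : Tm n m} {τ' : Ty (n + 1)} : IsVal v → IsVal (.pack τ v τ')
  | roll {n m : ℕ} {τ : Ty n} {v : Tm n m} : IsVal v → IsVal (.roll τ v)

/-- The contexts that are (left-to-right, call-by-value) evaluation contexts. -/
inductive IsEval {n m : ℕ} : Ctxt n m n m → Prop
  | hole : IsEval (.hole id id)
  | primL {o : PrimOp} {E : Ctxt n m n m} {e₂ : Tm n m} : IsEval E → IsEval (.primL o E e₂)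
  | primR {o : PrimOp} {v₁ : Tm n m} {E : Ctxt n m n m} :
      IsVal v₁ → IsEval E → IsEval (.primR o v₁ E)
  | ite {E : Ctxt n m n m} {e₁ e₂ : Tm n m} : IsEval E → IsEval (.iteC E e₁ e₂)
  | pairL {E : Ctxt n m n m} {e₂ : Tm n m} : IsEval E → IsEval (.pairL E e₂)
  | pairR {v₁ : Tm n m} {E : Ctxt n m n m} : IsVal v₁ → IsEval E → IsEval (.pairR v₁ E)
  | fst {E : Ctxt n m n m} : IsEval E → IsEval (.fst E)
  | snd {E : Ctxt n m n m} : IsEval E → IsEval (.snd E)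
  | inl {τ : Ty n} {E : Ctxt n m n m} : IsEval E → IsEval (.inl τ E)
  | inr {τ : Ty n} {E : Ctxt n m n m} : IsEval E → IsEval (.inr τ E)
  | case {E : Ctxt n m n m} {e₁ e₂ : Tm n (m + 1)} : IsEval E → IsEval (.caseC E e₁ e₂)
  | appL {E : Ctxt n m n m} {e₂ : Tm n m} : IsEval E → IsEval (.appL E e₂)
  | appR {v₁ : Tm n m} {E : Ctxt n m n m} : IsVal v₁ → IsEval E → IsEval (.appR v₁ E)
  | tapp {E : Ctxt n m n m} {τ : Ty n} : IsEval E → IsEval (.tapp E τ)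
  | pack {τ : Ty n} {E : Ctxt n m n m} {τ' : Ty (n + 1)} : IsEval E → IsEval (.pack τ E τ')
  | unpack {E : Ctxt n m n m} {e₂ : Tm (n + 1) (m + 1)} : IsEval E → IsEval (.unpackL E e₂)
  | roll {τ : Ty n} {E : Ctxt n m n m} : IsEval E → IsEval (.roll τ E)
  | unroll {E : Ctxt n m n m} : IsEval E → IsEval (.unroll E)

/-- The result of a primitive operation on two integers. -/
def PrimOp.eval {n m : ℕ} : PrimOp → ℤ → ℤ → Tm n m
  | .plus, a, b => .int (a + b)
  | .minus, a, b => .int (a - b)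
  | .eq, a, b => .bool (decide (a = b))
  | .lt, a, b => .bool (decide (a < b))
  | .le, a, b => .bool (decide (a ≤ b))

/-- The reduction axioms. The natural number is the number of unroll-roll reductions:
`1` for the axiom `unroll (roll v) ⇝ v`, and `0` for all the others. -/
inductive HeadStep {n m : ℕ} : ℕ → Tm n m → Tm n m → Prop
  | prim (o : PrimOp) (a b : ℤ) : HeadStep 0 (.prim o (.int a) (.int b)) (o.eval a b)
  | iteTrue (e₁ e₂ : Tm n m) : HeadStep 0 (.ite (.bool true) e₁ e₂) e₁
  | iteFalse (e₁ e₂ : Tm n m) : HeadStep 0 (.ite (.bool false) e₁ e₂) e₂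
  | fst {v₁ v₂ : Tm n m} : IsVal v₁ → IsVal v₂ → HeadStep 0 (.fst (.pair v₁ v₂)) v₁
  | snd {v₁ v₂ : Tm n m} : IsVal v₁ → IsVal v₂ → HeadStep 0 (.snd (.pair v₁ v₂)) v₂
  | caseInl {τ : Ty n} {v : Tm n m} (e₁ e₂ : Tm n (m + 1)) : IsVal v →
      HeadStep 0 (.case (.inl τ v) e₁ e₂) (e₁.subst Ty.var (push v Tm.var))
  | caseInr {τ : Ty n} {v : Tm n m} (e₁ e₂ : Tm n (m + 1)) : IsVal v →
      HeadStep 0 (.case (.inr τ v) e₁ e₂) (e₂.subst Ty.var (push v Tm.var))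
  | app {τ : Ty n} {v : Tm n m} (e : Tm n (m + 1)) : IsVal v →
      HeadStep 0 (.app (.lam τ e) v) (e.subst Ty.var (push v Tm.var))
  | tapp (e : Tm (n + 1) m) (τ : Ty n) :
      HeadStep 0 (.tapp (.tlam e) τ) (e.subst (push τ Ty.var) Tm.var)
  | unpack {τ : Ty n} {v : Tm n m} {τ₁ : Ty (n + 1)} (e : Tm (n + 1) (m + 1)) : IsVal v →
      HeadStep 0 (.unpack (.pack τ v τ₁) e) (e.subst (push τ Ty.var) (push v Tm.var))
  | unroll {τ : Ty n} {v : Tm n m} : IsVal v → HeadStep 1 (.unroll (.roll τ v)) v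

/-- One reduction step, labelled with its number (`0` or `1`) of unroll-roll reductions. -/
inductive LStep {n m : ℕ} : ℕ → Tm n m → Tm n m → Prop
  | mk {k : ℕ} {E : Ctxt n m n m} {e e' : Tm n m} :
      IsEval E → HeadStep k e e' → LStep k (E.fill e) (E.fill e')

/-- `e ⇝ e'` -/
def Step {n m : ℕ} (e e' : Tm n m) : Prop := ∃ k, LStep k e e'

/-- `e ⇝* e'` -/
def Steps {n m : ℕ} : Tm n m → Tm n m → Prop := Relation.ReflTransGen Step

/-- `e ⇝* e'` by a reduction sequence with exactly `k` unroll-roll reductions; the cases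
`k = 0` and `k = 1` are `e ⇝⁰ e'` and `e ⇝¹ e'`. -/
inductive StepsN {n m : ℕ} : ℕ → Tm n m → Tm n m → Prop
  | refl (e : Tm n m) : StepsN 0 e e
  | step {j k : ℕ} {e e' e'' : Tm n m} : LStep j e e' → StepsN k e' e'' → StepsN (j + k) e e''

/-- `e ⇓` -/
def Terminates {n m : ℕ} (e : Tm n m) : Prop := ∃ v, Steps e v ∧ IsVal v

/-! ## Contextual approximation and ciu approximation -/

/-- Contextual approximation `Γ ⊢ e₁ ⪯ctx e₂ : τ` (for `Γ ⊢ e₁ : τ` and `Γ ⊢ e₂ : τ`). -/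
def CtxApprox {n m : ℕ} (Γ : TyCtx n m) (e₁ e₂ : Tm n m) (τ : Ty n) : Prop :=
  ∀ (C : Ctxt n m 0 0) (τ' : Ty 0), CtxtTy Γ τ C TyCtx.empty τ' →
    Terminates (C.fill e₁) → Terminates (C.fill e₂)

/-- `⊢ E : τ ⇝ τ'` for an evaluation context `E`. -/
def EvalCtxtTy (E : Ctxt 0 0 0 0) (τ τ' : Ty 0) : Prop :=
  IsEval E ∧ CtxtTy TyCtx.empty τ E TyCtx.empty τ'

/-- Ciu approximation for closed terms, `⊢ e₁ ⪯ciu e₂ : τ`. It relates only terms of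
type `τ`. -/
def CiuClosed (e₁ e₂ : Tm 0 0) (τ : Ty 0) : Prop :=
  HasTy TyCtx.empty e₁ τ ∧ HasTy TyCtx.empty e₂ τ ∧
  ∀ (E : Ctxt 0 0 0 0) (τ' : Ty 0), EvalCtxtTy E τ τ' →
    Terminates (E.fill e₁) → Terminates (E.fill e₂)

/-- `⊢ γ : Γ`, for the closing substitution `γ` given by `σ` on type variables and by `s` on
term variables. -/
def ClosingSubst {n m : ℕ} (Γ : TyCtx n m) (σ : Fin n → Ty 0) (s : Fin m → Tm 0 0) : Prop :=
  ∀ i, IsVal (s i) ∧ HasTy TyCtx.empty (s i) ((Γ i).subst σ)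

/-- Ciu approximation for open terms, `Γ ⊢ e₁ ⪯ciu e₂ : τ`
(for `Γ ⊢ e₁ : τ` and `Γ ⊢ e₂ : τ`). -/
def CiuApprox {n m : ℕ} (Γ : TyCtx n m) (e₁ e₂ : Tm n m) (τ : Ty n) : Prop :=
  ∀ (σ : Fin n → Ty 0) (s : Fin m → Tm 0 0), ClosingSubst Γ σ s →
    CiuClosed (e₁.subst σ s) (e₂.subst σ s) (τ.subst σ)

/-! # The logic LSLR

Relations are deeply embedded. `Rel n m Δ k` is the type of relations of arity `k` whose free
F^μ variables are among `n` type variables and `m` term variables, and whose free relation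
variables are those of the relation context `Δ`, a list of arities. -/

/-- Relation variables of arity `k` bound in the relation context `Δ`. -/
inductive RVar : List ℕ → ℕ → Type
  | zero {k : ℕ} {Δ : List ℕ} : RVar (k :: Δ) k
  | succ {j k : ℕ} {Δ : List ℕ} (r : RVar Δ k) : RVar (j :: Δ) k

/-- The de Bruijn index of a relation variable. -/
def RVar.idx : {Δ : List ℕ} → {k : ℕ} → RVar Δ k → ℕ
  | _, _, .zero => 0
  | _, _, .succ r => r.idx + 1

/-- Syntax of LSLR. A block of F^μ variables (`∀𝒳`, `∃𝒳`, or the `x̄` in `x̄.P`) is bound by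
extending the scope at its end: variable `i` of the old scope becomes `Fin.castAdd _ i`, and
the `i`-th new variable is `Fin.natAdd _ i`. -/
inductive Rel : ℕ → ℕ → List ℕ → ℕ → Type
  | var {n m : ℕ} {Δ : List ℕ} {k : ℕ} (r : RVar Δ k) : Rel n m Δ k
  /-- `e₁ = e₂` -/
  | eq {n m : ℕ} {Δ : List ℕ} (e₁ e₂ : Tm n m) : Rel n m Δ 0
  /-- `Val` -/
  | val {n m : ℕ} {Δ : List ℕ} : Rel n m Δ 1
  /-- `e : τ` -/
  | hasTy {n m : ℕ} {Δ : List ℕ} (e : Tm n m) (τ : Ty n) : Rel n m Δ 0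
  /-- `C : τ ⇝ τ'` -/
  | ctxtTy {n m : ℕ} {Δ : List ℕ} (C : Ctxt 0 0 n m) (τ τ' : Ty n) : Rel n m Δ 0
  /-- `e₁ ⇝* e₂` -/
  | steps {n m : ℕ} {Δ : List ℕ} (e₁ e₂ : Tm n m) : Rel n m Δ 0
  /-- `e₁ ⇝⁰ e₂` -/
  | steps0 {n m : ℕ} {Δ : List ℕ} (e₁ e₂ : Tm n m) : Rel n m Δ 0
  /-- `e₁ ⇝¹ e₂` -/
  | steps1 {n m : ℕ} {Δ : List ℕ} (e₁ e₂ : Tm n m) : Rel n m Δ 0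
  /-- `e₁ ⪯ e₂` -/
  | ciu {n m : ℕ} {Δ : List ℕ} (e₁ e₂ : Tm n m) : Rel n m Δ 0
  | top {n m : ℕ} {Δ : List ℕ} : Rel n m Δ 0
  | bot {n m : ℕ} {Δ : List ℕ} : Rel n m Δ 0
  | and {n m : ℕ} {Δ : List ℕ} (P Q : Rel n m Δ 0) : Rel n m Δ 0
  | or {n m : ℕ} {Δ : List ℕ} (P Q : Rel n m Δ 0) : Rel n m Δ 0
  | imp {n m : ℕ} {Δ : List ℕ} (P Q : Rel n m Δ 0) : Rel n m Δ 0
  /-- `∀𝒳.P`, where `𝒳` consists of `a` type variables and `b` term variables -/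
  | all {n m : ℕ} {Δ : List ℕ} (a b : ℕ) (P : Rel (n + a) (m + b) Δ 0) : Rel n m Δ 0
  /-- `∃𝒳.P`, where `𝒳` consists of `a` type variables and `b` term variables -/
  | ex {n m : ℕ} {Δ : List ℕ} (a b : ℕ) (P : Rel (n + a) (m + b) Δ 0) : Rel n m Δ 0
  /-- `∀r.P`, where `r` has arity `j` -/
  | allR {n m : ℕ} {Δ : List ℕ} (j : ℕ) (P : Rel n m (j :: Δ) 0) : Rel n m Δ 0
  /-- `∃r.P`, where `r` has arity `j` -/
  | exR {n m : ℕ} {Δ : List ℕ} (j : ℕ) (P : Rel n m (j :: Δ) 0) : Rel n m Δ 0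
  /-- `x̄.P` -/
  | comp {n m : ℕ} {Δ : List ℕ} (k : ℕ) (P : Rel n (m + k) Δ 0) : Rel n m Δ k
  /-- `ē ∈ R` -/
  | mem {n m : ℕ} {Δ : List ℕ} {k : ℕ} (es : Fin k → Tm n m) (R : Rel n m Δ k) : Rel n m Δ 0
  /-- `μr.R` -/
  | mu {n m : ℕ} {Δ : List ℕ} {k : ℕ} (R : Rel n m (k :: Δ) k) : Rel n m Δ k
  /-- `▷ P` -/
  | later {n m : ℕ} {Δ : List ℕ} (P : Rel n m Δ 0) : Rel n m Δ 0

/-- `R.GuardedAt i`: the relation variable with index `i` occurs in `R` only under `▷`. -/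
def Rel.GuardedAt : {n m : ℕ} → {Δ : List ℕ} → {k : ℕ} → Rel n m Δ k → ℕ → Prop
  | _, _, _, _, .var r, i => r.idx ≠ i
  | _, _, _, _, .and P Q, i => P.GuardedAt i ∧ Q.GuardedAt i
  | _, _, _, _, .or P Q, i => P.GuardedAt i ∧ Q.GuardedAt i
  | _, _, _, _, .imp P Q, i => P.GuardedAt i ∧ Q.GuardedAt i
  | _, _, _, _, .all _ _ P, i => P.GuardedAt i
  | _, _, _, _, .ex _ _ P, i => P.GuardedAt i
  | _, _, _, _, .allR _ P, i => P.GuardedAt (i + 1)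
  | _, _, _, _, .exR _ P, i => P.GuardedAt (i + 1)
  | _, _, _, _, .comp _ P, i => P.GuardedAt i
  | _, _, _, _, .mem _ R, i => R.GuardedAt i
  | _, _, _, _, .mu R, i => R.GuardedAt (i + 1)
  | _, _, _, _, .later _, _ => True
  | _, _, _, _, .eq _ _, _ => True
  | _, _, _, _, .val, _ => True
  | _, _, _, _, .hasTy _ _, _ => True
  | _, _, _, _, .ctxtTy _ _ _, _ => True
  | _, _, _, _, .steps _ _, _ => True
  | _, _, _, _, .steps0 _ _, _ => True
  | _, _, _, _, .steps1 _ _, _ => True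
  | _, _, _, _, .ciu _ _, _ => True
  | _, _, _, _, .top, _ => True
  | _, _, _, _, .bot, _ => True

/-- Well-formedness. Scopes and arities are correct by construction; what remains is that in
every `μr.R` the body `R` is contractive in `r`. -/
def Rel.WF : {n m : ℕ} → {Δ : List ℕ} → {k : ℕ} → Rel n m Δ k → Prop
  | _, _, _, _, .and P Q => P.WF ∧ Q.WF
  | _, _, _, _, .or P Q => P.WF ∧ Q.WF
  | _, _, _, _, .imp P Q => P.WF ∧ Q.WF
  | _, _, _, _, .all _ _ P => P.WF
  | _, _, _, _, .ex _ _ P => P.WF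
  | _, _, _, _, .allR _ P => P.WF
  | _, _, _, _, .exR _ P => P.WF
  | _, _, _, _, .comp _ P => P.WF
  | _, _, _, _, .mem _ R => R.WF
  | _, _, _, _, .mu R => R.GuardedAt 0 ∧ R.WF
  | _, _, _, _, .later P => P.WF
  | _, _, _, _, .var _ => True
  | _, _, _, _, .eq _ _ => True
  | _, _, _, _, .val => True
  | _, _, _, _, .hasTy _ _ => True
  | _, _, _, _, .ctxtTy _ _ _ => True
  | _, _, _, _, .steps _ _ => True
  | _, _, _, _, .steps0 _ _ => True
  | _, _, _, _, .steps1 _ _ => True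
  | _, _, _, _, .ciu _ _ => True
  | _, _, _, _, .top => True
  | _, _, _, _, .bot => True

/-- Lift a renaming of variables under a block of `a` new variables. -/
def liftBlock {n n' : ℕ} (a : ℕ) (f : Fin n → Fin n') : Fin (n + a) → Fin (n' + a) :=
  Fin.append (fun i => Fin.castAdd a (f i)) (Fin.natAdd n')

/-- Renamings of relation variables. -/
abbrev RRen (Δ Δ' : List ℕ) : Type := ∀ k, RVar Δ k → RVar Δ' k

def RRen.lift {Δ Δ' : List ℕ} (h : RRen Δ Δ') (j : ℕ) : RRen (j :: Δ) (j :: Δ')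
  | _, .zero => .zero
  | _, .succ r => .succ (h _ r)

/-- Rename the free variables of a relation. -/
def Rel.rename : {n n' m m' : ℕ} → {Δ Δ' : List ℕ} → {k : ℕ} →
    (Fin n → Fin n') → (Fin m → Fin m') → RRen Δ Δ' → Rel n m Δ k → Rel n' m' Δ' k
  | _, _, _, _, _, _, _, _, _, h, .var r => .var (h _ r)
  | _, _, _, _, _, _, _, f, g, _, .eq e₁ e₂ => .eq (e₁.rename f g) (e₂.rename f g)
  | _, _, _, _, _, _, _, _, _, _, .val => .val
  | _, _, _, _, _, _, _, f, g, _, .hasTy e τ => .hasTy (e.rename f g) (τ.rename f)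
  | _, _, _, _, _, _, _, f, g, _, .ctxtTy C τ τ' =>
      .ctxtTy (C.subst (fun i => .var (f i)) (fun i => .var (g i))) (τ.rename f) (τ'.rename f)
  | _, _, _, _, _, _, _, f, g, _, .steps e₁ e₂ => .steps (e₁.rename f g) (e₂.rename f g)
  | _, _, _, _, _, _, _, f, g, _, .steps0 e₁ e₂ => .steps0 (e₁.rename f g) (e₂.rename f g)
  | _, _, _, _, _, _, _, f, g, _, .steps1 e₁ e₂ => .steps1 (e₁.rename f g) (e₂.rename f g)
  | _, _, _, _, _, _, _, f, g, _, .ciu e₁ e₂ => .ciu (e₁.rename f g) (e₂.rename f g)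
  | _, _, _, _, _, _, _, _, _, _, .top => .top
  | _, _, _, _, _, _, _, _, _, _, .bot => .bot
  | _, _, _, _, _, _, _, f, g, h, .and P Q => .and (P.rename f g h) (Q.rename f g h)
  | _, _, _, _, _, _, _, f, g, h, .or P Q => .or (P.rename f g h) (Q.rename f g h)
  | _, _, _, _, _, _, _, f, g, h, .imp P Q => .imp (P.rename f g h) (Q.rename f g h)
  | _, _, _, _, _, _, _, f, g, h, .all a b P =>
      .all a b (P.rename (liftBlock a f) (liftBlock b g) h)
  | _, _, _, _, _, _, _, f, g, h, .ex a b P =>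
      .ex a b (P.rename (liftBlock a f) (liftBlock b g) h)
  | _, _, _, _, _, _, _, f, g, h, .allR j P => .allR j (P.rename f g (h.lift j))
  | _, _, _, _, _, _, _, f, g, h, .exR j P => .exR j (P.rename f g (h.lift j))
  | _, _, _, _, _, _, _, f, g, h, .comp k P => .comp k (P.rename f (liftBlock k g) h)
  | _, _, _, _, _, _, _, f, g, h, .mem es R =>
      .mem (fun i => (es i).rename f g) (R.rename f g h)
  | _, _, _, _, _, _, _, f, g, h, .mu R => .mu (R.rename f g (h.lift _))
  | _, _, _, _, _, _, _, f, g, h, .later P => .later (P.rename f g h)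

/-- Weakening of a relation by `a` type variables and `b` term variables. -/
def Rel.wk {n m : ℕ} {Δ : List ℕ} {k : ℕ} (a b : ℕ) (R : Rel n m Δ k) :
    Rel (n + a) (m + b) Δ k :=
  R.rename (Fin.castAdd a) (Fin.castAdd b) (fun _ r => r)

/-- Weakening of a relation by a relation variable of arity `j`. -/
def Rel.wkR {n m : ℕ} {Δ : List ℕ} {k : ℕ} (j : ℕ) (R : Rel n m Δ k) : Rel n m (j :: Δ) k :=
  R.rename id id (fun _ r => .succ r)

/-! ## The Kripke model -/

/-- World-indexed relations of arity `k` on closed terms. -/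
abbrev WRel (k : ℕ) : Type := ℕ → (Fin k → Tm 0 0) → Prop

/-- Monotonicity: what is true in a world is true in all future (smaller) worlds. A *semantic
relation* is a monotone world-indexed relation. -/
def WRel.Mono {k : ℕ} (S : WRel k) : Prop :=
  ∀ (i j : ℕ) (es : Fin k → Tm 0 0), i ≤ j → S j es → S i es

/-- Interpretations of relation variables. -/
abbrev REnv (Δ : List ℕ) : Type := ∀ k, RVar Δ k → WRel k

def REnv.cons {Δ : List ℕ} {j : ℕ} (S : WRel j) (δ : REnv Δ) : REnv (j :: Δ)
  | _, .zero => S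
  | _, .succ r => δ _ r

/-- Relation defined by recursion on strictly future worlds: its value in world `w` is that of
`F X`, for an `X` that coincides with it in the worlds `v < w`. -/
def worldFix {k : ℕ} (F : WRel k → WRel k) (w : ℕ) (es : Fin k → Tm 0 0) : Prop :=
  F (fun v es' => ∃ _ : v < w, worldFix F v es') w es
termination_by w

/-- `R.interp σ s δ w ē`: the tuple `ē` belongs to `R` in world `w`, where the free type, term
and relation variables of `R` are interpreted by the closing substitution `σ`, `s` and by `δ`.
In world `0` everything is true. -/
def Rel.interp : {n m : ℕ} → {Δ : List ℕ} → {k : ℕ} → Rel n m Δ k →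
    (Fin n → Ty 0) → (Fin m → Tm 0 0) → REnv Δ → WRel k
  | _, _, _, _, _, _, _, _, 0, _ => True
  | _, _, _, _, .var r, _, _, δ, w + 1, es => δ _ r (w + 1) es
  | _, _, _, _, .eq e₁ e₂, σ, s, _, _ + 1, _ => e₁.subst σ s = e₂.subst σ s
  | _, _, _, _, .val, _, _, _, _ + 1, es => IsVal (es 0)
  | _, _, _, _, .hasTy e τ, σ, s, _, _ + 1, _ =>
      HasTy TyCtx.empty (e.subst σ s) (τ.subst σ)
  | _, _, _, _, .ctxtTy C τ τ', σ, s, _, _ + 1, _ =>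
      EvalCtxtTy (C.subst σ s) (τ.subst σ) (τ'.subst σ)
  | _, _, _, _, .steps e₁ e₂, σ, s, _, _ + 1, _ => Steps (e₁.subst σ s) (e₂.subst σ s)
  | _, _, _, _, .steps0 e₁ e₂, σ, s, _, _ + 1, _ => StepsN 0 (e₁.subst σ s) (e₂.subst σ s)
  | _, _, _, _, .steps1 e₁ e₂, σ, s, _, _ + 1, _ => StepsN 1 (e₁.subst σ s) (e₂.subst σ s)
  | _, _, _, _, .ciu e₁ e₂, σ, s, _, _ + 1, _ =>
      ∃ τ : Ty 0, CiuClosed (e₁.subst σ s) (e₂.subst σ s) τ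
  | _, _, _, _, .top, _, _, _, _ + 1, _ => True
  | _, _, _, _, .bot, _, _, _, _ + 1, _ => False
  | _, _, _, _, .and P Q, σ, s, δ, w + 1, es =>
      P.interp σ s δ (w + 1) es ∧ Q.interp σ s δ (w + 1) es
  | _, _, _, _, .or P Q, σ, s, δ, w + 1, es =>
      P.interp σ s δ (w + 1) es ∨ Q.interp σ s δ (w + 1) es
  | _, _, _, _, .imp P Q, σ, s, δ, w + 1, es =>
      ∀ v ≤ w + 1, P.interp σ s δ v es → Q.interp σ s δ v es
  | _, _, _, _, .all a b P, σ, s, δ, w + 1, es =>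
      ∀ (σ' : Fin a → Ty 0) (s' : Fin b → Tm 0 0),
        P.interp (Fin.append σ σ') (Fin.append s s') δ (w + 1) es
  | _, _, _, _, .ex a b P, σ, s, δ, w + 1, es =>
      ∃ (σ' : Fin a → Ty 0) (s' : Fin b → Tm 0 0),
        P.interp (Fin.append σ σ') (Fin.append s s') δ (w + 1) es
  | _, _, _, _, .allR j P, σ, s, δ, w + 1, es =>
      ∀ S : WRel j, S.Mono → P.interp σ s (REnv.cons S δ) (w + 1) es
  | _, _, _, _, .exR j P, σ, s, δ, w + 1, es =>
      ∃ S : WRel j, S.Mono ∧ P.interp σ s (REnv.cons S δ) (w + 1) es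
  | _, _, _, _, .comp _ P, σ, s, δ, w + 1, es =>
      P.interp σ (Fin.append s es) δ (w + 1) Fin.elim0
  | _, _, _, _, .mem es' R, σ, s, δ, w + 1, _ =>
      R.interp σ s δ (w + 1) (fun i => (es' i).subst σ s)
  | _, _, _, _, .mu R, σ, s, δ, w + 1, es =>
      worldFix (fun S => R.interp σ s (REnv.cons S δ)) (w + 1) es
  | _, _, _, _, .later P, σ, s, δ, w + 1, es => P.interp σ s δ w es

/-- The interpretation of `R` in world `w` depends on a variable that is contractive in `R` only
through its values in the worlds `v < w`, and on the others through the worlds `v ≤ w`. -/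
theorem Rel.interp_congr {n m : ℕ} {Δ : List ℕ} {k : ℕ} (R : Rel n m Δ k) :
    ∀ (σ : Fin n → Ty 0) (s : Fin m → Tm 0 0) (δ δ' : REnv Δ) (w : ℕ),
      (∀ k (r : RVar Δ k) v, (v < w ∨ v = w ∧ ¬ R.GuardedAt r.idx) → δ k r v = δ' k r v) →
      ∀ v ≤ w, R.interp σ s δ v = R.interp σ s δ' v := by
  have cons : ∀ {Δ : List ℕ} {j : ℕ} (S : WRel j) (δ δ' : REnv Δ) (w : ℕ) (p : ℕ → Prop),
      (∀ k (r : RVar Δ k) v, (v < w ∨ v = w ∧ ¬ p (r.idx + 1)) → δ k r v = δ' k r v) →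
      (∀ k (r : RVar (j :: Δ) k) v, (v < w ∨ v = w ∧ ¬ p r.idx) →
        REnv.cons S δ k r v = REnv.cons S δ' k r v) := by
    intro Δ j S δ δ' w p H k r v hv
    cases r with
    | zero => rfl
    | succ r => exact H k r v hv
  induction R <;> intro σ s δ δ' w H v hv
  all_goals
    rcases v with _ | v
    · funext es; simp only [Rel.interp]
  all_goals funext es; simp only [Rel.interp]
  case var r =>
    rcases hv.lt_or_eq with h | h
    · rw [H _ r (v+1) (Or.inl h)]
    · rw [H _ r (v+1) (Or.inr ⟨h, by simp [Rel.GuardedAt]⟩)]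
  case and ih₁ ih₂ =>
    rw [ih₁ σ s δ δ' w (fun k r u hu => H k r u (hu.imp id fun h => ⟨h.1, fun h' => h.2 h'.1⟩)) _ hv,
      ih₂ σ s δ δ' w (fun k r u hu => H k r u (hu.imp id fun h => ⟨h.1, fun h' => h.2 h'.2⟩)) _ hv]
  case or ih₁ ih₂ =>
    rw [ih₁ σ s δ δ' w (fun k r u hu => H k r u (hu.imp id fun h => ⟨h.1, fun h' => h.2 h'.1⟩)) _ hv,
      ih₂ σ s δ δ' w (fun k r u hu => H k r u (hu.imp id fun h => ⟨h.1, fun h' => h.2 h'.2⟩)) _ hv]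
  case imp ih₁ ih₂ =>
    refine propext (forall_congr' fun u => forall_congr' fun hu => ?_)
    rw [ih₁ σ s δ δ' w (fun k r u hu => H k r u (hu.imp id fun h => ⟨h.1, fun h' => h.2 h'.1⟩)) _
      (hu.trans hv),
      ih₂ σ s δ δ' w (fun k r u hu => H k r u (hu.imp id fun h => ⟨h.1, fun h' => h.2 h'.2⟩)) _
      (hu.trans hv)]
  case all ih =>
    refine propext (forall_congr' fun σ' => forall_congr' fun s' => ?_)
    rw [ih _ _ δ δ' w H _ hv]
  case ex ih =>
    refine propext (exists_congr fun σ' => exists_congr fun s' => ?_)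
    rw [ih _ _ δ δ' w H _ hv]
  case allR P ih =>
    refine propext (forall_congr' fun S => forall_congr' fun _ => ?_)
    rw [ih _ _ _ _ w (cons S δ δ' w P.GuardedAt H) _ hv]
  case exR P ih =>
    refine propext (exists_congr fun S => and_congr_right fun _ => ?_)
    rw [ih _ _ _ _ w (cons S δ δ' w P.GuardedAt H) _ hv]
  case comp ih => rw [ih _ _ δ δ' w H _ hv]
  case mem ih => rw [ih _ _ δ δ' w H _ hv]
  case mu R ih =>
    have key : ∀ u ≤ w, worldFix (fun S => R.interp σ s (REnv.cons S δ)) u =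
        worldFix (fun S => R.interp σ s (REnv.cons S δ')) u := by
      intro u
      induction u using Nat.strong_induction_on with
      | _ u ihu =>
        intro hu
        funext es
        rw [worldFix, worldFix]
        have : (fun v es' => ∃ _ : v < u, worldFix (fun S => R.interp σ s (REnv.cons S δ)) v es') =
            (fun v es' => ∃ _ : v < u, worldFix (fun S => R.interp σ s (REnv.cons S δ')) v es') := by
          funext v es'
          refine propext (exists_congr fun hv => ?_)
          rw [ihu v hv (hv.le.trans hu)]
        rw [this]
        rw [ih _ _ _ _ w (cons _ δ δ' w R.GuardedAt H) _ hu]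
    rw [key _ hv]
  case later P ih =>
    rw [ih _ _ δ δ' v (fun k r u hu => H k r u (Or.inl ?_)) v le_rfl]
    rcases hu with h | h <;> omega

/-- A recursive relation means the same as its expansion. -/
theorem Rel.interp_mu {n m : ℕ} {Δ : List ℕ} {k : ℕ} (R : Rel n m (k :: Δ) k)
    (hR : R.GuardedAt 0) (σ : Fin n → Ty 0) (s : Fin m → Tm 0 0) (δ : REnv Δ) :
    (Rel.mu R).interp σ s δ = R.interp σ s (REnv.cons ((Rel.mu R).interp σ s δ) δ) := by
  have e : ∀ w, (Rel.mu R).interp σ s δ w = worldFix (fun S => R.interp σ s (REnv.cons S δ)) w := by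
    intro w
    cases w with
    | zero => funext es; rw [worldFix]; simp only [Rel.interp]
    | succ w => funext es; simp only [Rel.interp]
  funext w
  rw [e]
  funext es
  rw [worldFix]
  refine congrFun (Rel.interp_congr R σ s _ _ w ?_ w le_rfl) es
  intro j r v hv
  cases r with
  | zero =>
    have hv : v < w := by
      rcases hv with h | h
      · exact h
      · exact absurd hR h.2
    funext es'
    change (∃ _ : v < w, _) = (Rel.mu R).interp σ s δ v es'
    rw [e]
    simp [hv]
  | succ r => rfl

/-- The logical judgment `𝒳; ℛ; 𝒫 ⊢ P`, where `𝒳` consists of `n` type variables and `m` term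
variables and `ℛ` is `Δ`. -/
def Entails {n m : ℕ} {Δ : List ℕ} (Ps : Set (Rel n m Δ 0)) (P : Rel n m Δ 0) : Prop :=
  ∀ (w : ℕ) (σ : Fin n → Ty 0) (s : Fin m → Tm 0 0) (δ : REnv Δ),
    (∀ k (r : RVar Δ k), (δ k r).Mono) →
    (∀ Q ∈ Ps, Q.interp σ s δ w Fin.elim0) → P.interp σ s δ w Fin.elim0

/-! # The logical relation -/

/-- `e ↓ τ` -/
def Rel.valTy {n m : ℕ} {Δ : List ℕ} (e : Tm n m) (τ : Ty n) : Rel n m Δ 0 :=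
  .and (.hasTy e τ) (.mem ![e] .val)

/-- `e₁ ⇓⁰ e₂` -/
def Rel.evals0 {n m : ℕ} {Δ : List ℕ} (e₁ e₂ : Tm n m) : Rel n m Δ 0 :=
  .and (.steps0 e₁ e₂) (.mem ![e₂] .val)

/-- The `i`-th variable of the innermost block of `b` term variables. -/
abbrev Tm.new {n : ℕ} (m : ℕ) {b : ℕ} (i : Fin b) : Tm n (m + b) := .var (Fin.natAdd m i)

/-- Weakening of a term by `a` type variables and `b` term variables. -/
def Tm.wk {n m : ℕ} (a b : ℕ) (e : Tm n m) : Tm (n + a) (m + b) :=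
  e.rename (Fin.castAdd a) (Fin.castAdd b)

/-- `(x₁ : τ₁, x₂ : τ₂). P` -/
def Rel.pairTy {n m : ℕ} {Δ : List ℕ} (τ₁ τ₂ : Ty n) (P : Rel n (m + 2) Δ 0) : Rel n m Δ 2 :=
  .comp 2 (.and (.hasTy (.new m 0) τ₁) (.and (.hasTy (.new m 1) τ₂) P))

/-- `(x₁ ↓ τ₁, x₂ ↓ τ₂). P` -/
def Rel.pairVal {n m : ℕ} {Δ : List ℕ} (τ₁ τ₂ : Ty n) (P : Rel n (m + 2) Δ 0) : Rel n m Δ 2 :=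
  .comp 2 (.and (.valTy (.new m 0) τ₁) (.and (.valTy (.new m 1) τ₂) P))

/-- `R : VRel(τ₁, τ₂)` -/
def Rel.isVRel {n m : ℕ} {Δ : List ℕ} (R : Rel n m Δ 2) (τ₁ τ₂ : Ty n) : Rel n m Δ 0 :=
  .all 0 2 (.imp (.mem ![.new m 0, .new m 1] (R.wk 0 2))
    (.and (.valTy (.new m 0) τ₁) (.valTy (.new m 1) τ₂)))

/-- A triple `(τ₁, τ₂, R)`, interpreting a type variable. -/
structure TyInterp (n m : ℕ) (Δ : List ℕ) : Type where
  left : Ty n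
  right : Ty n
  rel : Rel n m Δ 2

/-- Relational interpretations `ρ` of `p` type variables. -/
abbrev TyEnv (p n m : ℕ) (Δ : List ℕ) : Type := Fin p → TyInterp n m Δ

/-- `ρ₁τ` -/
def TyEnv.substL {p n m : ℕ} {Δ : List ℕ} (ρ : TyEnv p n m Δ) (τ : Ty p) : Ty n :=
  τ.subst (fun i => (ρ i).left)

/-- `ρ₂τ` -/
def TyEnv.substR {p n m : ℕ} {Δ : List ℕ} (ρ : TyEnv p n m Δ) (τ : Ty p) : Ty n :=
  τ.subst (fun i => (ρ i).right)

/-- `ρ` in a scope with `a` more type variables and `b` more term variables. -/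
def TyEnv.wk {p n m : ℕ} {Δ : List ℕ} (a b : ℕ) (ρ : TyEnv p n m Δ) :
    TyEnv p (n + a) (m + b) Δ :=
  fun i => ⟨(ρ i).left.rename (Fin.castAdd a), (ρ i).right.rename (Fin.castAdd a),
    (ρ i).rel.wk a b⟩

/-- `ρ` in a scope with one more relation variable, of arity `j`. -/
def TyEnv.wkR {p n m : ℕ} {Δ : List ℕ} (j : ℕ) (ρ : TyEnv p n m Δ) : TyEnv p n m (j :: Δ) :=
  fun i => ⟨(ρ i).left, (ρ i).right, (ρ i).rel.wkR j⟩

/-- `ρ, α ↦ (τ₁, τ₂, R)` -/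
def TyEnv.ext {p n m : ℕ} {Δ : List ℕ} (ρ : TyEnv p n m Δ) (τ₁ τ₂ : Ty n) (R : Rel n m Δ 2) :
    TyEnv (p + 1) n m Δ :=
  push ⟨τ₁, τ₂, R⟩ ρ

/-- The term relation built from a value relation: if `R` is `𝒱⟦τ⟧ρ`, `τ₁` is `ρ₁τ` and `τ₂` is
`ρ₂τ`, this is

`ℰ⟦τ⟧ρ = μr. (t₁ : ρ₁τ, t₂ : ρ₂τ).
  (∀x₁. t₁ ⇓⁰ x₁ ⇒ ∃x₂. x₂ ⪯ t₂ ∧ (x₁, x₂) ∈ 𝒱⟦τ⟧ρ) ∧ (∀t₁'. t₁ ⇝¹ t₁' ⇒ ▷ (t₁', t₂) ∈ r)`. -/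
def Rel.termRel {n m : ℕ} {Δ : List ℕ} (τ₁ τ₂ : Ty n) (R : Rel n m Δ 2) : Rel n m Δ 2 :=
  let t₁ : Tm n (m + 2) := .new m 0
  let t₂ : Tm n (m + 2) := .new m 1
  let x₁ : Tm n (m + 2 + 1) := .new (m + 2) 0
  let x₂ : Tm n (m + 2 + 1 + 1) := .new (m + 2 + 1) 0
  .mu (.pairTy τ₁ τ₂
    (.and
      (.all 0 1 (.imp (.evals0 (t₁.wk 0 1) x₁)
        (.ex 0 1 (.and (.ciu x₂ ((t₂.wk 0 1).wk 0 1))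
          (.mem ![x₁.wk 0 1, x₂] ((((R.wkR 2).wk 0 2).wk 0 1).wk 0 1))))))
      (.all 0 1 (.imp (.steps1 (t₁.wk 0 1) x₁)
        (.later (.mem ![x₁, t₂.wk 0 1] (.var .zero)))))))

/-- The value relation `𝒱⟦τ⟧ρ`. -/
def valRel : {p : ℕ} → Ty p → {n m : ℕ} → {Δ : List ℕ} → TyEnv p n m Δ → Rel n m Δ 2
  | _, .var α, _, _, _, ρ => (ρ α).rel
  | _, .unit, _, m, _, _ => .pairVal .unit .unit (.eq (.new m 0) (.new m 1))
  | _, .int, _, m, _, _ => .pairVal .int .int (.eq (.new m 0) (.new m 1))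
  | _, .bool, _, m, _, _ => .pairVal .bool .bool (.eq (.new m 0) (.new m 1))
  | _, .prod τ τ', _, m, _, ρ =>
      let y := Tm.new (m + 2) (b := 4)
      .pairVal (ρ.substL (.prod τ τ')) (ρ.substR (.prod τ τ'))
        (.ex 0 4
          (.and (.eq ((Tm.new m 0).wk 0 4) (.pair (y 0) (y 1)))
          (.and (.eq ((Tm.new m 1).wk 0 4) (.pair (y 2) (y 3)))
          (.and (.mem ![y 0, y 2] (valRel τ ((ρ.wk 0 2).wk 0 4)))
            (.mem ![y 1, y 3] (valRel τ' ((ρ.wk 0 2).wk 0 4)))))))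
  | _, .sum τ τ', _, m, _, ρ =>
      let y := Tm.new (m + 2) (b := 2)
      let ρ' := (ρ.wk 0 2).wk 0 2
      .pairVal (ρ.substL (.sum τ τ')) (ρ.substR (.sum τ τ'))
        (.or
          (.ex 0 2
            (.and (.eq ((Tm.new m 0).wk 0 2) (.inl (ρ'.substL (.sum τ τ')) (y 0)))
            (.and (.eq ((Tm.new m 1).wk 0 2) (.inl (ρ'.substR (.sum τ τ')) (y 1)))
              (.mem ![y 0, y 1] (valRel τ ρ')))))
          (.ex 0 2
            (.and (.eq ((Tm.new m 0).wk 0 2) (.inr (ρ'.substL (.sum τ τ')) (y 0)))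
            (.and (.eq ((Tm.new m 1).wk 0 2) (.inr (ρ'.substR (.sum τ τ')) (y 1)))
              (.mem ![y 0, y 1] (valRel τ' ρ'))))))
  | _, .arr τ τ', _, m, _, ρ =>
      let y := Tm.new (m + 2) (b := 2)
      let ρ' := (ρ.wk 0 2).wk 0 2
      .pairVal (ρ.substL (.arr τ τ')) (ρ.substR (.arr τ τ'))
        (.all 0 2
          (.imp (.mem ![y 0, y 1] (valRel τ ρ'))
            (.mem ![.app ((Tm.new m 0).wk 0 2) (y 0), .app ((Tm.new m 1).wk 0 2) (y 1)]
              (.termRel (ρ'.substL τ') (ρ'.substR τ') (valRel τ' ρ')))))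
  | _, .all τ, n, m, _, ρ =>
      let α := fun i : Fin 2 => Ty.var (Fin.natAdd n i)
      let ρ' := (((ρ.wk 0 2).wk 2 0).wkR 2).ext (α 0) (α 1) (.var .zero)
      .pairVal (ρ.substL (.all τ)) (ρ.substR (.all τ))
        (.all 2 0 (.allR 2
          (.imp (.isVRel (.var .zero) (α 0) (α 1))
            (.mem ![.tapp ((Tm.new m 0).wk 2 0) (α 0), .tapp ((Tm.new m 1).wk 2 0) (α 1)]
              (.termRel (ρ'.substL τ) (ρ'.substR τ) (valRel τ ρ'))))))
  | _, .ex τ, n, m, _, ρ =>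
      let α := fun i : Fin 2 => Ty.var (Fin.natAdd n i)
      let y := Tm.new (m + 2) (b := 2)
      let ρ₀ := ((ρ.wk 0 2).wk 2 2).wkR 2
      let ρ' := ρ₀.ext (α 0) (α 1) (.var .zero)
      .pairVal (ρ.substL (.ex τ)) (ρ.substR (.ex τ))
        (.ex 2 2 (.exR 2
          (.and (.isVRel (.var .zero) (α 0) (α 1))
          (.and (.eq ((Tm.new m 0).wk 2 2)
            (.pack (α 0) (y 0) (τ.subst (liftTy fun i => (ρ₀ i).left))))
          (.and (.eq ((Tm.new m 1).wk 2 2)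
            (.pack (α 1) (y 1) (τ.subst (liftTy fun i => (ρ₀ i).right))))
            (.mem ![y 0, y 1] (valRel τ ρ')))))))
  | _, .mu τ, _, m, _, ρ =>
      let y := Tm.new (m + 2) (b := 2)
      let ρ₀ := ((ρ.wkR 2).wk 0 2).wk 0 2
      let ρ' := ρ₀.ext (ρ₀.substL (.mu τ)) (ρ₀.substR (.mu τ)) (.var .zero)
      .mu (.pairVal (ρ.substL (.mu τ)) (ρ.substR (.mu τ))
        (.ex 0 2
          (.and (.eq ((Tm.new m 0).wk 0 2) (.roll (ρ₀.substL (.mu τ)) (y 0)))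
          (.and (.eq ((Tm.new m 1).wk 0 2) (.roll (ρ₀.substR (.mu τ)) (y 1)))
            (.later (.mem ![y 0, y 1] (valRel τ ρ')))))))

/-- The term relation `ℰ⟦τ⟧ρ`. -/
def expRel {p : ℕ} (τ : Ty p) {n m : ℕ} {Δ : List ℕ} (ρ : TyEnv p n m Δ) : Rel n m Δ 2 :=
  .termRel (ρ.substL τ) (ρ.substR τ) (valRel τ ρ)

/-! ### The logical relation is well formed -/

theorem Rel.guardedAt_rename {n m : ℕ} {Δ : List ℕ} {k : ℕ} (R : Rel n m Δ k) :
    ∀ {n' m' : ℕ} {Δ' : List ℕ} (f : Fin n → Fin n') (g : Fin m → Fin m') (h : RRen Δ Δ')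
      (i : ℕ), (∀ k (r : RVar Δ k), (h k r).idx ≠ i) → (R.rename f g h).GuardedAt i := by
  have lift : ∀ {Δ Δ' : List ℕ} (h : RRen Δ Δ') (j i : ℕ),
      (∀ k (r : RVar Δ k), (h k r).idx ≠ i) →
      ∀ k (r : RVar (j :: Δ) k), (h.lift j k r).idx ≠ i + 1 := by
    intro Δ Δ' h j i H k r
    cases r with
    | zero => simp [RRen.lift, RVar.idx]
    | succ r => simpa [RRen.lift, RVar.idx] using H k r
  induction R <;> intro n' m' Δ' f g h i H <;>
    simp only [Rel.rename, Rel.GuardedAt] <;> first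
    | exact H _ _
    | trivial
    | (rename_i ih₁ ih₂; exact ⟨ih₁ _ _ _ _ H, ih₂ _ _ _ _ H⟩)
    | (rename_i ih; exact ih _ _ _ _ H)
    | (rename_i ih; exact ih _ _ _ _ (lift _ _ _ H))

theorem Rel.guardedAt_rename_of {n m : ℕ} {Δ : List ℕ} {k : ℕ} (R : Rel n m Δ k) :
    ∀ {n' m' : ℕ} {Δ' : List ℕ} (f : Fin n → Fin n') (g : Fin m → Fin m') (h : RRen Δ Δ')
      (i i' : ℕ), (∀ k (r : RVar Δ k), (h k r).idx = i' → r.idx = i) →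
      R.GuardedAt i → (R.rename f g h).GuardedAt i' := by
  have lift : ∀ {Δ Δ' : List ℕ} (h : RRen Δ Δ') (j i i' : ℕ),
      (∀ k (r : RVar Δ k), (h k r).idx = i' → r.idx = i) →
      ∀ k (r : RVar (j :: Δ) k), (h.lift j k r).idx = i' + 1 → r.idx = i + 1 := by
    intro Δ Δ' h j i i' H k r
    cases r with
    | zero => simp [RRen.lift, RVar.idx]
    | succ r => simpa [RRen.lift, RVar.idx] using H k r
  induction R <;> intro n' m' Δ' f g h i i' H <;>
    simp only [Rel.rename, Rel.GuardedAt] <;> first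
    | exact fun hne he => hne (H _ _ he)
    | exact fun _ => trivial
    | (rename_i ih₁ ih₂; exact fun hg => ⟨ih₁ _ _ _ _ _ H hg.1, ih₂ _ _ _ _ _ H hg.2⟩)
    | (rename_i ih; exact ih _ _ _ _ _ H)
    | (rename_i ih; exact ih _ _ _ _ _ (lift _ _ _ _ H))

theorem Rel.wf_rename {n m : ℕ} {Δ : List ℕ} {k : ℕ} (R : Rel n m Δ k) :
    ∀ {n' m' : ℕ} {Δ' : List ℕ} (f : Fin n → Fin n') (g : Fin m → Fin m') (h : RRen Δ Δ'),
      R.WF → (R.rename f g h).WF := by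
  induction R <;> intro n' m' Δ' f g h <;>
    simp only [Rel.rename, Rel.WF] <;> first
    | exact fun _ => trivial
    | (rename_i ih₁ ih₂; exact fun hg => ⟨ih₁ _ _ _ hg.1, ih₂ _ _ _ hg.2⟩)
    | (rename_i ih; exact ih _ _ _)
    | (rename_i ih; refine fun hg => ⟨Rel.guardedAt_rename_of _ _ _ _ 0 0 ?_ hg.1, ih _ _ _ hg.2⟩
       intro k r hr
       cases r with
       | zero => rfl
       | succ r => simp [RRen.lift, RVar.idx] at hr)

theorem termRel_wf {n m : ℕ} {Δ : List ℕ} (τ₁ τ₂ : Ty n) (R : Rel n m Δ 2) (h : R.WF) :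
    (Rel.termRel τ₁ τ₂ R).WF := by
  have h1 := Rel.wf_rename _ id id (fun _ r => .succ r : RRen Δ (2 :: Δ)) h
  refine ⟨⟨trivial, trivial, ⟨⟨trivial, trivial⟩, trivial, ?_⟩, trivial, trivial⟩,
    trivial, trivial, ⟨⟨trivial, trivial⟩, trivial, ?_⟩, trivial, trivial⟩
  · have := Rel.guardedAt_rename R id id (fun _ r => .succ r : RRen Δ (2 :: Δ)) 0
      (fun k r => by simp [RVar.idx])
    exact Rel.guardedAt_rename_of _ _ _ _ 0 0 (fun _ _ h => h)
     (Rel.guardedAt_rename_of _ _ _ _ 0 0 (fun _ _ h => h)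
      (Rel.guardedAt_rename_of _ _ _ _ 0 0 (fun _ _ h => h) this))
  · exact Rel.wf_rename _ _ _ _ (Rel.wf_rename _ _ _ _ (Rel.wf_rename _ _ _ _ h1))

theorem valRel_wf {p : ℕ} (τ : Ty p) : ∀ {n m : ℕ} {Δ : List ℕ} (ρ : TyEnv p n m Δ),
    (∀ i, (ρ i).rel.WF) → (valRel τ ρ).WF := by
  have wk : ∀ {p n m : ℕ} {Δ : List ℕ} (a b : ℕ) (ρ : TyEnv p n m Δ),
      (∀ i, (ρ i).rel.WF) → ∀ i, (ρ.wk a b i).rel.WF :=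
    fun a b ρ h i => Rel.wf_rename _ _ _ _ (h i)
  have wkR : ∀ {p n m : ℕ} {Δ : List ℕ} (j : ℕ) (ρ : TyEnv p n m Δ),
      (∀ i, (ρ i).rel.WF) → ∀ i, (ρ.wkR j i).rel.WF :=
    fun j ρ h i => Rel.wf_rename _ _ _ _ (h i)
  have ext : ∀ {p n m : ℕ} {Δ : List ℕ} (ρ : TyEnv p n m Δ) (τ₁ τ₂ : Ty n) (R : Rel n m Δ 2),
      (∀ i, (ρ i).rel.WF) → R.WF → ∀ i, (ρ.ext τ₁ τ₂ R i).rel.WF := by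
    intro p n m Δ ρ τ₁ τ₂ R h hR i
    refine Fin.cases hR h i
  induction τ with
  | var => intro n m Δ ρ h; exact h _
  | unit => intro n m Δ ρ h; simp [valRel, Rel.pairVal, Rel.valTy, Rel.WF]
  | int => intro n m Δ ρ h; simp [valRel, Rel.pairVal, Rel.valTy, Rel.WF]
  | bool => intro n m Δ ρ h; simp [valRel, Rel.pairVal, Rel.valTy, Rel.WF]
  | prod a b iha ihb =>
    intro n m Δ ρ h
    simp only [valRel, Rel.pairVal, Rel.valTy, Rel.WF, true_and]
    exact ⟨iha _ (wk _ _ _ (wk _ _ _ h)), ihb _ (wk _ _ _ (wk _ _ _ h))⟩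
  | sum a b iha ihb =>
    intro n m Δ ρ h
    simp only [valRel, Rel.pairVal, Rel.valTy, Rel.WF, true_and]
    exact ⟨iha _ (wk _ _ _ (wk _ _ _ h)), ihb _ (wk _ _ _ (wk _ _ _ h))⟩
  | arr a b iha ihb =>
    intro n m Δ ρ h
    simp only [valRel, Rel.pairVal, Rel.valTy, Rel.WF, true_and]
    exact ⟨iha _ (wk _ _ _ (wk _ _ _ h)), termRel_wf _ _ _ (ihb _ (wk _ _ _ (wk _ _ _ h)))⟩
  | all a ih =>
    intro n m Δ ρ h
    simp only [valRel, Rel.pairVal, Rel.valTy, Rel.isVRel, Rel.wk, Rel.rename, Rel.WF, true_and]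
    exact termRel_wf _ _ _ (ih _ (ext _ _ _ _ (wkR _ _ (wk _ _ _ (wk _ _ _ h))) trivial))
  | ex a ih =>
    intro n m Δ ρ h
    simp only [valRel, Rel.pairVal, Rel.valTy, Rel.isVRel, Rel.wk, Rel.rename, Rel.WF, true_and]
    exact ih _ (ext _ _ _ _ (wkR _ _ (wk _ _ _ (wk _ _ _ h))) trivial)
  | mu a ih =>
    intro n m Δ ρ h
    simp only [valRel, Rel.pairVal, Rel.valTy, Rel.GuardedAt, Rel.WF, true_and]
    exact ih _ (ext _ _ _ _ (wk _ _ _ (wk _ _ _ (wkR _ _ h))) trivial)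

theorem expRel_wf {p : ℕ} (τ : Ty p) {n m : ℕ} {Δ : List ℕ} (ρ : TyEnv p n m Δ)
    (h : ∀ i, (ρ i).rel.WF) : (expRel τ ρ).WF :=
  termRel_wf _ _ _ (valRel_wf τ ρ h)

/-! ## Logical approximation -/

/-- The relation variables of a context of `n` binary relation variables. -/
def relVar : {n : ℕ} → Fin n → RVar (List.replicate n 2) 2
  | _ + 1, ⟨0, _⟩ => .zero
  | _ + 1, ⟨i + 1, h⟩ => .succ (relVar ⟨i, Nat.lt_of_succ_lt_succ h⟩)

/-- `αᵢ ↦ (αᵢ¹, αᵢ², rᵢ)` for `n` type variables `αᵢ`; here `αᵢ¹` is `Fin.castAdd n i` and `αᵢ²` is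
`Fin.natAdd n i`. -/
def logEnv (n m : ℕ) : TyEnv n (n + n) m (List.replicate n 2) :=
  fun i => ⟨.var (Fin.castAdd n i), .var (Fin.natAdd n i), .var (relVar i)⟩

/-- The hypotheses `rᵢ : VRel(αᵢ¹, αᵢ²)` and `(xⱼ¹, xⱼ²) ∈ 𝒱⟦τⱼ⟧ρ`; here `xⱼ¹` is
`Fin.castAdd m j` and `xⱼ²` is `Fin.natAdd m j`. -/
def logHyps {n m : ℕ} (Γ : TyCtx n m) : Set (Rel (n + n) (m + m) (List.replicate n 2) 0) :=
  (Set.range fun i : Fin n =>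
    Rel.isVRel (.var (relVar i)) (.var (Fin.castAdd n i)) (.var (Fin.natAdd n i))) ∪
  (Set.range fun j : Fin m =>
    Rel.mem ![.var (Fin.castAdd m j), .var (Fin.natAdd m j)] (valRel (Γ j) (logEnv n (m + m))))

/-- Logical approximation `Γ ⊢ e₁ ⪯log e₂ : τ` (for `Γ ⊢ e₁ : τ` and `Γ ⊢ e₂ : τ`). -/
def LogApprox {n m : ℕ} (Γ : TyCtx n m) (e₁ e₂ : Tm n m) (τ : Ty n) : Prop :=
  let ρ := logEnv n (m + m)
  Entails (logHyps Γ)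
    (.mem ![e₁.subst (fun i => (ρ i).left) (fun j => .var (Fin.castAdd m j)),
        e₂.subst (fun i => (ρ i).right) (fun j => .var (Fin.natAdd m j))]
      (expRel τ ρ))

end FMu

/-!
The three approximations are proved equivalent by a cycle of implications.

*From contextual to ciu approximation.* Abstracting all variables of `Γ` around the hole gives
closed contexts `λx̄. [·]` under type abstractions, which can be plugged into any evaluation
context. Instantiating a closing substitution amounts to evaluation contexts `[·] τ` and `[·] v`, whose
beta reductions do not affect termination, since reduction is deterministic
(`CtxApprox.ciuApprox_fill`).

*From ciu to logical approximation.* The term relation `ℰ⟦τ⟧ρ` demands a value `x₂ ⪯ t₂`, not an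
evaluation of `t₂`, so it absorbs ciu approximation on the right (`semExp.of_ciu`). Applied to the
fundamental theorem `LogRel.refl`, that every well-typed term is logically related to itself, this
gives `CiuApprox.logRel`.

*From logical to contextual approximation.* Logical approximation is compatible with all the
constructs of the language, hence a precongruence (`LogRel.fill`), and it is adequate
(`LogRel.terminates`): if the first term evaluates with `j` unroll-roll reductions, then the term
relation at index `j` provides a value that approximates the second term from below.

To reason about the logical relation, it is first transported from the deeply embedded logic to
the Kripke model. There `𝒱⟦τ⟧ρ` becomes `semVal` (`curry_interp_valRel`), and the recursion of
`ℰ⟦τ⟧ρ` unfolds to an explicit relation `semExp` (`Rel.curry_interp_termRel`): if the first term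
evaluates with `j` unroll-roll reductions, then the values are related from `j` indices later on.
The two technical facts behind compatibility are `semExp.bind`, that related terms may be put into
related evaluation contexts, and `semVal_subst`, that substitution of types is composition of
interpretations; the latter handles the rules for type application, `pack`, `roll` and `unroll`.
-/

namespace FMu

/-! ### Renaming and substitution in types -/

theorem liftTy_var {n n' : ℕ} (f : Fin n → Fin n') :
    liftTy (fun i => Ty.var (f i)) = fun i => Ty.var (liftRen f i) := by
  funext i
  refine Fin.cases ?_ (fun i => ?_) i <;> simp [liftTy, liftRen, Ty.rename]

theorem liftTy_comp_liftRen {n n' n'' : ℕ} (f : Fin n → Fin n') (σ : Fin n' → Ty n'') :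
    (fun i => liftTy σ (liftRen f i)) = liftTy (fun i => σ (f i)) := by
  funext i
  refine Fin.cases ?_ (fun i => ?_) i <;> simp [liftTy, liftRen]

theorem Ty.rename_eq_subst {n : ℕ} (a : Ty n) : ∀ {n' : ℕ} (f : Fin n → Fin n'),
    a.rename f = a.subst (fun i => .var (f i)) := by
  induction a <;> intro n' f <;> simp_all [Ty.rename, Ty.subst, liftTy_var]

theorem Ty.subst_rename {n : ℕ} (a : Ty n) : ∀ {n' n'' : ℕ} (f : Fin n → Fin n')
    (σ : Fin n' → Ty n''), (a.rename f).subst σ = a.subst (fun i => σ (f i)) := by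
  induction a <;> intro n' n'' f σ <;> simp_all [Ty.rename, Ty.subst, liftTy_comp_liftRen]

theorem liftTy_id {n : ℕ} : liftTy (Ty.var : Fin n → Ty n) = Ty.var := by
  have := liftTy_var (id : Fin n → Fin n)
  simp only [id] at this
  rw [this]
  funext i
  refine Fin.cases ?_ (fun i => ?_) i <;> simp [liftRen]

@[simp] theorem Ty.subst_var {n : ℕ} (a : Ty n) : a.subst Ty.var = a := by
  induction a <;> simp_all [Ty.subst, liftTy_id]

@[simp] theorem Ty.rename_id {n : ℕ} (a : Ty n) : a.rename id = a := by
  rw [Ty.rename_eq_subst]; exact a.subst_var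

theorem Ty.rename_rename {n n' n'' : ℕ} (a : Ty n) (f : Fin n → Fin n') (g : Fin n' → Fin n'') :
    (a.rename f).rename g = a.rename (fun i => g (f i)) := by
  rw [Ty.rename_eq_subst _ g, Ty.subst_rename, ← Ty.rename_eq_subst]

theorem liftTy_rename {n n' n'' : ℕ} (σ : Fin n → Ty n') (f : Fin n' → Fin n'') :
    (fun i => (liftTy σ i).rename (liftRen f)) = liftTy (fun i => (σ i).rename f) := by
  funext i
  refine Fin.cases ?_ (fun i => ?_) i <;> simp [liftTy, liftRen, Ty.rename, Ty.rename_rename]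

theorem Ty.rename_subst {n : ℕ} (a : Ty n) : ∀ {n' n'' : ℕ} (σ : Fin n → Ty n')
    (f : Fin n' → Fin n''), (a.subst σ).rename f = a.subst (fun i => (σ i).rename f) := by
  induction a <;> intro n' n'' σ f <;> simp_all [Ty.rename, Ty.subst, liftTy_rename]

theorem liftTy_subst {n n' n'' : ℕ} (σ : Fin n → Ty n') (σ' : Fin n' → Ty n'') :
    (fun i => (liftTy σ i).subst (liftTy σ')) = liftTy (fun i => (σ i).subst σ') := by
  funext i
  refine Fin.cases ?_ (fun i => ?_) i <;>
    simp [liftTy, Ty.subst, Ty.subst_rename, Ty.rename_subst]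

theorem Ty.subst_subst {n : ℕ} (a : Ty n) : ∀ {n' n'' : ℕ} (σ : Fin n → Ty n')
    (σ' : Fin n' → Ty n''), (a.subst σ).subst σ' = a.subst (fun i => (σ i).subst σ') := by
  induction a <;> intro n' n'' σ σ' <;> simp_all [Ty.subst, liftTy_subst]

theorem push_comp {A B : Type} {n : ℕ} (F : A → B) (a : A) (f : Fin n → A) :
    (fun i => F (push a f i)) = push (F a) (fun i => F (f i)) := by
  funext i
  refine Fin.cases ?_ (fun i => ?_) i <;> simp

theorem liftTy_inst {n n' : ℕ} (σ : Fin n → Ty n') (b : Ty n') :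
    (fun i => (liftTy σ i).subst (push b .var)) = push b σ := by
  funext i
  refine Fin.cases ?_ (fun i => ?_) i <;> simp [liftTy, Ty.subst, Ty.subst_rename]

/-- Instantiating the bound variable after a substitution extends the substitution. -/
theorem Ty.subst_lift_inst {n n' : ℕ} (a : Ty (n + 1)) (σ : Fin n → Ty n') (b : Ty n') :
    (a.subst (liftTy σ)).inst b = a.subst (push b σ) := by
  rw [Ty.inst, Ty.subst_subst, liftTy_inst]

theorem Ty.inst_subst {n n' : ℕ} (a : Ty (n + 1)) (b : Ty n) (σ : Fin n → Ty n') :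
    (a.inst b).subst σ = (a.subst (liftTy σ)).inst (b.subst σ) := by
  rw [Ty.subst_lift_inst, Ty.inst, Ty.subst_subst, push_comp (fun t : Ty n => t.subst σ)]
  simp [Ty.subst]

theorem Ty.inst_rename {n n' : ℕ} (a : Ty (n + 1)) (b : Ty n) (f : Fin n → Fin n') :
    (a.inst b).rename f = (a.rename (liftRen f)).inst (b.rename f) := by
  rw [Ty.rename_eq_subst, Ty.inst_subst, Ty.rename_eq_subst, Ty.rename_eq_subst, liftTy_var]

@[simp] theorem Ty.subst_rename_succ {n n' : ℕ} (a : Ty n) (b : Ty n') (σ : Fin n → Ty n') :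
    (a.rename Fin.succ).subst (push b σ) = a.subst σ := by
  simp [Ty.subst_rename]

theorem Ty.rename_succ_injective {n : ℕ} :
    Function.Injective (fun a : Ty n => a.rename Fin.succ) := fun a b h => by
  have := congrArg (Ty.subst (push (.unit : Ty n) .var)) h
  simpa using this

theorem Ty.subst_closed (a : Ty 0) (σ : Fin 0 → Ty 0) : a.subst σ = a := by
  rw [Subsingleton.elim σ Ty.var, Ty.subst_var]

/-! ### Renaming and substitution in terms -/

theorem liftTm_var {n m m' : ℕ} (g : Fin m → Fin m') :
    liftTm (n := n) (fun i => Tm.var (g i)) = fun i => Tm.var (liftRen g i) := by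
  funext i
  refine Fin.cases ?_ (fun i => ?_) i <;> simp [liftTm, liftRen, Tm.rename]

theorem shiftTm_var {n m m' : ℕ} (g : Fin m → Fin m') :
    shiftTm (n := n) (fun i => Tm.var (g i)) = fun i => Tm.var (g i) := by
  funext i
  simp [shiftTm, Tm.rename]

theorem Tm.rename_eq_subst {n m : ℕ} (e : Tm n m) : ∀ {n' m' : ℕ} (f : Fin n → Fin n')
    (g : Fin m → Fin m'), e.rename f g = e.subst (fun i => .var (f i)) (fun i => .var (g i)) := by
  induction e <;> intro n' m' f g <;>
    simp [*, Tm.rename, Tm.subst, liftTy_var, liftTm_var, shiftTm_var, Ty.rename_eq_subst]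

theorem liftTm_comp_liftRen {n m m' m'' : ℕ} (g : Fin m → Fin m') (s : Fin m' → Tm n m'') :
    (fun i => liftTm s (liftRen g i)) = liftTm (fun i => s (g i)) := by
  funext i
  refine Fin.cases ?_ (fun i => ?_) i <;> simp [liftTm, liftRen]

theorem shiftTm_comp {n m m' m'' : ℕ} (g : Fin m → Fin m') (s : Fin m' → Tm n m'') :
    (fun i => shiftTm s (g i)) = shiftTm (fun i => s (g i)) := rfl

theorem Tm.subst_rename {n m : ℕ} (e : Tm n m) : ∀ {n' n'' m' m'' : ℕ} (f : Fin n → Fin n')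
    (g : Fin m → Fin m') (σ : Fin n' → Ty n'') (s : Fin m' → Tm n'' m''),
    (e.rename f g).subst σ s = e.subst (fun i => σ (f i)) (fun i => s (g i)) := by
  induction e <;> intro n' n'' m' m'' f g σ s <;>
    simp [*, Tm.rename, Tm.subst, liftTy_comp_liftRen, liftTm_comp_liftRen, Ty.subst_rename,
      shiftTm_comp]

theorem liftTm_id {n m : ℕ} : liftTm (Tm.var : Fin m → Tm n m) = Tm.var := by
  have := liftTm_var (n := n) (id : Fin m → Fin m)
  simp only [id] at this
  rw [this]
  funext i
  refine Fin.cases ?_ (fun i => ?_) i <;> simp [liftRen]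

@[simp] theorem Tm.subst_var {n m : ℕ} (e : Tm n m) : e.subst Ty.var Tm.var = e := by
  have h : ∀ n m, shiftTm (Tm.var : Fin m → Tm n m) = Tm.var := fun n m => shiftTm_var id
  induction e <;> simp [*, Tm.subst, liftTy_id, liftTm_id]

@[simp] theorem Tm.rename_id {n m : ℕ} (e : Tm n m) : e.rename id id = e := by
  rw [Tm.rename_eq_subst]; exact e.subst_var

theorem Tm.rename_rename {n n' n'' m m' m'' : ℕ} (e : Tm n m) (f : Fin n → Fin n')
    (g : Fin m → Fin m') (f' : Fin n' → Fin n'') (g' : Fin m' → Fin m'') :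
    (e.rename f g).rename f' g' = e.rename (fun i => f' (f i)) (fun i => g' (g i)) := by
  rw [Tm.rename_eq_subst _ f', Tm.subst_rename, ← Tm.rename_eq_subst]

theorem liftTm_rename {n n' m m' m'' : ℕ} (s : Fin m → Tm n m') (f : Fin n → Fin n')
    (g : Fin m' → Fin m'') :
    (fun i => (liftTm s i).rename f (liftRen g)) = liftTm (fun i => (s i).rename f g) := by
  funext i
  refine Fin.cases ?_ (fun i => ?_) i <;> simp [liftTm, liftRen, Tm.rename, Tm.rename_rename]

theorem shiftTm_rename {n n' m m' m'' : ℕ} (s : Fin m → Tm n m') (f : Fin n → Fin n')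
    (g : Fin m' → Fin m'') :
    (fun i => (shiftTm s i).rename (liftRen f) g) = shiftTm (fun i => (s i).rename f g) := by
  funext i
  simp [shiftTm, liftRen, Tm.rename_rename]

theorem Tm.rename_subst {n m : ℕ} (e : Tm n m) : ∀ {n' n'' m' m'' : ℕ} (σ : Fin n → Ty n')
    (s : Fin m → Tm n' m') (f : Fin n' → Fin n'') (g : Fin m' → Fin m''),
    (e.subst σ s).rename f g =
      e.subst (fun i => (σ i).rename f) (fun i => (s i).rename f g) := by
  induction e <;> intro n' n'' m' m'' σ s f g <;>
    simp [*, Tm.rename, Tm.subst, liftTy_rename, liftTm_rename, Ty.rename_subst, shiftTm_rename]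

theorem liftTm_subst {n n' m m' m'' : ℕ} (s : Fin m → Tm n m') (σ : Fin n → Ty n')
    (s' : Fin m' → Tm n' m'') :
    (fun i => (liftTm s i).subst σ (liftTm s')) = liftTm (fun i => (s i).subst σ s') := by
  funext i
  refine Fin.cases ?_ (fun i => ?_) i <;>
    simp [liftTm, Tm.subst, Tm.subst_rename, Tm.rename_subst]

theorem shiftTm_subst {n n' m m' m'' : ℕ} (s : Fin m → Tm n m') (σ : Fin n → Ty n')
    (s' : Fin m' → Tm n' m'') :
    (fun i => (shiftTm s i).subst (liftTy σ) (shiftTm s')) =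
      shiftTm (fun i => (s i).subst σ s') := by
  funext i
  simp only [shiftTm, liftTy, Tm.subst_rename, Tm.rename_subst, id]
  simp

theorem Tm.subst_subst {n m : ℕ} (e : Tm n m) : ∀ {n' n'' m' m'' : ℕ} (σ : Fin n → Ty n')
    (s : Fin m → Tm n' m') (σ' : Fin n' → Ty n'') (s' : Fin m' → Tm n'' m''),
    (e.subst σ s).subst σ' s' =
      e.subst (fun i => (σ i).subst σ') (fun i => (s i).subst σ' s') := by
  induction e <;> intro n' n'' m' m'' σ s σ' s' <;>
    simp [*, Tm.subst, liftTy_subst, liftTm_subst, Ty.subst_subst, shiftTm_subst]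

theorem Tm.subst_lift_push {n n' m m' : ℕ} (e : Tm n (m + 1)) (σ : Fin n → Ty n')
    (s : Fin m → Tm n' m') (v : Tm n' m') :
    (e.subst σ (liftTm s)).subst Ty.var (push v Tm.var) = e.subst σ (push v s) := by
  rw [Tm.subst_subst]
  congr 1
  · funext i; simp
  · funext i
    refine Fin.cases ?_ (fun i => ?_) i <;> simp [liftTm, Tm.subst, Tm.subst_rename]

theorem Tm.subst_liftTy_push {n n' m m' : ℕ} (e : Tm (n + 1) m) (σ : Fin n → Ty n')
    (s : Fin m → Tm n' m') (τ : Ty n') :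
    (e.subst (liftTy σ) (shiftTm s)).subst (push τ Ty.var) Tm.var = e.subst (push τ σ) s := by
  rw [Tm.subst_subst, liftTy_inst]
  congr 1
  funext i
  simp [shiftTm, Tm.subst_rename]

theorem Tm.subst_liftBoth_push {n n' m m' : ℕ} (e : Tm (n + 1) (m + 1)) (σ : Fin n → Ty n')
    (s : Fin m → Tm n' m') (τ : Ty n') (v : Tm n' m') :
    (e.subst (liftTy σ) (liftTm (shiftTm s))).subst (push τ Ty.var) (push v Tm.var) =
      e.subst (push τ σ) (push v s) := by
  rw [Tm.subst_subst, liftTy_inst]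
  congr 1
  funext i
  refine Fin.cases ?_ (fun i => ?_) i <;> simp [liftTm, shiftTm, Tm.subst, Tm.subst_rename]

theorem Tm.subst_closed (e : Tm 0 0) (σ : Fin 0 → Ty 0) (s : Fin 0 → Tm 0 0) :
    e.subst σ s = e := by
  rw [Subsingleton.elim σ Ty.var, Subsingleton.elim s Tm.var, Tm.subst_var]

/-- Contexts in the logic are renamed by substituting variables for variables; this is the
corresponding `subst_rename`. -/
theorem Ctxt.subst_subst_var {n m : ℕ} (C : Ctxt 0 0 n m) :
    ∀ {n' n'' m' m'' : ℕ} (f : Fin n → Fin n') (g : Fin m → Fin m') (σ : Fin n' → Ty n'')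
      (s : Fin m' → Tm n'' m''),
      (C.subst (fun i => .var (f i)) (fun i => .var (g i))).subst σ s =
        C.subst (fun i => σ (f i)) (fun i => s (g i)) := by
  induction C <;> intro n' n'' m' m'' f g σ s <;>
    simp [*, Ctxt.subst, liftTy_comp_liftRen, liftTm_comp_liftRen, shiftTm_comp, liftTy_var,
      liftTm_var, shiftTm_var, ← Ty.rename_eq_subst, ← Tm.rename_eq_subst, Ty.subst_rename,
      Tm.subst_rename]

/-! ### Typing -/

theorem TyCtx.bindTm_liftRen {n n' m m' : ℕ} {Γ : TyCtx n m} {Γ' : TyCtx n' m'}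
    {f : Fin n → Fin n'} {g : Fin m → Fin m'} (h : ∀ i, Γ' (g i) = (Γ i).rename f) (τ : Ty n) :
    ∀ i, Γ'.bindTm (τ.rename f) (liftRen g i) = (Γ.bindTm τ i).rename f := by
  intro i
  refine Fin.cases ?_ (fun i => ?_) i <;> simp [TyCtx.bindTm, liftRen, h]

theorem TyCtx.bindTy_liftRen {n n' m m' : ℕ} {Γ : TyCtx n m} {Γ' : TyCtx n' m'}
    {f : Fin n → Fin n'} {g : Fin m → Fin m'} (h : ∀ i, Γ' (g i) = (Γ i).rename f) :
    ∀ i, Γ'.bindTy (g i) = (Γ.bindTy i).rename (liftRen f) := by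
  intro i
  simp [TyCtx.bindTy, liftRen, h, Ty.rename_rename]

theorem Ty.rename_succ_liftRen {n n' : ℕ} (a : Ty n) (f : Fin n → Fin n') :
    (a.rename Fin.succ).rename (liftRen f) = (a.rename f).rename Fin.succ := by
  simp [Ty.rename_rename, liftRen]

theorem Ty.subst_succ_liftTy {n n' : ℕ} (a : Ty n) (σ : Fin n → Ty n') :
    (a.rename Fin.succ).subst (liftTy σ) = (a.subst σ).rename Fin.succ := by
  simp [Ty.subst_rename, Ty.rename_subst, liftTy]

theorem HasTy.rename {n m : ℕ} {Γ : TyCtx n m} {e : Tm n m} {τ : Ty n} (h : HasTy Γ e τ) :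
    ∀ {n' m' : ℕ} {Γ' : TyCtx n' m'} {f : Fin n → Fin n'} {g : Fin m → Fin m'},
      (∀ i, Γ' (g i) = (Γ i).rename f) → HasTy Γ' (e.rename f g) (τ.rename f) := by
  induction h <;> intro n' m' Γ' f g H
  case var i => rw [← H i]; exact .var _
  case prim o _ _ _ _ ih₁ ih₂ =>
    have := HasTy.prim (o := o) (ih₁ H) (ih₂ H)
    cases o <;> exact this
  case unit => exact .unit
  case int => exact .int _
  case bool => exact .bool _
  case ite ih ih₁ ih₂ => exact .ite (ih H) (ih₁ H) (ih₂ H)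
  case pair ih₁ ih₂ => exact .pair (ih₁ H) (ih₂ H)
  case fst ih => exact .fst (ih H)
  case snd ih => exact .snd (ih H)
  case inl ih => exact .inl (ih H)
  case inr ih => exact .inr (ih H)
  case case ih ih₁ ih₂ =>
    exact .case (ih H) (ih₁ (TyCtx.bindTm_liftRen H _)) (ih₂ (TyCtx.bindTm_liftRen H _))
  case lam ih => exact .lam (ih (TyCtx.bindTm_liftRen H _))
  case app ih₁ ih₂ => exact .app (ih₁ H) (ih₂ H)
  case tlam ih => exact .tlam (ih (TyCtx.bindTy_liftRen H))
  case tapp ih => rw [Ty.inst_rename]; exact .tapp _ (ih H)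
  case pack ih => exact .pack (by rw [← Ty.inst_rename]; exact ih H)
  case unpack ih₁ ih₂ =>
    refine .unpack (ih₁ H) ?_
    rw [← Ty.rename_succ_liftRen]
    exact ih₂ (TyCtx.bindTm_liftRen (TyCtx.bindTy_liftRen H) _)
  case roll ih => exact .roll (by have := ih H; rwa [Ty.inst_rename] at this)
  case unroll ih => rw [Ty.inst_rename]; exact .unroll (ih H)

theorem HasTy.liftTm {n n' m m' : ℕ} {Γ : TyCtx n m} {Γ' : TyCtx n' m'} {σ : Fin n → Ty n'}
    {s : Fin m → Tm n' m'} (h : ∀ i, HasTy Γ' (s i) ((Γ i).subst σ)) (τ : Ty n) :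
    ∀ i, HasTy (Γ'.bindTm (τ.subst σ)) (FMu.liftTm s i) ((Γ.bindTm τ i).subst σ) := by
  intro i
  refine Fin.cases ?_ (fun i => ?_) i
  · exact .var (Γ := Γ'.bindTm (τ.subst σ)) 0
  · have := (h i).rename (Γ' := Γ'.bindTm (τ.subst σ)) (f := id) (g := Fin.succ)
      (by intro i; simp [TyCtx.bindTm])
    simpa [FMu.liftTm, TyCtx.bindTm] using this

theorem HasTy.shiftTm {n n' m m' : ℕ} {Γ : TyCtx n m} {Γ' : TyCtx n' m'} {σ : Fin n → Ty n'}
    {s : Fin m → Tm n' m'} (h : ∀ i, HasTy Γ' (s i) ((Γ i).subst σ)) :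
    ∀ i, HasTy Γ'.bindTy (FMu.shiftTm s i) ((Γ.bindTy i).subst (liftTy σ)) := by
  intro i
  rw [TyCtx.bindTy, Ty.subst_succ_liftTy]
  exact (h i).rename (fun i => rfl)

theorem HasTy.subst {n m : ℕ} {Γ : TyCtx n m} {e : Tm n m} {τ : Ty n} (h : HasTy Γ e τ) :
    ∀ {n' m' : ℕ} {Γ' : TyCtx n' m'} {σ : Fin n → Ty n'} {s : Fin m → Tm n' m'},
      (∀ i, HasTy Γ' (s i) ((Γ i).subst σ)) → HasTy Γ' (e.subst σ s) (τ.subst σ) := by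
  induction h <;> intro n' m' Γ' σ s H
  case var i => exact H i
  case prim o _ _ _ _ ih₁ ih₂ =>
    have := HasTy.prim (o := o) (ih₁ H) (ih₂ H)
    cases o <;> exact this
  case unit => exact .unit
  case int => exact .int _
  case bool => exact .bool _
  case ite ih ih₁ ih₂ => exact .ite (ih H) (ih₁ H) (ih₂ H)
  case pair ih₁ ih₂ => exact .pair (ih₁ H) (ih₂ H)
  case fst ih => exact .fst (ih H)
  case snd ih => exact .snd (ih H)
  case inl ih => exact .inl (ih H)
  case inr ih => exact .inr (ih H)
  case case ih ih₁ ih₂ => exact .case (ih H) (ih₁ (HasTy.liftTm H _)) (ih₂ (HasTy.liftTm H _))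
  case lam ih => exact .lam (ih (HasTy.liftTm H _))
  case app ih₁ ih₂ => exact .app (ih₁ H) (ih₂ H)
  case tlam ih => exact .tlam (ih (HasTy.shiftTm H))
  case tapp ih => rw [Ty.inst_subst]; exact .tapp _ (ih H)
  case pack ih => exact .pack (by rw [← Ty.inst_subst]; exact ih H)
  case unpack ih₁ ih₂ =>
    refine .unpack (ih₁ H) ?_
    rw [← Ty.subst_succ_liftTy]
    exact ih₂ (HasTy.liftTm (HasTy.shiftTm H) _)
  case roll ih => exact .roll (by have := ih H; rwa [Ty.inst_subst] at this)
  case unroll ih => rw [Ty.inst_subst]; exact .unroll (ih H)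

/-- Types are unique, because injections, packages and `roll` carry annotations. Hence the type
that is left implicit in the atomic relation `e₁ ⪯ e₂` is the expected one. -/
theorem HasTy.unique {n m : ℕ} {Γ : TyCtx n m} {e : Tm n m} {τ : Ty n} (h : HasTy Γ e τ) :
    ∀ {τ' : Ty n}, HasTy Γ e τ' → τ = τ' := by
  induction h <;> intro τ' h'
  case unpack ih₁ ih₂ =>
    cases h' with
    | unpack h₁ h₂ =>
      cases ih₁ h₁
      exact Ty.rename_succ_injective (ih₂ h₂)
  case case ih ih₁ ih₂ =>
    cases h' with
    | case h h₁ h₂ =>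
      cases ih h
      exact ih₁ h₁
  all_goals cases h'
  all_goals first
    | rfl
    | (rename_i ih _ h; cases ih h; rfl)
    | (rename_i ih _ _ h; cases ih h; rfl)
    | (rename_i ih₁ ih₂ _ _ h₁ h₂; cases ih₁ h₁; cases ih₂ h₂; rfl)
    | (rename_i ih₁ ih₂ _ h₂ h₁; cases ih₁ h₁; rfl)

/-! ### Operational semantics -/

/-- Labelled reduction in structural form: the congruence rules follow the evaluation contexts. -/
inductive SStep {n m : ℕ} : ℕ → Tm n m → Tm n m → Prop
  | head {k : ℕ} {e e' : Tm n m} : HeadStep k e e' → SStep k e e'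
  | primL {k : ℕ} {e e' : Tm n m} (o : PrimOp) (e₂ : Tm n m) :
      SStep k e e' → SStep k (.prim o e e₂) (.prim o e' e₂)
  | primR {k : ℕ} {e e' : Tm n m} (o : PrimOp) {v : Tm n m} :
      IsVal v → SStep k e e' → SStep k (.prim o v e) (.prim o v e')
  | ite {k : ℕ} {e e' : Tm n m} (e₁ e₂ : Tm n m) :
      SStep k e e' → SStep k (.ite e e₁ e₂) (.ite e' e₁ e₂)
  | pairL {k : ℕ} {e e' : Tm n m} (e₂ : Tm n m) :
      SStep k e e' → SStep k (.pair e e₂) (.pair e' e₂)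
  | pairR {k : ℕ} {e e' : Tm n m} {v : Tm n m} :
      IsVal v → SStep k e e' → SStep k (.pair v e) (.pair v e')
  | fst {k : ℕ} {e e' : Tm n m} : SStep k e e' → SStep k (.fst e) (.fst e')
  | snd {k : ℕ} {e e' : Tm n m} : SStep k e e' → SStep k (.snd e) (.snd e')
  | inl {k : ℕ} {e e' : Tm n m} (τ : Ty n) : SStep k e e' → SStep k (.inl τ e) (.inl τ e')
  | inr {k : ℕ} {e e' : Tm n m} (τ : Ty n) : SStep k e e' → SStep k (.inr τ e) (.inr τ e')
  | case {k : ℕ} {e e' : Tm n m} (e₁ e₂ : Tm n (m + 1)) :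
      SStep k e e' → SStep k (.case e e₁ e₂) (.case e' e₁ e₂)
  | appL {k : ℕ} {e e' : Tm n m} (e₂ : Tm n m) :
      SStep k e e' → SStep k (.app e e₂) (.app e' e₂)
  | appR {k : ℕ} {e e' : Tm n m} {v : Tm n m} :
      IsVal v → SStep k e e' → SStep k (.app v e) (.app v e')
  | tapp {k : ℕ} {e e' : Tm n m} (τ : Ty n) : SStep k e e' → SStep k (.tapp e τ) (.tapp e' τ)
  | pack {k : ℕ} {e e' : Tm n m} (τ : Ty n) (τ' : Ty (n + 1)) :
      SStep k e e' → SStep k (.pack τ e τ') (.pack τ e' τ')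
  | unpack {k : ℕ} {e e' : Tm n m} (e₂ : Tm (n + 1) (m + 1)) :
      SStep k e e' → SStep k (.unpack e e₂) (.unpack e' e₂)
  | roll {k : ℕ} {e e' : Tm n m} (τ : Ty n) : SStep k e e' → SStep k (.roll τ e) (.roll τ e')
  | unroll {k : ℕ} {e e' : Tm n m} : SStep k e e' → SStep k (.unroll e) (.unroll e')

theorem SStep.fill {n m k : ℕ} {E : Ctxt n m n m} {e e' : Tm n m} (hE : IsEval E)
    (h : SStep k e e') : SStep k (E.fill e) (E.fill e') := by
  induction hE with
  | hole => simpa [Ctxt.fill] using h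
  | primL _ ih => exact .primL _ _ ih
  | primR hv _ ih => exact .primR _ hv ih
  | ite _ ih => exact .ite _ _ ih
  | pairL _ ih => exact .pairL _ ih
  | pairR hv _ ih => exact .pairR hv ih
  | fst _ ih => exact .fst ih
  | snd _ ih => exact .snd ih
  | inl _ ih => exact .inl _ ih
  | inr _ ih => exact .inr _ ih
  | case _ ih => exact .case _ _ ih
  | appL _ ih => exact .appL _ ih
  | appR hv _ ih => exact .appR hv ih
  | tapp _ ih => exact .tapp _ ih
  | pack _ ih => exact .pack _ _ ih
  | unpack _ ih => exact .unpack _ ih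
  | roll _ ih => exact .roll _ ih
  | unroll _ ih => exact .unroll ih

theorem lstep_iff_sstep {n m k : ℕ} {e e' : Tm n m} : LStep k e e' ↔ SStep k e e' := by
  constructor
  · rintro ⟨hE, h⟩
    exact .fill hE (.head h)
  · intro h
    induction h with
    | head h => simpa [Ctxt.fill] using LStep.mk IsEval.hole h
    | primL o e₂ _ ih => obtain ⟨hE, h⟩ := ih; exact .mk (.primL (o := o) (e₂ := e₂) hE) h
    | primR o hv _ ih => obtain ⟨hE, h⟩ := ih; exact .mk (.primR (o := o) hv hE) h
    | ite e₁ e₂ _ ih => obtain ⟨hE, h⟩ := ih; exact .mk (.ite (e₁ := e₁) (e₂ := e₂) hE) h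
    | pairL e₂ _ ih => obtain ⟨hE, h⟩ := ih; exact .mk (.pairL (e₂ := e₂) hE) h
    | pairR hv _ ih => obtain ⟨hE, h⟩ := ih; exact .mk (.pairR hv hE) h
    | fst _ ih => obtain ⟨hE, h⟩ := ih; exact .mk (.fst hE) h
    | snd _ ih => obtain ⟨hE, h⟩ := ih; exact .mk (.snd hE) h
    | inl τ _ ih => obtain ⟨hE, h⟩ := ih; exact .mk (.inl (τ := τ) hE) h
    | inr τ _ ih => obtain ⟨hE, h⟩ := ih; exact .mk (.inr (τ := τ) hE) h
    | case e₁ e₂ _ ih => obtain ⟨hE, h⟩ := ih; exact .mk (.case (e₁ := e₁) (e₂ := e₂) hE) h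
    | appL e₂ _ ih => obtain ⟨hE, h⟩ := ih; exact .mk (.appL (e₂ := e₂) hE) h
    | appR hv _ ih => obtain ⟨hE, h⟩ := ih; exact .mk (.appR hv hE) h
    | tapp τ _ ih => obtain ⟨hE, h⟩ := ih; exact .mk (.tapp (τ := τ) hE) h
    | pack τ τ' _ ih => obtain ⟨hE, h⟩ := ih; exact .mk (.pack (τ := τ) (τ' := τ') hE) h
    | unpack e₂ _ ih => obtain ⟨hE, h⟩ := ih; exact .mk (.unpack (e₂ := e₂) hE) h
    | roll τ _ ih => obtain ⟨hE, h⟩ := ih; exact .mk (.roll (τ := τ) hE) h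
    | unroll _ ih => obtain ⟨hE, h⟩ := ih; exact .mk (.unroll hE) h

theorem IsVal.not_sstep {n m k : ℕ} {v e : Tm n m} (hv : IsVal v) : ¬ SStep k v e := by
  induction hv generalizing k e with
  | var | unit | int | bool | lam | tlam =>
    intro h; cases h with | head h => cases h
  | pair _ _ ih₁ ih₂ =>
    intro h
    cases h with
    | head h => cases h
    | pairL _ h => exact ih₁ h
    | pairR _ h => exact ih₂ h
  | inl _ ih => intro h; cases h with
    | head h => cases h
    | inl _ h => exact ih h
  | inr _ ih => intro h; cases h with
    | head h => cases h
    | inr _ h => exact ih h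
  | pack _ ih => intro h; cases h with
    | head h => cases h
    | pack _ _ h => exact ih h
  | roll _ ih => intro h; cases h with
    | head h => cases h
    | roll _ h => exact ih h

theorem HeadStep.deterministic {n m k k' : ℕ} {e e' e'' : Tm n m} (h : HeadStep k e e')
    (h' : HeadStep k' e e'') : k = k' ∧ e' = e'' := by
  cases h <;> cases h' <;> exact ⟨rfl, rfl⟩

/-- In a redex all the subterms in evaluation position are values. -/
theorem HeadStep.sstep {n m k k' : ℕ} {e e' e'' : Tm n m} (h : HeadStep k e e')
    (h' : SStep k' e e'') : k = k' ∧ e' = e'' := by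
  have hval : ∀ {k' : ℕ} {v u : Tm n m} {p : Prop}, SStep k' v u → IsVal v → p :=
    fun hs hv => absurd hs hv.not_sstep
  cases h <;> cases h' <;> first
    | (rename_i h'; exact HeadStep.deterministic (by constructor <;> assumption) h')
    | (rename_i hs; refine hval hs ?_; (repeat' constructor) <;> assumption)

theorem SStep.deterministic {n m k k' : ℕ} {e e' e'' : Tm n m} (h : SStep k e e')
    (h' : SStep k' e e'') : k = k' ∧ e' = e'' := by
  have key : ∀ {k k' : ℕ} {e e' e'' : Tm n m}, HeadStep k' e e'' → SStep k e e' →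
      k = k' ∧ e' = e'' := fun h h' => ⟨(h.sstep h').1.symm, (h.sstep h').2.symm⟩
  induction h generalizing k' e'' with
  | head h => exact h.sstep h'
  | primL o e₂ hs ih =>
    cases h' with
    | head h' => exact key h' (.primL o e₂ hs)
    | primL _ _ h' => obtain ⟨rfl, rfl⟩ := ih h'; exact ⟨rfl, rfl⟩
    | primR _ hv _ => exact absurd hs hv.not_sstep
  | primR o hv hs ih =>
    cases h' with
    | head h' => exact key h' (.primR o hv hs)
    | primL _ _ h' => exact absurd h' hv.not_sstep
    | primR _ _ h' => obtain ⟨rfl, rfl⟩ := ih h'; exact ⟨rfl, rfl⟩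
  | pairL e₂ hs ih =>
    cases h' with
    | head h' => exact key h' (.pairL e₂ hs)
    | pairL _ h' => obtain ⟨rfl, rfl⟩ := ih h'; exact ⟨rfl, rfl⟩
    | pairR hv _ => exact absurd hs hv.not_sstep
  | pairR hv hs ih =>
    cases h' with
    | head h' => exact key h' (.pairR hv hs)
    | pairL _ h' => exact absurd h' hv.not_sstep
    | pairR _ h' => obtain ⟨rfl, rfl⟩ := ih h'; exact ⟨rfl, rfl⟩
  | appL e₂ hs ih =>
    cases h' with
    | head h' => exact key h' (.appL e₂ hs)
    | appL _ h' => obtain ⟨rfl, rfl⟩ := ih h'; exact ⟨rfl, rfl⟩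
    | appR hv _ => exact absurd hs hv.not_sstep
  | appR hv hs ih =>
    cases h' with
    | head h' => exact key h' (.appR hv hs)
    | appL _ h' => exact absurd h' hv.not_sstep
    | appR _ h' => obtain ⟨rfl, rfl⟩ := ih h'; exact ⟨rfl, rfl⟩
  | ite e₁ e₂ hs ih =>
    cases h' with
    | head h' => exact key h' (.ite e₁ e₂ hs)
    | ite _ _ h' => obtain ⟨rfl, rfl⟩ := ih h'; exact ⟨rfl, rfl⟩
  | fst hs ih =>
    cases h' with
    | head h' => exact key h' (.fst hs)
    | fst h' => obtain ⟨rfl, rfl⟩ := ih h'; exact ⟨rfl, rfl⟩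
  | snd hs ih =>
    cases h' with
    | head h' => exact key h' (.snd hs)
    | snd h' => obtain ⟨rfl, rfl⟩ := ih h'; exact ⟨rfl, rfl⟩
  | inl τ hs ih =>
    cases h' with
    | head h' => exact key h' (.inl τ hs)
    | inl _ h' => obtain ⟨rfl, rfl⟩ := ih h'; exact ⟨rfl, rfl⟩
  | inr τ hs ih =>
    cases h' with
    | head h' => exact key h' (.inr τ hs)
    | inr _ h' => obtain ⟨rfl, rfl⟩ := ih h'; exact ⟨rfl, rfl⟩
  | case e₁ e₂ hs ih =>
    cases h' with
    | head h' => exact key h' (.case e₁ e₂ hs)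
    | case _ _ h' => obtain ⟨rfl, rfl⟩ := ih h'; exact ⟨rfl, rfl⟩
  | tapp τ hs ih =>
    cases h' with
    | head h' => exact key h' (.tapp τ hs)
    | tapp _ h' => obtain ⟨rfl, rfl⟩ := ih h'; exact ⟨rfl, rfl⟩
  | pack τ τ' hs ih =>
    cases h' with
    | head h' => exact key h' (.pack τ τ' hs)
    | pack _ _ h' => obtain ⟨rfl, rfl⟩ := ih h'; exact ⟨rfl, rfl⟩
  | unpack e₂ hs ih =>
    cases h' with
    | head h' => exact key h' (.unpack e₂ hs)
    | unpack _ h' => obtain ⟨rfl, rfl⟩ := ih h'; exact ⟨rfl, rfl⟩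
  | roll τ hs ih =>
    cases h' with
    | head h' => exact key h' (.roll τ hs)
    | roll _ h' => obtain ⟨rfl, rfl⟩ := ih h'; exact ⟨rfl, rfl⟩
  | unroll hs ih =>
    cases h' with
    | head h' => exact key h' (.unroll hs)
    | unroll h' => obtain ⟨rfl, rfl⟩ := ih h'; exact ⟨rfl, rfl⟩

/-- Subject reduction. -/
theorem HasTy.sstep {n m k : ℕ} {Γ : TyCtx n m} {e e' : Tm n m} (h : SStep k e e') {τ : Ty n}
    (ht : HasTy Γ e τ) : HasTy Γ e' τ := by
  have hpush : ∀ {σ : Ty n} {v : Tm n m}, HasTy Γ v σ →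
      ∀ i, HasTy Γ (push v Tm.var i) ((Γ.bindTm σ i).subst Ty.var) := by
    intro σ v hv i
    refine Fin.cases ?_ (fun i => ?_) i
    · simpa [TyCtx.bindTm] using hv
    · simpa [TyCtx.bindTm] using HasTy.var i
  induction h generalizing τ with
  | head h =>
    cases h with
    | prim o a b => cases ht; cases o <;> constructor
    | iteTrue => cases ht; assumption
    | iteFalse => cases ht; assumption
    | fst => cases ht with | fst h => cases h; assumption
    | snd => cases ht with | snd h => cases h; assumption
    | caseInl =>
      cases ht with
      | case h h₁ h₂ => cases h with | inl h => simpa using h₁.subst (hpush h)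
    | caseInr =>
      cases ht with
      | case h h₁ h₂ => cases h with | inr h => simpa using h₂.subst (hpush h)
    | app => cases ht with
      | app h h₂ => cases h with | lam h => simpa using h.subst (hpush h₂)
    | tapp e τ₁ => cases ht with
      | tapp _ h => cases h with
        | tlam h =>
          refine h.subst fun i => ?_
          simpa [TyCtx.bindTy] using HasTy.var i
    | @unpack τ₁ => cases ht with
      | unpack h h₂ => cases h with
        | pack h =>
          have := h₂.subst (Γ' := Γ) (σ := push τ₁ Ty.var) (s := push _ Tm.var) (by
            intro i
            refine Fin.cases ?_ (fun i => ?_) i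
            · simpa [TyCtx.bindTm, Ty.inst] using h
            · simpa [TyCtx.bindTm, TyCtx.bindTy] using HasTy.var i)
          simpa using this
    | unroll => cases ht with | unroll h => cases h; assumption
  | _ =>
    cases ht
    constructor <;> solve_by_elim

theorem HasTy.stepsN {n m k : ℕ} {Γ : TyCtx n m} {e e' : Tm n m} (h : StepsN k e e') {τ : Ty n}
    (ht : HasTy Γ e τ) : HasTy Γ e' τ := by
  induction h with
  | refl => exact ht
  | step h _ ih => exact ih (ht.sstep (lstep_iff_sstep.1 h))

theorem HasTy.fill {p q : ℕ} {Γ : TyCtx p q} {τ : Ty p} {n m : ℕ} {C : Ctxt p q n m}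
    {Γ' : TyCtx n m} {τ' : Ty n} (hC : CtxtTy Γ τ C Γ' τ') {e : Tm p q} (h : HasTy Γ e τ) :
    HasTy Γ' (C.fill e) τ' := by
  induction hC with
  | hole _ _ hΓ => exact h.rename hΓ
  | primL _ h₂ ih => exact .prim ih h₂
  | primR h₁ _ ih => exact .prim h₁ ih
  | tapp _ _ ih => exact .tapp _ ih
  | _ => simp only [Ctxt.fill]; constructor <;> assumption

/-! ### Evaluation -/

theorem StepsN.trans {n m j k : ℕ} {a b c : Tm n m} (h : StepsN j a b) (h' : StepsN k b c) :
    StepsN (j + k) a c := by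
  induction h with
  | refl => simpa using h'
  | step h _ ih => rw [add_assoc]; exact .step h (ih h')

theorem steps_iff_stepsN {n m : ℕ} {a b : Tm n m} : Steps a b ↔ ∃ k, StepsN k a b := by
  constructor
  · intro h
    induction h using Relation.ReflTransGen.head_induction_on with
    | refl => exact ⟨0, .refl _⟩
    | head h _ ih =>
      obtain ⟨j, h⟩ := h
      obtain ⟨k, ih⟩ := ih
      exact ⟨_, .step h ih⟩
  · rintro ⟨k, h⟩
    induction h with
    | refl => exact .refl
    | step h _ ih => exact .head ⟨_, h⟩ ih

theorem LStep.fill {n m k : ℕ} {E : Ctxt n m n m} {e e' : Tm n m} (hE : IsEval E)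
    (h : LStep k e e') : LStep k (E.fill e) (E.fill e') :=
  lstep_iff_sstep.2 (.fill hE (lstep_iff_sstep.1 h))

theorem LStep.head {n m k : ℕ} {e e' : Tm n m} (h : HeadStep k e e') : LStep k e e' :=
  lstep_iff_sstep.2 (.head h)

theorem LStep.le_one {n m k : ℕ} {e e' : Tm n m} (h : LStep k e e') : k ≤ 1 := by
  obtain ⟨_, h⟩ := h
  cases h <;> simp

/-- A reduction sequence with `j + 1` unroll-roll reductions begins with one that has exactly
one, which is the form in which the term relation of the logic consumes it. -/
theorem StepsN.split {n m k : ℕ} {e e' : Tm n m} (h : StepsN k e e') : ∀ j, k = j + 1 →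
    ∃ e'', StepsN 1 e e'' ∧ StepsN j e'' e' := by
  induction h with
  | refl => intro j hj; omega
  | @step i k _ _ _ h h' ih =>
    intro j hj
    have := h.le_one
    obtain rfl | rfl : i = 0 ∨ i = 1 := by omega
    · obtain ⟨e'', h₁, h₂⟩ := ih j (by omega)
      exact ⟨e'', by simpa using StepsN.step h h₁, h₂⟩
    · obtain rfl : k = j := by omega
      exact ⟨_, .step h (.refl _), h'⟩

theorem IsVal.stepsN {n m k : ℕ} {v e : Tm n m} (hv : IsVal v) (h : StepsN k v e) :
    k = 0 ∧ e = v := by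
  cases h with
  | refl => exact ⟨rfl, rfl⟩
  | step h _ => exact absurd (lstep_iff_sstep.1 h) hv.not_sstep

/-- By determinism, every evaluation of `e` goes through its reduct. -/
theorem StepsN.tail_of_lstep {n m j k : ℕ} {e e' v : Tm n m} (h : LStep k e e')
    (h' : StepsN j e v) (hv : IsVal v) : ∃ i, j = k + i ∧ StepsN i e' v := by
  cases h' with
  | refl => exact absurd (lstep_iff_sstep.1 h) hv.not_sstep
  | step h₁ h₂ =>
    obtain ⟨rfl, rfl⟩ := (lstep_iff_sstep.1 h).deterministic (lstep_iff_sstep.1 h₁)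
    exact ⟨_, rfl, h₂⟩

theorem Terminates.of_lstep {n m k : ℕ} {e e' : Tm n m} (h : LStep k e e')
    (ht : Terminates e') : Terminates e :=
  ht.imp fun _ hv => ⟨.head ⟨_, h⟩ hv.1, hv.2⟩

theorem Terminates.lstep {n m k : ℕ} {e e' : Tm n m} (h : LStep k e e')
    (ht : Terminates e) : Terminates e' := by
  obtain ⟨v, hs, hv⟩ := ht
  obtain ⟨j, hs⟩ := steps_iff_stepsN.1 hs
  obtain ⟨i, -, hs⟩ := hs.tail_of_lstep h hv
  exact ⟨v, steps_iff_stepsN.2 ⟨i, hs⟩, hv⟩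

theorem IsVal.of_fill {n m : ℕ} {E : Ctxt n m n m} {e : Tm n m} (hE : IsEval E)
    (h : IsVal (E.fill e)) : IsVal e := by
  induction hE with
  | hole => simpa [Ctxt.fill] using h
  | _ => simp only [Ctxt.fill] at h; cases h <;> solve_by_elim

/-- If the term in the hole is not a value, then a reduction step takes place inside it. -/
theorem SStep.of_fill {n m k : ℕ} {E : Ctxt n m n m} {e u : Tm n m} (hE : IsEval E)
    (he : ¬ IsVal e) (h : SStep k (E.fill e) u) : ∃ e', SStep k e e' ∧ u = E.fill e' := by
  have hval : ∀ {E : Ctxt n m n m} {p : Prop}, IsEval E → IsVal (E.fill e) → p :=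
    fun hE h => absurd (h.of_fill hE) he
  induction hE generalizing u with
  | hole =>
    simp only [Ctxt.fill, Tm.rename_id] at h ⊢
    exact ⟨u, h, rfl⟩
  | @primL _ E _ hE ih =>
    simp only [Ctxt.fill] at h ⊢
    generalize ht : E.fill e = t at h
    cases h with
    | head h => cases h; exact hval hE (ht ▸ .int _)
    | primL _ _ h => obtain ⟨e', h₁, rfl⟩ := ih (ht ▸ h); exact ⟨e', h₁, rfl⟩
    | primR _ hv _ => exact hval hE (ht ▸ hv)
  | @pairL E _ hE ih =>
    simp only [Ctxt.fill] at h ⊢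
    generalize ht : E.fill e = t at h
    cases h with
    | head h => cases h
    | pairL _ h => obtain ⟨e', h₁, rfl⟩ := ih (ht ▸ h); exact ⟨e', h₁, rfl⟩
    | pairR hv _ => exact hval hE (ht ▸ hv)
  | @appL E _ hE ih =>
    simp only [Ctxt.fill] at h ⊢
    generalize ht : E.fill e = t at h
    cases h with
    | head h => cases h; exact hval hE (ht ▸ .lam _ _)
    | appL _ h => obtain ⟨e', h₁, rfl⟩ := ih (ht ▸ h); exact ⟨e', h₁, rfl⟩
    | appR hv _ => exact hval hE (ht ▸ hv)
  | @primR _ _ E hv hE ih =>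
    simp only [Ctxt.fill] at h ⊢
    generalize ht : E.fill e = t at h
    cases h with
    | head h => cases h; exact hval hE (ht ▸ .int _)
    | primL _ _ h => exact absurd h hv.not_sstep
    | primR _ _ h => obtain ⟨e', h₁, rfl⟩ := ih (ht ▸ h); exact ⟨e', h₁, rfl⟩
  | @pairR _ E hv hE ih =>
    simp only [Ctxt.fill] at h ⊢
    generalize ht : E.fill e = t at h
    cases h with
    | head h => cases h
    | pairL _ h => exact absurd h hv.not_sstep
    | pairR _ h => obtain ⟨e', h₁, rfl⟩ := ih (ht ▸ h); exact ⟨e', h₁, rfl⟩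
  | @appR _ E hv hE ih =>
    simp only [Ctxt.fill] at h ⊢
    generalize ht : E.fill e = t at h
    cases h with
    | head h => cases h; exact hval hE (by rw [ht]; assumption)
    | appL _ h => exact absurd h hv.not_sstep
    | appR _ h => obtain ⟨e', h₁, rfl⟩ := ih (ht ▸ h); exact ⟨e', h₁, rfl⟩
  | @ite E _ _ hE ih | @fst E hE ih | @snd E hE ih | @inl _ E hE ih | @inr _ E hE ih
  | @case E _ _ hE ih | @tapp E _ hE ih | @pack _ E _ hE ih | @unpack E _ hE ih
  | @roll _ E hE ih | @unroll E hE ih =>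
    simp only [Ctxt.fill] at h ⊢
    generalize ht : E.fill e = t at h
    cases h with
    | head h =>
      cases h <;> refine hval hE ?_ <;> rw [ht] <;> (repeat' constructor) <;> assumption
    | _ =>
      rename_i h
      obtain ⟨e', h₁, rfl⟩ := ih (ht ▸ h)
      exact ⟨e', h₁, rfl⟩

/-- The evaluation of `E[e]` to a value evaluates `e` first. -/
theorem StepsN.of_fill {n m k : ℕ} {E : Ctxt n m n m} (hE : IsEval E) {t v : Tm n m}
    (h : StepsN k t v) (hv : IsVal v) : ∀ e, t = E.fill e →
    ∃ i j u, k = i + j ∧ StepsN i e u ∧ IsVal u ∧ StepsN j (E.fill u) v := by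
  induction h with
  | refl t =>
    rintro e rfl
    exact ⟨0, 0, e, rfl, .refl _, hv.of_fill hE, .refl _⟩
  | @step i k _ _ _ h h' ih =>
    rintro e rfl
    by_cases he : IsVal e
    · exact ⟨0, _, e, (Nat.zero_add _).symm, .refl _, he, .step h h'⟩
    · obtain ⟨e', h₁, rfl⟩ := SStep.of_fill hE he (lstep_iff_sstep.1 h)
      obtain ⟨i', j', u, rfl, h₂, hu, h₃⟩ := ih hv e' rfl
      exact ⟨i + i', j', u, by omega, .step (lstep_iff_sstep.2 h₁) h₂, hu, h₃⟩

/-! ### Ciu approximation of closed terms -/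

/-- `E[C]` for an evaluation context `E`, whose hole is in the scope of `E` itself. The value on
contexts that are not evaluation contexts is junk. -/
def Ctxt.plug {a b p q : ℕ} : {n m : ℕ} → Ctxt a b n m → Ctxt p q n m → Ctxt p q n m
  | _, _, .primL o E e₂, C => .primL o (E.plug C) e₂
  | _, _, .primR o e₁ E, C => .primR o e₁ (E.plug C)
  | _, _, .iteC E e₁ e₂, C => .iteC (E.plug C) e₁ e₂
  | _, _, .pairL E e₂, C => .pairL (E.plug C) e₂
  | _, _, .pairR e₁ E, C => .pairR e₁ (E.plug C)
  | _, _, .fst E, C => .fst (E.plug C)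
  | _, _, .snd E, C => .snd (E.plug C)
  | _, _, .inl τ E, C => .inl τ (E.plug C)
  | _, _, .inr τ E, C => .inr τ (E.plug C)
  | _, _, .caseC E e₁ e₂, C => .caseC (E.plug C) e₁ e₂
  | _, _, .appL E e₂, C => .appL (E.plug C) e₂
  | _, _, .appR e₁ E, C => .appR e₁ (E.plug C)
  | _, _, .tapp E τ, C => .tapp (E.plug C) τ
  | _, _, .pack τ E τ', C => .pack τ (E.plug C) τ'
  | _, _, .unpackL E e₂, C => .unpackL (E.plug C) e₂
  | _, _, .roll τ E, C => .roll τ (E.plug C)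
  | _, _, .unroll E, C => .unroll (E.plug C)
  | _, _, _, C => C

theorem IsEval.fill_plug {p q n m : ℕ} {E : Ctxt n m n m} (hE : IsEval E) (C : Ctxt p q n m)
    (e : Tm p q) : (E.plug C).fill e = E.fill (C.fill e) := by
  induction hE <;> simp [Ctxt.plug, Ctxt.fill, *]

theorem IsEval.plug {n m : ℕ} {E E' : Ctxt n m n m} (hE : IsEval E) (hE' : IsEval E') :
    IsEval (E.plug E') := by
  induction hE <;> first | exact hE' | (constructor <;> assumption)

theorem IsEval.ctxtTy_plug {p q n m : ℕ} {E : Ctxt n m n m} (hE : IsEval E) {Γ : TyCtx n m}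
    {τ τ' : Ty n} (ht : CtxtTy Γ τ E Γ τ') {C : Ctxt p q n m} {Γ₀ : TyCtx p q} {τ₀ : Ty p}
    (hC : CtxtTy Γ₀ τ₀ C Γ τ) : CtxtTy Γ₀ τ₀ (E.plug C) Γ τ' := by
  induction hE generalizing τ' with
  | hole =>
    generalize hf : (Ctxt.hole id id : Ctxt n m n m) = D at ht
    cases ht with
    | hole =>
      cases hf
      simpa [Ctxt.plug] using hC
    | _ => cases hf
  | tapp _ ih => cases ht with | tapp _ h => exact .tapp _ (ih h)
  | _ =>
    rename_i ih
    cases ht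
    have := ih (by assumption)
    constructor <;> assumption

theorem CiuClosed.refl {e : Tm 0 0} {τ : Ty 0} (h : HasTy TyCtx.empty e τ) : CiuClosed e e τ :=
  ⟨h, h, fun _ _ _ h => h⟩

theorem CiuClosed.trans {a b c : Tm 0 0} {τ : Ty 0} (h : CiuClosed a b τ)
    (h' : CiuClosed b c τ) : CiuClosed a c τ :=
  ⟨h.1, h'.2.1, fun E τ' hE ht => h'.2.2 E τ' hE (h.2.2 E τ' hE ht)⟩

theorem CiuClosed.of_lstep {k : ℕ} {e e' : Tm 0 0} {τ : Ty 0} (ht : HasTy TyCtx.empty e τ)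
    (h : LStep k e e') : CiuClosed e' e τ :=
  ⟨ht.sstep (lstep_iff_sstep.1 h), ht, fun _ _ hE hT => hT.of_lstep (h.fill hE.1)⟩

theorem CiuClosed.fill {a b : Tm 0 0} {τ τ' : Ty 0} (h : CiuClosed a b τ) {E : Ctxt 0 0 0 0}
    (hE : EvalCtxtTy E τ τ') : CiuClosed (E.fill a) (E.fill b) τ' := by
  refine ⟨.fill hE.2 h.1, .fill hE.2 h.2.1, fun E' τ'' hE' => ?_⟩
  rw [← hE'.1.fill_plug, ← hE'.1.fill_plug]
  exact h.2.2 _ τ'' ⟨hE'.1.plug hE.1, hE'.1.ctxtTy_plug hE'.2 hE.2⟩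

/-! ### The interpretation of renamed relations -/

theorem append_liftBlock {A : Type} {n n' a : ℕ} (f : Fin n → Fin n') (σ : Fin n' → A)
    (σ' : Fin a → A) :
    (fun i => Fin.append σ σ' (liftBlock a f i)) = Fin.append (fun i => σ (f i)) σ' := by
  funext i
  refine Fin.addCases (fun i => ?_) (fun i => ?_) i <;> simp [liftBlock]

theorem REnv.cons_lift {Δ Δ' : List ℕ} (h : RRen Δ Δ') {j : ℕ} (S : WRel j) (δ : REnv Δ') :
    (fun k r => REnv.cons S δ k (h.lift j k r)) = REnv.cons S (fun k r => δ k (h k r)) := by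
  funext k r
  cases r <;> rfl

@[simp] theorem Rel.interp_zero {n m : ℕ} {Δ : List ℕ} {k : ℕ} (R : Rel n m Δ k)
    (σ : Fin n → Ty 0) (s : Fin m → Tm 0 0) (δ : REnv Δ) (es : Fin k → Tm 0 0) :
    R.interp σ s δ 0 es = True := by
  simp only [Rel.interp]

theorem Rel.interp_rename {n m : ℕ} {Δ : List ℕ} {k : ℕ} (R : Rel n m Δ k) :
    ∀ {n' m' : ℕ} {Δ' : List ℕ} (f : Fin n → Fin n') (g : Fin m → Fin m') (h : RRen Δ Δ')
      (σ : Fin n' → Ty 0) (s : Fin m' → Tm 0 0) (δ : REnv Δ'),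
      (R.rename f g h).interp σ s δ =
        R.interp (fun i => σ (f i)) (fun i => s (g i)) (fun k r => δ k (h k r)) := by
  induction R <;> intro n' m' Δ' f g h σ s δ <;> funext w es <;> cases w <;>
    simp [Rel.rename, Rel.interp, Tm.subst_rename, Ty.subst_rename, Ctxt.subst_subst_var,
      append_liftBlock, REnv.cons_lift, *]

/-! ### The logical relation in the Kripke model

The semantic counterparts of `valRel` and `expRel` are indexed by natural numbers so that index
`w` stands for world `w + 1`: the trivial world `0` disappears. -/

/-- World-indexed binary relations on closed terms. -/
abbrev SRel : Type := ℕ → Tm 0 0 → Tm 0 0 → Prop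

/-- What holds at `v` holds at every `u ≤ v`. -/
def SRel.Mono (S : SRel) : Prop := ∀ u v a b, u ≤ v → S v a b → S u a b

/-- `e ↓ τ` for a closed term. -/
def ValOf (e : Tm 0 0) (τ : Ty 0) : Prop := HasTy TyCtx.empty e τ ∧ IsVal e

/-- `S : VRel(τ₁, τ₂)` at index `w`. -/
def SRel.IsVRel (S : SRel) (τ₁ τ₂ : Ty 0) (w : ℕ) : Prop :=
  ∀ v ≤ w, ∀ a b, S v a b → ValOf a τ₁ ∧ ValOf b τ₂

/-- `▷ S`, which is trivial at the last index. -/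
def SRel.later (S : SRel) : SRel
  | 0, _, _ => True
  | w + 1, a, b => S w a b

/-- A semantic interpretation of a type variable. -/
structure STy : Type where
  left : Ty 0
  right : Ty 0
  rel : SRel

/-- The semantic counterpart of `ρ`, interpreting `p` type variables. -/
abbrev SEnv (p : ℕ) : Type := Fin p → STy

/-- The type substitution `ρ₁`. -/
def SEnv.left {p : ℕ} (ρ : SEnv p) : Fin p → Ty 0 := fun i => (ρ i).left

/-- The type substitution `ρ₂`. -/
def SEnv.right {p : ℕ} (ρ : SEnv p) : Fin p → Ty 0 := fun i => (ρ i).right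

theorem SEnv.left_push {p : ℕ} (x : STy) (ρ : SEnv p) :
    SEnv.left (push x ρ) = push x.left ρ.left := push_comp STy.left x ρ

theorem SEnv.right_push {p : ℕ} (x : STy) (ρ : SEnv p) :
    SEnv.right (push x ρ) = push x.right ρ.right := push_comp STy.right x ρ

/-- The term relation built from a value relation `V`, with the recursion over the unroll-roll
reductions unfolded: the first term evaluates with `j` of them, and `V` is required at all
indices that are at least `j` steps later. -/
def semExp (τ₁ τ₂ : Ty 0) (V : SRel) : SRel := fun w t₁ t₂ =>
  HasTy TyCtx.empty t₁ τ₁ ∧ HasTy TyCtx.empty t₂ τ₂ ∧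
  ∀ j v, j + v ≤ w → ∀ x₁, StepsN j t₁ x₁ → IsVal x₁ →
    ∃ x₂, CiuClosed x₂ t₂ τ₂ ∧ V v x₁ x₂

/-- The relation defined by recursion on smaller indices, as in `worldFix`. -/
def indexFix (F : SRel → SRel) (w : ℕ) (a b : Tm 0 0) : Prop :=
  F (fun v a b => ∃ _ : v < w, indexFix F v a b) w a b
termination_by w

/-- The semantic value relation `𝒱⟦τ⟧ρ`. For recursive types it is defined by recursion on the
index; `semVal_mu` is its characterization. -/
def semVal : {p : ℕ} → Ty p → SEnv p → SRel
  | _, .var i, ρ => (ρ i).rel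
  | _, .unit, _ => fun _ a b => ValOf a .unit ∧ ValOf b .unit ∧ a = b
  | _, .int, _ => fun _ a b => ValOf a .int ∧ ValOf b .int ∧ a = b
  | _, .bool, _ => fun _ a b => ValOf a .bool ∧ ValOf b .bool ∧ a = b
  | _, .prod τ τ', ρ => fun w a b =>
      ValOf a ((Ty.prod τ τ').subst ρ.left) ∧ ValOf b ((Ty.prod τ τ').subst ρ.right) ∧
      ∃ a₁ a₂ b₁ b₂, a = .pair a₁ a₂ ∧ b = .pair b₁ b₂ ∧
        semVal τ ρ w a₁ b₁ ∧ semVal τ' ρ w a₂ b₂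
  | _, .sum τ τ', ρ => fun w a b =>
      ValOf a ((Ty.sum τ τ').subst ρ.left) ∧ ValOf b ((Ty.sum τ τ').subst ρ.right) ∧
      ((∃ a₁ b₁, a = .inl ((Ty.sum τ τ').subst ρ.left) a₁ ∧
          b = .inl ((Ty.sum τ τ').subst ρ.right) b₁ ∧ semVal τ ρ w a₁ b₁) ∨
        ∃ a₁ b₁, a = .inr ((Ty.sum τ τ').subst ρ.left) a₁ ∧
          b = .inr ((Ty.sum τ τ').subst ρ.right) b₁ ∧ semVal τ' ρ w a₁ b₁)
  | _, .arr τ τ', ρ => fun w a b =>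
      ValOf a ((Ty.arr τ τ').subst ρ.left) ∧ ValOf b ((Ty.arr τ τ').subst ρ.right) ∧
      ∀ y₁ y₂, ∀ v ≤ w, semVal τ ρ v y₁ y₂ →
        semExp (τ'.subst ρ.left) (τ'.subst ρ.right) (semVal τ' ρ) v (.app a y₁) (.app b y₂)
  | _, .all τ, ρ => fun w a b =>
      ValOf a ((Ty.all τ).subst ρ.left) ∧ ValOf b ((Ty.all τ).subst ρ.right) ∧
      ∀ (α₁ α₂ : Ty 0) (S : SRel), S.Mono → ∀ v ≤ w, S.IsVRel α₁ α₂ v →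
        semExp (τ.subst (push α₁ ρ.left)) (τ.subst (push α₂ ρ.right))
          (semVal τ (push ⟨α₁, α₂, S⟩ ρ)) v (.tapp a α₁) (.tapp b α₂)
  | _, .ex τ, ρ => fun w a b =>
      ValOf a ((Ty.ex τ).subst ρ.left) ∧ ValOf b ((Ty.ex τ).subst ρ.right) ∧
      ∃ (α₁ α₂ : Ty 0) (y₁ y₂ : Tm 0 0) (S : SRel), S.Mono ∧ S.IsVRel α₁ α₂ w ∧
        a = .pack α₁ y₁ (τ.subst (liftTy ρ.left)) ∧
        b = .pack α₂ y₂ (τ.subst (liftTy ρ.right)) ∧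
        semVal τ (push ⟨α₁, α₂, S⟩ ρ) w y₁ y₂
  | _, .mu τ, ρ => indexFix fun S w a b =>
      ValOf a ((Ty.mu τ).subst ρ.left) ∧ ValOf b ((Ty.mu τ).subst ρ.right) ∧
      ∃ y₁ y₂, a = .roll ((Ty.mu τ).subst ρ.left) y₁ ∧ b = .roll ((Ty.mu τ).subst ρ.right) y₂ ∧
        SRel.later (semVal τ (push ⟨(Ty.mu τ).subst ρ.left, (Ty.mu τ).subst ρ.right, S⟩ ρ)) w y₁ y₂

/-! ### The syntactic and the semantic relation agree -/

/-- A binary world-indexed relation of the Kripke model, without world `0`. -/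
def WRel.curry (S : WRel 2) : SRel := fun w a b => S (w + 1) ![a, b]

/-- The inverse of `WRel.curry`; everything holds in world `0`. -/
def SRel.uncurry (S : SRel) : WRel 2
  | 0, _ => True
  | w + 1, es => S w (es 0) (es 1)

theorem SRel.Mono.uncurry {S : SRel} (h : S.Mono) : S.uncurry.Mono := by
  intro i j es hij hj
  cases i with
  | zero => trivial
  | succ i =>
    cases j with
    | zero => omega
    | succ j => exact h i j _ _ (by omega) hj

theorem WRel.Mono.curry {S : WRel 2} (h : S.Mono) : S.curry.Mono :=
  fun u v _ _ huv hv => h (u + 1) (v + 1) _ (by omega) hv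

/-- The semantic environment denoted by `ρ` under a closing interpretation of its variables. -/
def TyEnv.interp {p n m : ℕ} {Δ : List ℕ} (ρ : TyEnv p n m Δ) (σ : Fin n → Ty 0)
    (s : Fin m → Tm 0 0) (δ : REnv Δ) : SEnv p :=
  fun i => ⟨(ρ i).left.subst σ, (ρ i).right.subst σ, WRel.curry ((ρ i).rel.interp σ s δ)⟩

theorem TyEnv.substL_subst {p n m : ℕ} {Δ : List ℕ} (ρ : TyEnv p n m Δ) (σ : Fin n → Ty 0)
    (s : Fin m → Tm 0 0) (δ : REnv Δ) (τ : Ty p) :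
    (ρ.substL τ).subst σ = τ.subst (ρ.interp σ s δ).left := Ty.subst_subst _ _ _

theorem TyEnv.substR_subst {p n m : ℕ} {Δ : List ℕ} (ρ : TyEnv p n m Δ) (σ : Fin n → Ty 0)
    (s : Fin m → Tm 0 0) (δ : REnv Δ) (τ : Ty p) :
    (ρ.substR τ).subst σ = τ.subst (ρ.interp σ s δ).right := Ty.subst_subst _ _ _

theorem TyEnv.interp_wk {p n m a b : ℕ} {Δ : List ℕ} (ρ : TyEnv p n m Δ)
    (σ : Fin (n + a) → Ty 0) (s : Fin (m + b) → Tm 0 0) (δ : REnv Δ) :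
    (ρ.wk a b).interp σ s δ =
      ρ.interp (fun i => σ (Fin.castAdd a i)) (fun i => s (Fin.castAdd b i)) δ := by
  funext i
  simp [TyEnv.interp, TyEnv.wk, Rel.wk, Rel.interp_rename, Ty.subst_rename]

theorem TyEnv.interp_wkR {p n m j : ℕ} {Δ : List ℕ} (ρ : TyEnv p n m Δ)
    (σ : Fin n → Ty 0) (s : Fin m → Tm 0 0) (S : WRel j) (δ : REnv Δ) :
    (ρ.wkR j).interp σ s (REnv.cons S δ) = ρ.interp σ s δ := by
  funext i
  simp [TyEnv.interp, TyEnv.wkR, Rel.wkR, Rel.interp_rename, REnv.cons]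

theorem TyEnv.interp_ext {p n m : ℕ} {Δ : List ℕ} (ρ : TyEnv p n m Δ) (τ₁ τ₂ : Ty n)
    (R : Rel n m Δ 2) (σ : Fin n → Ty 0) (s : Fin m → Tm 0 0) (δ : REnv Δ) :
    (ρ.ext τ₁ τ₂ R).interp σ s δ =
      push ⟨τ₁.subst σ, τ₂.subst σ, WRel.curry (R.interp σ s δ)⟩ (ρ.interp σ s δ) := by
  funext i
  refine Fin.cases ?_ (fun i => ?_) i <;> simp [TyEnv.interp, TyEnv.ext]

theorem Rel.interp_mem₂ {n m : ℕ} {Δ : List ℕ} (e₁ e₂ : Tm n m) (R : Rel n m Δ 2)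
    (σ : Fin n → Ty 0) (s : Fin m → Tm 0 0) (δ : REnv Δ) (w : ℕ) (es : Fin 0 → Tm 0 0) :
    (Rel.mem ![e₁, e₂] R).interp σ s δ (w + 1) es ↔
      WRel.curry (R.interp σ s δ) w (e₁.subst σ s) (e₂.subst σ s) := by
  have : (fun i => (![e₁, e₂] i).subst σ s) = ![e₁.subst σ s, e₂.subst σ s] := by
    funext i
    refine Fin.cases ?_ (fun i => ?_) i
    · rfl
    · rw [Subsingleton.elim i 0]; rfl
  simp only [Rel.interp, this, WRel.curry]

theorem Rel.interp_imp {n m : ℕ} {Δ : List ℕ} (P Q : Rel n m Δ 0)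
    (σ : Fin n → Ty 0) (s : Fin m → Tm 0 0) (δ : REnv Δ) (w : ℕ) (es : Fin 0 → Tm 0 0) :
    (Rel.imp P Q).interp σ s δ (w + 1) es ↔
      ∀ v ≤ w, P.interp σ s δ (v + 1) es → Q.interp σ s δ (v + 1) es := by
  simp only [Rel.interp]
  constructor
  · exact fun h v hv => h (v + 1) (by omega)
  · intro h v hv
    cases v with
    | zero => simp
    | succ v => exact h v (by omega)

theorem Rel.interp_valTy {n m : ℕ} {Δ : List ℕ} (e : Tm n m) (τ : Ty n)
    (σ : Fin n → Ty 0) (s : Fin m → Tm 0 0) (δ : REnv Δ) (w : ℕ) (es : Fin 0 → Tm 0 0) :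
    (Rel.valTy e τ).interp σ s δ (w + 1) es ↔ ValOf (e.subst σ s) (τ.subst σ) := by
  simp [Rel.valTy, Rel.interp, ValOf]

theorem Rel.interp_pairVal {n m : ℕ} {Δ : List ℕ} (τ₁ τ₂ : Ty n) (P : Rel n (m + 2) Δ 0)
    (σ : Fin n → Ty 0) (s : Fin m → Tm 0 0) (δ : REnv Δ) (w : ℕ) (a b : Tm 0 0) :
    (Rel.pairVal τ₁ τ₂ P).interp σ s δ (w + 1) ![a, b] ↔
      ValOf a (τ₁.subst σ) ∧ ValOf b (τ₂.subst σ) ∧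
        P.interp σ (Fin.append s ![a, b]) δ (w + 1) Fin.elim0 := by
  rw [Rel.pairVal, Rel.interp, Rel.interp, Rel.interp, Rel.interp_valTy, Rel.interp_valTy]
  simp [Tm.subst]

theorem Rel.interp_pairTy {n m : ℕ} {Δ : List ℕ} (τ₁ τ₂ : Ty n) (P : Rel n (m + 2) Δ 0)
    (σ : Fin n → Ty 0) (s : Fin m → Tm 0 0) (δ : REnv Δ) (w : ℕ) (a b : Tm 0 0) :
    (Rel.pairTy τ₁ τ₂ P).interp σ s δ (w + 1) ![a, b] ↔
      HasTy TyCtx.empty a (τ₁.subst σ) ∧ HasTy TyCtx.empty b (τ₂.subst σ) ∧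
        P.interp σ (Fin.append s ![a, b]) δ (w + 1) Fin.elim0 := by
  rw [Rel.pairTy, Rel.interp, Rel.interp, Rel.interp, Rel.interp, Rel.interp]
  simp [Tm.subst]

theorem Fin.append_elim_zero {A : Type} {n : ℕ} (f : Fin n → A) (g : Fin 0 → A) :
    (Fin.append f g : Fin n → A) = f := by
  funext i; exact Fin.append_left f g i

theorem Fin.eq_vec₂ {A : Type} (f : Fin 2 → A) : f = ![f 0, f 1] := by
  funext i; fin_cases i <;> rfl

theorem Rel.interp_all_tm₂ {n m : ℕ} {Δ : List ℕ} (P : Rel (n + 0) (m + 2) Δ 0)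
    (σ : Fin n → Ty 0) (s : Fin m → Tm 0 0) (δ : REnv Δ) (w : ℕ) (es : Fin 0 → Tm 0 0) :
    (Rel.all 0 2 P).interp σ s δ (w + 1) es ↔
      ∀ y₁ y₂, Rel.interp (n := n + 0) P σ (Fin.append s ![y₁, y₂]) δ (w + 1) es := by
  simp only [Rel.interp, Fin.append_elim_zero]
  constructor
  · exact fun h y₁ y₂ => h Fin.elim0 _
  · intro h σ' s'
    rw [Fin.eq_vec₂ s']
    exact h _ _

theorem Rel.interp_ex_tm₂ {n m : ℕ} {Δ : List ℕ} (P : Rel (n + 0) (m + 2) Δ 0)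
    (σ : Fin n → Ty 0) (s : Fin m → Tm 0 0) (δ : REnv Δ) (w : ℕ) (es : Fin 0 → Tm 0 0) :
    (Rel.ex 0 2 P).interp σ s δ (w + 1) es ↔
      ∃ y₁ y₂, Rel.interp (n := n + 0) P σ (Fin.append s ![y₁, y₂]) δ (w + 1) es := by
  simp only [Rel.interp, Fin.append_elim_zero]
  constructor
  · rintro ⟨σ', s', h⟩
    rw [Fin.eq_vec₂ s'] at h
    exact ⟨_, _, h⟩
  · rintro ⟨y₁, y₂, h⟩
    exact ⟨Fin.elim0, _, h⟩

theorem Rel.interp_all_tm₁ {n m : ℕ} {Δ : List ℕ} (P : Rel (n + 0) (m + 1) Δ 0)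
    (σ : Fin n → Ty 0) (s : Fin m → Tm 0 0) (δ : REnv Δ) (w : ℕ) (es : Fin 0 → Tm 0 0) :
    (Rel.all 0 1 P).interp σ s δ (w + 1) es ↔
      ∀ y, Rel.interp (n := n + 0) P σ (Fin.append s ![y]) δ (w + 1) es := by
  simp only [Rel.interp, Fin.append_elim_zero]
  constructor
  · exact fun h y => h Fin.elim0 _
  · intro h σ' s'
    rw [show s' = ![s' 0] by funext i; fin_cases i; rfl]
    exact h _

theorem Rel.interp_ex_tm₁ {n m : ℕ} {Δ : List ℕ} (P : Rel (n + 0) (m + 1) Δ 0)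
    (σ : Fin n → Ty 0) (s : Fin m → Tm 0 0) (δ : REnv Δ) (w : ℕ) (es : Fin 0 → Tm 0 0) :
    (Rel.ex 0 1 P).interp σ s δ (w + 1) es ↔
      ∃ y, Rel.interp (n := n + 0) P σ (Fin.append s ![y]) δ (w + 1) es := by
  simp only [Rel.interp, Fin.append_elim_zero]
  constructor
  · rintro ⟨σ', s', h⟩
    rw [show s' = ![s' 0] by funext i; fin_cases i; rfl] at h
    exact ⟨_, h⟩
  · rintro ⟨y, h⟩
    exact ⟨Fin.elim0, _, h⟩

theorem Rel.interp_isVRel {n m : ℕ} {Δ : List ℕ} (R : Rel n m Δ 2) (τ₁ τ₂ : Ty n)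
    (σ : Fin n → Ty 0) (s : Fin m → Tm 0 0) (δ : REnv Δ) (w : ℕ) (es : Fin 0 → Tm 0 0) :
    (Rel.isVRel R τ₁ τ₂).interp σ s δ (w + 1) es ↔
      (WRel.curry (R.interp σ s δ)).IsVRel (τ₁.subst σ) (τ₂.subst σ) w := by
  rw [Rel.isVRel, Rel.interp_all_tm₂]
  simp only [Rel.interp_imp, Rel.interp_mem₂, Rel.wk, Rel.interp_rename]
  simp [Rel.interp, Rel.interp_valTy, Tm.subst, SRel.IsVRel]
  exact ⟨fun h v hv a b => h a b v hv, fun h a b v hv => h v hv a b⟩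

theorem Tm.subst_new {n m b : ℕ} (σ : Fin n → Ty 0) (s : Fin m → Tm 0 0)
    (es : Fin b → Tm 0 0) (i : Fin b) : (Tm.new m i).subst σ (Fin.append s es) = es i := by
  simp [Tm.subst]

theorem Tm.subst_wk {n m a b : ℕ} (e : Tm n m) (σ : Fin (n + a) → Ty 0)
    (s : Fin (m + b) → Tm 0 0) : (e.wk a b).subst σ s =
      e.subst (fun i => σ (Fin.castAdd a i)) (fun i => s (Fin.castAdd b i)) :=
  Tm.subst_rename _ _ _ _ _

/-- A special case of `Tm.subst_wk`, up to the identification of `n + 0` with `n`. -/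
theorem Tm.subst_wk_zero {n m b : ℕ} (e : Tm n m) (σ : Fin n → Ty 0)
    (s : Fin (m + b) → Tm 0 0) : Tm.subst (n := n) σ s (e.wk 0 b) =
      e.subst σ (fun i => s (Fin.castAdd b i)) :=
  Tm.subst_wk (a := 0) e σ s

theorem Rel.interp_and {n m : ℕ} {Δ : List ℕ} (P Q : Rel n m Δ 0)
    (σ : Fin n → Ty 0) (s : Fin m → Tm 0 0) (δ : REnv Δ) (w : ℕ) (es : Fin 0 → Tm 0 0) :
    (Rel.and P Q).interp σ s δ (w + 1) es ↔
      P.interp σ s δ (w + 1) es ∧ Q.interp σ s δ (w + 1) es := by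
  simp only [Rel.interp]

theorem Rel.interp_or {n m : ℕ} {Δ : List ℕ} (P Q : Rel n m Δ 0)
    (σ : Fin n → Ty 0) (s : Fin m → Tm 0 0) (δ : REnv Δ) (w : ℕ) (es : Fin 0 → Tm 0 0) :
    (Rel.or P Q).interp σ s δ (w + 1) es ↔
      P.interp σ s δ (w + 1) es ∨ Q.interp σ s δ (w + 1) es := by
  simp only [Rel.interp]

theorem Rel.interp_eq {n m : ℕ} {Δ : List ℕ} (e₁ e₂ : Tm n m)
    (σ : Fin n → Ty 0) (s : Fin m → Tm 0 0) (δ : REnv Δ) (w : ℕ) (es : Fin 0 → Tm 0 0) :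
    (Rel.eq e₁ e₂).interp σ s δ (w + 1) es ↔ e₁.subst σ s = e₂.subst σ s := by
  simp only [Rel.interp]

theorem Rel.interp_ciu {n m : ℕ} {Δ : List ℕ} (e₁ e₂ : Tm n m)
    (σ : Fin n → Ty 0) (s : Fin m → Tm 0 0) (δ : REnv Δ) (w : ℕ) (es : Fin 0 → Tm 0 0) :
    (Rel.ciu e₁ e₂).interp σ s δ (w + 1) es ↔
      ∃ τ, CiuClosed (e₁.subst σ s) (e₂.subst σ s) τ := by
  simp only [Rel.interp]

theorem Rel.interp_steps1 {n m : ℕ} {Δ : List ℕ} (e₁ e₂ : Tm n m)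
    (σ : Fin n → Ty 0) (s : Fin m → Tm 0 0) (δ : REnv Δ) (w : ℕ) (es : Fin 0 → Tm 0 0) :
    (Rel.steps1 e₁ e₂).interp σ s δ (w + 1) es ↔ StepsN 1 (e₁.subst σ s) (e₂.subst σ s) := by
  simp only [Rel.interp]

theorem Rel.interp_evals0 {n m : ℕ} {Δ : List ℕ} (e₁ e₂ : Tm n m)
    (σ : Fin n → Ty 0) (s : Fin m → Tm 0 0) (δ : REnv Δ) (w : ℕ) (es : Fin 0 → Tm 0 0) :
    (Rel.evals0 e₁ e₂).interp σ s δ (w + 1) es ↔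
      StepsN 0 (e₁.subst σ s) (e₂.subst σ s) ∧ IsVal (e₂.subst σ s) := by
  simp [Rel.evals0, Rel.interp]

theorem Rel.interp_later_mem₂ {n m : ℕ} {Δ : List ℕ} (e₁ e₂ : Tm n m) (R : Rel n m Δ 2)
    (σ : Fin n → Ty 0) (s : Fin m → Tm 0 0) (δ : REnv Δ) (w : ℕ) (es : Fin 0 → Tm 0 0) :
    (Rel.later (.mem ![e₁, e₂] R)).interp σ s δ (w + 1) es ↔
      SRel.later (WRel.curry (R.interp σ s δ)) w (e₁.subst σ s) (e₂.subst σ s) := by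
  rw [Rel.interp]
  cases w with
  | zero => simp [SRel.later]
  | succ w => rw [Rel.interp_mem₂]; rfl

/-- The body of `Rel.termRel`, here called `R'`, is guarded, so that the fixed point equation
applies. -/
theorem termRel_guarded {n m : ℕ} {Δ : List ℕ} (R : Rel n m Δ 2) {R' : Rel n m (2 :: Δ) 2}
    {τ₁ τ₂ : Ty n} (h : Rel.termRel τ₁ τ₂ R = .mu R') : R'.GuardedAt 0 := by
  cases h
  refine ⟨trivial, trivial, ⟨⟨trivial, trivial⟩, trivial, ?_⟩, ⟨trivial, trivial⟩⟩
  have := Rel.guardedAt_rename R id id (fun _ r => .succ r : RRen Δ (2 :: Δ)) 0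
    (fun k r => by simp [RVar.idx])
  exact Rel.guardedAt_rename_of _ _ _ _ 0 0 (fun _ _ h => h)
    (Rel.guardedAt_rename_of _ _ _ _ 0 0 (fun _ _ h => h)
      (Rel.guardedAt_rename_of _ _ _ _ 0 0 (fun _ _ h => h) this))

theorem Rel.curry_interp_var_zero {n m : ℕ} {Δ : List ℕ} (σ : Fin n → Ty 0) (s : Fin m → Tm 0 0)
    (S : WRel 2) (δ : REnv Δ) :
    WRel.curry ((Rel.var .zero).interp σ s (REnv.cons S δ)) = S.curry := by
  funext w a b
  simp [WRel.curry, Rel.interp, REnv.cons]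

/-- The fixed point equation of the term relation, with the connectives of the logic interpreted. -/
theorem Rel.interp_termRel_unfold {n m : ℕ} {Δ : List ℕ} (τ₁ τ₂ : Ty n) (R : Rel n m Δ 2)
    (σ : Fin n → Ty 0) (s : Fin m → Tm 0 0) (δ : REnv Δ) (w : ℕ) (a b : Tm 0 0) :
    WRel.curry ((Rel.termRel τ₁ τ₂ R).interp σ s δ) w a b ↔
      HasTy TyCtx.empty a (τ₁.subst σ) ∧ HasTy TyCtx.empty b (τ₂.subst σ) ∧
      (∀ x₁, ∀ v ≤ w, StepsN 0 a x₁ → IsVal x₁ → ∃ x₂, (∃ τ, CiuClosed x₂ b τ) ∧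
        WRel.curry (R.interp σ s δ) v x₁ x₂) ∧
      ∀ a', ∀ v ≤ w, StepsN 1 a a' →
        SRel.later (WRel.curry ((Rel.termRel τ₁ τ₂ R).interp σ s δ)) v a' b := by
  conv_lhs => rw [WRel.curry, Rel.termRel, Rel.interp_mu _ (termRel_guarded R rfl)]
  rw [Rel.interp_pairTy]
  refine and_congr_right fun _ => and_congr_right fun _ => ?_
  rw [Rel.interp, Rel.interp_all_tm₁, Rel.interp_all_tm₁]
  simp only [Rel.interp_imp, Rel.interp_ex_tm₁]
  refine and_congr ?_ ?_
  · refine forall_congr' fun x₁ => forall_congr' fun v => forall_congr' fun hv => ?_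
    simp only [Rel.interp_evals0, Rel.interp_and, Rel.interp_ciu, Rel.interp_mem₂, Rel.wk,
      Rel.wkR, Rel.interp_rename, Tm.subst_wk_zero, Tm.subst_new, Fin.append_left, id, REnv.cons]
    simp
  · refine forall_congr' fun x₁ => forall_congr' fun v => forall_congr' fun hv => ?_
    simp only [Rel.interp_steps1, Rel.interp_later_mem₂, Tm.subst_wk_zero, Tm.subst_new,
      Fin.append_left]
    simp [Rel.curry_interp_var_zero, Rel.termRel]

/-- The recursively defined term relation of the logic is the explicit one: unfolding the recursion
once for each unroll-roll reduction consumes the whole evaluation of the first term. -/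
theorem Rel.curry_interp_termRel {n m : ℕ} {Δ : List ℕ} (τ₁ τ₂ : Ty n) (R : Rel n m Δ 2)
    (σ : Fin n → Ty 0) (s : Fin m → Tm 0 0) (δ : REnv Δ) :
    WRel.curry ((Rel.termRel τ₁ τ₂ R).interp σ s δ) =
      semExp (τ₁.subst σ) (τ₂.subst σ) (WRel.curry (R.interp σ s δ)) := by
  funext w a b
  induction w using Nat.strong_induction_on generalizing a with
  | _ w ih =>
    rw [Rel.interp_termRel_unfold]
    refine propext (and_congr_right fun ha => and_congr_right fun hb => ?_)
    constructor
    · rintro ⟨h₀, h₁⟩ j v hjv x hx hv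
      cases j with
      | zero =>
        obtain ⟨x₂, ⟨τ, hτ⟩, h⟩ := h₀ x v (by omega) hx hv
        exact ⟨x₂, hτ.2.1.unique hb ▸ hτ, h⟩
      | succ j =>
        obtain ⟨a', ha', hx⟩ := hx.split j rfl
        obtain ⟨w, rfl⟩ : ∃ w', w = w' + 1 := ⟨w - 1, by omega⟩
        have h := h₁ a' (w + 1) le_rfl ha'
        rw [SRel.later, ih w (by omega)] at h
        exact h.2.2 j v (by omega) x hx hv
    · intro h
      refine ⟨fun x v hv hx hval => ?_, fun a' v hv ha' => ?_⟩
      · obtain ⟨x₂, h₁, h₂⟩ := h 0 v (by omega) x hx hval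
        exact ⟨x₂, ⟨_, h₁⟩, h₂⟩
      · cases v with
        | zero => trivial
        | succ v =>
          rw [SRel.later, ih v (by omega)]
          exact ⟨ha.stepsN ha', hb, fun j u hju x hx hval =>
            h (1 + j) u (by omega) x (ha'.trans hx) hval⟩

/-- If `F` and `G` agree up to currying, then so do their fixed points. -/
theorem indexFix_eq_worldFix {F : SRel → SRel} {G : WRel 2 → WRel 2}
    (h : ∀ S, WRel.curry (G S) = F (WRel.curry S)) (w : ℕ) :
    ∀ a b, worldFix G (w + 1) ![a, b] = indexFix F w a b := by
  induction w using Nat.strong_induction_on with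
  | _ w ih =>
    intro a b
    rw [worldFix, indexFix]
    refine (congrFun (congrFun (congrFun (h _) w) a) b).trans ?_
    congr 1
    funext v a b
    refine propext ⟨?_, ?_⟩
    · rintro ⟨hv, h⟩
      exact ⟨by omega, (ih v (by omega) a b) ▸ h⟩
    · rintro ⟨hv, h⟩
      exact ⟨by omega, (ih v (by omega) a b) ▸ h⟩

theorem Rel.interp_ex_tm₄ {n m : ℕ} {Δ : List ℕ} (P : Rel (n + 0) (m + 4) Δ 0)
    (σ : Fin n → Ty 0) (s : Fin m → Tm 0 0) (δ : REnv Δ) (w : ℕ) (es : Fin 0 → Tm 0 0) :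
    (Rel.ex 0 4 P).interp σ s δ (w + 1) es ↔
      ∃ y₁ y₂ y₃ y₄,
        Rel.interp (n := n + 0) P σ (Fin.append s ![y₁, y₂, y₃, y₄]) δ (w + 1) es := by
  simp only [Rel.interp, Fin.append_elim_zero]
  constructor
  · rintro ⟨σ', s', h⟩
    rw [show s' = ![s' 0, s' 1, s' 2, s' 3] by funext i; fin_cases i <;> rfl] at h
    exact ⟨_, _, _, _, h⟩
  · rintro ⟨y₁, y₂, y₃, y₄, h⟩
    exact ⟨Fin.elim0, _, h⟩

theorem Rel.interp_all_ty₂ {n m : ℕ} {Δ : List ℕ} (P : Rel (n + 2) (m + 0) Δ 0)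
    (σ : Fin n → Ty 0) (s : Fin m → Tm 0 0) (δ : REnv Δ) (w : ℕ) (es : Fin 0 → Tm 0 0) :
    (Rel.all 2 0 P).interp σ s δ (w + 1) es ↔
      ∀ α₁ α₂, Rel.interp (m := m + 0) P (Fin.append σ ![α₁, α₂]) s δ (w + 1) es := by
  simp only [Rel.interp, Fin.append_elim_zero]
  constructor
  · exact fun h y₁ y₂ => h _ Fin.elim0
  · intro h σ' s'
    rw [Fin.eq_vec₂ σ']
    exact h _ _

theorem Rel.interp_ex_ty₂_tm₂ {n m : ℕ} {Δ : List ℕ} (P : Rel (n + 2) (m + 2) Δ 0)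
    (σ : Fin n → Ty 0) (s : Fin m → Tm 0 0) (δ : REnv Δ) (w : ℕ) (es : Fin 0 → Tm 0 0) :
    (Rel.ex 2 2 P).interp σ s δ (w + 1) es ↔
      ∃ α₁ α₂ y₁ y₂,
        Rel.interp P (Fin.append σ ![α₁, α₂]) (Fin.append s ![y₁, y₂]) δ (w + 1) es := by
  simp only [Rel.interp]
  constructor
  · rintro ⟨σ', s', h⟩
    rw [Fin.eq_vec₂ s', Fin.eq_vec₂ σ'] at h
    exact ⟨_, _, _, _, h⟩
  · rintro ⟨α₁, α₂, y₁, y₂, h⟩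
    exact ⟨_, _, h⟩

theorem TyEnv.interp_wk_zero {p n m b : ℕ} {Δ : List ℕ} (ρ : TyEnv p n m Δ)
    (σ : Fin n → Ty 0) (s : Fin (m + b) → Tm 0 0) (δ : REnv Δ) :
    TyEnv.interp (n := n) (ρ.wk 0 b) σ s δ =
      ρ.interp σ (fun i => s (Fin.castAdd b i)) δ :=
  TyEnv.interp_wk (a := 0) ρ σ s δ

theorem TyEnv.interp_wk_ty {p n m a : ℕ} {Δ : List ℕ} (ρ : TyEnv p n m Δ)
    (σ : Fin (n + a) → Ty 0) (s : Fin m → Tm 0 0) (δ : REnv Δ) :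
    TyEnv.interp (m := m) (ρ.wk a 0) σ s δ =
      ρ.interp (fun i => σ (Fin.castAdd a i)) s δ :=
  TyEnv.interp_wk (b := 0) ρ σ s δ

theorem TyEnv.substL_wk_zero {p n m b : ℕ} {Δ : List ℕ} (ρ : TyEnv p n m Δ) (τ : Ty p)
    (σ : Fin n → Ty 0) :
    Ty.subst (n := n) σ ((ρ.wk 0 b).substL τ) = (ρ.substL τ).subst σ := by
  refine (Ty.subst_subst _ _ _).trans (Eq.trans ?_ (Ty.subst_subst _ _ _).symm)
  congr 1; funext i; exact Ty.subst_rename _ _ _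

theorem TyEnv.substR_wk_zero {p n m b : ℕ} {Δ : List ℕ} (ρ : TyEnv p n m Δ) (τ : Ty p)
    (σ : Fin n → Ty 0) :
    Ty.subst (n := n) σ ((ρ.wk 0 b).substR τ) = (ρ.substR τ).subst σ := by
  refine (Ty.subst_subst _ _ _).trans (Eq.trans ?_ (Ty.subst_subst _ _ _).symm)
  congr 1; funext i; exact Ty.subst_rename _ _ _

theorem TyEnv.substL_wkR {p n m j : ℕ} {Δ : List ℕ} (ρ : TyEnv p n m Δ) (τ : Ty p) :
    (ρ.wkR j).substL τ = ρ.substL τ := rfl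

theorem TyEnv.substR_wkR {p n m j : ℕ} {Δ : List ℕ} (ρ : TyEnv p n m Δ) (τ : Ty p) :
    (ρ.wkR j).substR τ = ρ.substR τ := rfl

theorem Tm.subst_wk_ty {n m a : ℕ} (e : Tm n m) (σ : Fin (n + a) → Ty 0)
    (s : Fin m → Tm 0 0) : Tm.subst (m := m) σ s (e.wk a 0) =
      e.subst (fun i => σ (Fin.castAdd a i)) s :=
  Tm.subst_wk (b := 0) e σ s

theorem Ty.subst_new {n b : ℕ} (σ : Fin n → Ty 0) (σ' : Fin b → Ty 0) (i : Fin b) :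
    (Ty.var (Fin.natAdd n i)).subst (Fin.append σ σ') = σ' i := by
  simp [Ty.subst]

theorem Rel.interp_allR {n m j : ℕ} {Δ : List ℕ} (P : Rel n m (j :: Δ) 0)
    (σ : Fin n → Ty 0) (s : Fin m → Tm 0 0) (δ : REnv Δ) (w : ℕ) (es : Fin 0 → Tm 0 0) :
    (Rel.allR j P).interp σ s δ (w + 1) es ↔
      ∀ S : WRel j, S.Mono → P.interp σ s (REnv.cons S δ) (w + 1) es := by
  simp only [Rel.interp]

theorem Rel.interp_exR {n m j : ℕ} {Δ : List ℕ} (P : Rel n m (j :: Δ) 0)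
    (σ : Fin n → Ty 0) (s : Fin m → Tm 0 0) (δ : REnv Δ) (w : ℕ) (es : Fin 0 → Tm 0 0) :
    (Rel.exR j P).interp σ s δ (w + 1) es ↔
      ∃ S : WRel j, S.Mono ∧ P.interp σ s (REnv.cons S δ) (w + 1) es := by
  simp only [Rel.interp]

/-- The operator whose fixed point is `𝒱⟦μα.τ⟧ρ`, in the model. -/
theorem curry_interp_muBody {p : ℕ} {τ : Ty (p + 1)}
    (ih : ∀ {n m : ℕ} {Δ : List ℕ} (ρ : TyEnv (p + 1) n m Δ) (σ : Fin n → Ty 0)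
      (s : Fin m → Tm 0 0) (δ : REnv Δ),
      WRel.curry ((valRel τ ρ).interp σ s δ) = semVal τ (ρ.interp σ s δ))
    {n m : ℕ} {Δ : List ℕ} (ρ : TyEnv p n m Δ) (σ : Fin n → Ty 0) (s : Fin m → Tm 0 0)
    (δ : REnv Δ) (S : WRel 2) :
    let ρ₀ := ((ρ.wkR 2).wk 0 2).wk 0 2
    let y := Tm.new (m + 2) (b := 2)
    WRel.curry (Rel.interp (.pairVal (ρ.substL (.mu τ)) (ρ.substR (.mu τ))
      (.ex 0 2
        (.and (.eq ((Tm.new m 0).wk 0 2) (.roll (ρ₀.substL (.mu τ)) (y 0)))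
        (.and (.eq ((Tm.new m 1).wk 0 2) (.roll (ρ₀.substR (.mu τ)) (y 1)))
          (.later (.mem ![y 0, y 1] (valRel τ (ρ₀.ext (ρ₀.substL (.mu τ)) (ρ₀.substR (.mu τ))
            (.var .zero)))))))))
      σ s (REnv.cons S δ)) =
    fun w a b =>
      ValOf a ((Ty.mu τ).subst (ρ.interp σ s δ).left) ∧
      ValOf b ((Ty.mu τ).subst (ρ.interp σ s δ).right) ∧
      ∃ y₁ y₂, a = .roll ((Ty.mu τ).subst (ρ.interp σ s δ).left) y₁ ∧
        b = .roll ((Ty.mu τ).subst (ρ.interp σ s δ).right) y₂ ∧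
        SRel.later (semVal τ (push ⟨(Ty.mu τ).subst (ρ.interp σ s δ).left,
          (Ty.mu τ).subst (ρ.interp σ s δ).right, WRel.curry S⟩ (ρ.interp σ s δ))) w y₁ y₂ := by
  funext w a b
  rw [WRel.curry, Rel.interp_pairVal, ← TyEnv.substL_subst,
    ← TyEnv.substR_subst, Rel.interp_ex_tm₂]
  simp only [Rel.interp_and, Rel.interp_eq, Rel.interp_later_mem₂, Tm.subst_wk_zero, Tm.subst,
    ih, TyEnv.interp_wk_zero, Fin.append_left, Fin.append_right, TyEnv.substL_wk_zero,
    TyEnv.substR_wk_zero, TyEnv.substL_wkR, TyEnv.substR_wkR, TyEnv.interp_ext,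
    TyEnv.interp_wkR, Rel.curry_interp_var_zero]
  simp

/-- The model interprets `𝒱⟦τ⟧ρ` as `semVal`, for every interpretation of the free variables. -/
theorem curry_interp_valRel {p : ℕ} (τ : Ty p) :
    ∀ {n m : ℕ} {Δ : List ℕ} (ρ : TyEnv p n m Δ) (σ : Fin n → Ty 0) (s : Fin m → Tm 0 0)
      (δ : REnv Δ),
      WRel.curry ((valRel τ ρ).interp σ s δ) = semVal τ (ρ.interp σ s δ) := by
  have hE : ∀ {p : ℕ} {τ : Ty p}, (∀ {n m : ℕ} {Δ : List ℕ} (ρ : TyEnv p n m Δ)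
      (σ : Fin n → Ty 0) (s : Fin m → Tm 0 0) (δ : REnv Δ),
      WRel.curry ((valRel τ ρ).interp σ s δ) = semVal τ (ρ.interp σ s δ)) →
      ∀ {n m : ℕ} {Δ : List ℕ} (ρ : TyEnv p n m Δ)
      (σ : Fin n → Ty 0) (s : Fin m → Tm 0 0) (δ : REnv Δ),
      WRel.curry ((Rel.termRel (ρ.substL τ) (ρ.substR τ) (valRel τ ρ)).interp σ s δ) =
        semExp (τ.subst (ρ.interp σ s δ).left) (τ.subst (ρ.interp σ s δ).right)
          (semVal τ (ρ.interp σ s δ)) := by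
    intro p τ ih n m Δ ρ σ s δ
    rw [Rel.curry_interp_termRel, ih, ← TyEnv.substL_subst, ← TyEnv.substR_subst]
  induction τ <;> intro n m Δ ρ σ s δ
  case var => rfl
  case unit | int | bool =>
    funext w a b
    rw [WRel.curry, valRel, Rel.interp_pairVal, semVal, Rel.interp_eq, Tm.subst_new, Tm.subst_new]
    rfl
  case prod τ τ' ih ih' =>
    funext w a b
    rw [WRel.curry, valRel, Rel.interp_pairVal, semVal, ← TyEnv.substL_subst,
      ← TyEnv.substR_subst, Rel.interp_ex_tm₄]
    simp only [Rel.interp_and, Rel.interp_eq, Rel.interp_mem₂, Tm.subst_wk_zero, Tm.subst,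
      ih, ih', TyEnv.interp_wk_zero, Fin.append_left, Fin.append_right]
    simp
  case sum τ τ' ih ih' =>
    funext w a b
    rw [WRel.curry, valRel, Rel.interp_pairVal, semVal, ← TyEnv.substL_subst,
      ← TyEnv.substR_subst, Rel.interp_or, Rel.interp_ex_tm₂, Rel.interp_ex_tm₂]
    simp only [Rel.interp_and, Rel.interp_eq, Rel.interp_mem₂, Tm.subst_wk_zero, Tm.subst,
      ih, ih', TyEnv.interp_wk_zero, Fin.append_left, Fin.append_right, TyEnv.substL_wk_zero,
      TyEnv.substR_wk_zero]
    simp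
  case arr τ τ' ih ih' =>
    funext w a b
    rw [WRel.curry, valRel, Rel.interp_pairVal, semVal, ← TyEnv.substL_subst,
      ← TyEnv.substR_subst, Rel.interp_all_tm₂]
    simp only [Rel.interp_imp, Rel.interp_mem₂, Tm.subst_wk_zero, Tm.subst,
      ih, hE ih', TyEnv.interp_wk_zero, Fin.append_left, Fin.append_right]
    simp
  case all τ ih =>
    funext w a b
    rw [WRel.curry, valRel, Rel.interp_pairVal, semVal, ← TyEnv.substL_subst,
      ← TyEnv.substR_subst, Rel.interp_all_ty₂]
    simp only [Rel.interp_imp, Rel.interp_allR, Rel.interp_mem₂, Tm.subst_wk_ty, Tm.subst,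
      Rel.interp_isVRel, hE ih, TyEnv.interp_ext, TyEnv.interp_wkR, TyEnv.interp_wk_ty,
      TyEnv.interp_wk_zero, Fin.append_left, Fin.append_right, Rel.curry_interp_var_zero,
      Ty.subst_new, SEnv.left_push, SEnv.right_push]
    refine propext (and_congr_right fun _ => and_congr_right fun _ =>
      forall_congr' fun α₁ => forall_congr' fun α₂ => ?_)
    exact ⟨fun h S hS => h S.uncurry hS.uncurry, fun h S hS => h S.curry hS.curry⟩
  case ex τ ih =>
    funext w a b
    rw [WRel.curry, valRel, Rel.interp_pairVal, semVal, ← TyEnv.substL_subst,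
      ← TyEnv.substR_subst, Rel.interp_ex_ty₂_tm₂]
    simp only [Rel.interp_and, Rel.interp_exR, Rel.interp_eq, Rel.interp_mem₂, Tm.subst_wk,
      Tm.subst, Rel.interp_isVRel, ih, TyEnv.interp_ext, TyEnv.interp_wkR, TyEnv.interp_wk,
      Fin.append_left, Fin.append_right, Rel.curry_interp_var_zero,
      Ty.subst_new, Ty.subst_subst, liftTy_subst]
    refine propext (and_congr_right fun _ => and_congr_right fun _ =>
      exists_congr fun α₁ => exists_congr fun α₂ => exists_congr fun y₁ =>
      exists_congr fun y₂ => ?_)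
    have hleft : (fun i => Ty.subst (Fin.append σ ![α₁, α₂])
        ((((ρ.wk 0 2).wk 2 2).wkR 2) i).left) = SEnv.left (ρ.interp σ s δ) := by
      funext i
      simp [TyEnv.wk, TyEnv.wkR, Ty.subst_rename, SEnv.left, TyEnv.interp]
    have hright : (fun i => Ty.subst (Fin.append σ ![α₁, α₂])
        ((((ρ.wk 0 2).wk 2 2).wkR 2) i).right) = SEnv.right (ρ.interp σ s δ) := by
      funext i
      simp [TyEnv.wk, TyEnv.wkR, Ty.subst_rename, SEnv.right, TyEnv.interp]
    rw [hleft, hright]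
    exact ⟨fun ⟨S, hS, h⟩ => ⟨S.curry, hS.curry, h⟩, fun ⟨S, hS, h⟩ => ⟨S.uncurry, hS.uncurry, h⟩⟩
  case mu τ ih =>
    funext w a b
    rw [WRel.curry, valRel, semVal, Rel.interp]
    exact indexFix_eq_worldFix (fun S => curry_interp_muBody ih ρ σ s δ S) w a b

/-! ### Semantic environments and their representation -/

/-- Interpretation of the relation variables of `logEnv`. -/
def relEnv : {p : ℕ} → (Fin p → WRel 2) → REnv (List.replicate p 2)
  | 0, _ => fun _ r => nomatch r
  | _ + 1, S => REnv.cons (S 0) (relEnv fun i => S i.succ)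

theorem relEnv_relVar {p : ℕ} (S : Fin p → WRel 2) (i : Fin p) : relEnv S 2 (relVar i) = S i := by
  induction p with
  | zero => exact i.elim0
  | succ p ih =>
    obtain ⟨i, hi⟩ := i
    cases i with
    | zero => rfl
    | succ i => exact ih (fun i => S i.succ) ⟨i, Nat.lt_of_succ_lt_succ hi⟩

theorem relEnv_mono {p : ℕ} {S : Fin p → WRel 2} (h : ∀ i, (S i).Mono) :
    ∀ k (r : RVar (List.replicate p 2) k), (relEnv S k r).Mono := by
  induction p with
  | zero => intro k r; exact nomatch r
  | succ p ih =>
    intro k r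
    cases r with
    | zero => exact h 0
    | succ r => exact ih (fun i => h i.succ) k r

theorem curry_interp_var {n m : ℕ} {Δ : List ℕ} (r : RVar Δ 2) (σ : Fin n → Ty 0)
    (s : Fin m → Tm 0 0) (δ : REnv Δ) :
    WRel.curry ((Rel.var r).interp σ s δ) = WRel.curry (δ 2 r) := by
  funext w a b
  simp [WRel.curry, Rel.interp]

theorem logEnv_interp {p m : ℕ} (σ : Fin (p + p) → Ty 0) (s : Fin m → Tm 0 0)
    (δ : REnv (List.replicate p 2)) :
    (logEnv p m).interp σ s δ =
      fun i => ⟨σ (Fin.castAdd p i), σ (Fin.natAdd p i), WRel.curry (δ 2 (relVar i))⟩ := by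
  funext i
  simp [logEnv, TyEnv.interp, curry_interp_var, Ty.subst]

theorem logEnv_interp_append {p m : ℕ} (ρ : SEnv p) (s : Fin m → Tm 0 0) :
    (logEnv p m).interp (Fin.append ρ.left ρ.right) s (relEnv fun i => (ρ i).rel.uncurry) = ρ := by
  rw [logEnv_interp]
  funext i
  rw [Fin.append_left, Fin.append_right, relEnv_relVar]
  rfl

/-! ### Properties of the value relation -/

/-- The expansion of a recursive type. It is inherited from the fixed point in the logic, since
every semantic environment interprets some syntactic one. -/
theorem semVal_mu {p : ℕ} (τ : Ty (p + 1)) (ρ : SEnv p) (w : ℕ) (a b : Tm 0 0) :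
    semVal (.mu τ) ρ w a b ↔
      ValOf a ((Ty.mu τ).subst ρ.left) ∧ ValOf b ((Ty.mu τ).subst ρ.right) ∧
      ∃ y₁ y₂, a = .roll ((Ty.mu τ).subst ρ.left) y₁ ∧ b = .roll ((Ty.mu τ).subst ρ.right) y₂ ∧
        SRel.later (semVal τ (push ⟨(Ty.mu τ).subst ρ.left, (Ty.mu τ).subst ρ.right,
          semVal (.mu τ) ρ⟩ ρ)) w y₁ y₂ := by
  have key := curry_interp_valRel (.mu τ) (logEnv p 0) (Fin.append ρ.left ρ.right) Fin.elim0
    (relEnv fun i => (ρ i).rel.uncurry)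
  rw [logEnv_interp_append] at key
  have hwf := valRel_wf (.mu τ) (logEnv p 0) (fun _ => trivial)
  rw [valRel] at key hwf
  conv_lhs => rw [← key, Rel.interp_mu _ hwf.1, curry_interp_muBody (curry_interp_valRel τ),
    logEnv_interp_append]
  rw [key]

/-- The value relation is monotone as soon as `ρ` is; only indices up to `w` matter, which the
induction for recursive types needs. -/
theorem semVal_mono {p : ℕ} (τ : Ty p) : ∀ {ρ : SEnv p} {w : ℕ},
    (∀ i u v a b, u ≤ v → v ≤ w → (ρ i).rel v a b → (ρ i).rel u a b) →
    ∀ u ≤ w, ∀ a b, semVal τ ρ w a b → semVal τ ρ u a b := by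
  induction τ <;> intro ρ w hρ u hu a b h
  case var i => exact hρ i u w a b hu le_rfl h
  case unit | int | bool => exact h
  case prod ih ih' =>
    obtain ⟨ha, hb, a₁, a₂, b₁, b₂, rfl, rfl, h₁, h₂⟩ := h
    exact ⟨ha, hb, a₁, a₂, b₁, b₂, rfl, rfl, ih hρ u hu _ _ h₁, ih' hρ u hu _ _ h₂⟩
  case sum ih ih' =>
    obtain ⟨ha, hb, ⟨a₁, b₁, rfl, rfl, h⟩ | ⟨a₁, b₁, rfl, rfl, h⟩⟩ := h
    · exact ⟨ha, hb, .inl ⟨a₁, b₁, rfl, rfl, ih hρ u hu _ _ h⟩⟩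
    · exact ⟨ha, hb, .inr ⟨a₁, b₁, rfl, rfl, ih' hρ u hu _ _ h⟩⟩
  case arr => exact ⟨h.1, h.2.1, fun y₁ y₂ v hv => h.2.2 y₁ y₂ v (hv.trans hu)⟩
  case all => exact ⟨h.1, h.2.1, fun α₁ α₂ S hS v hv => h.2.2 α₁ α₂ S hS v (hv.trans hu)⟩
  case ex ih =>
    obtain ⟨ha, hb, α₁, α₂, y₁, y₂, S, hS, hR, rfl, rfl, h⟩ := h
    refine ⟨ha, hb, α₁, α₂, y₁, y₂, S, hS, fun v hv => hR v (hv.trans hu), rfl, rfl,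
      ih (fun i => ?_) u hu _ _ h⟩
    refine Fin.cases ?_ (fun i => ?_) i
    · exact fun u v _ _ huv _ => hS u v _ _ huv
    · exact hρ i
  case mu τ ih =>
    induction w using Nat.strong_induction_on generalizing u a b with
    | _ w ihw =>
      rw [semVal_mu] at h ⊢
      obtain ⟨ha, hb, y₁, y₂, rfl, rfl, h⟩ := h
      refine ⟨ha, hb, y₁, y₂, rfl, rfl, ?_⟩
      cases u with
      | zero => trivial
      | succ u =>
        obtain ⟨w, rfl⟩ : ∃ w', w = w' + 1 := ⟨w - 1, by omega⟩
        refine ih (w := w) (fun i => ?_) u (by omega) _ _ h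
        refine Fin.cases ?_ (fun i => ?_) i
        · exact fun u v a b huv hv => ihw v (by omega)
            (fun i u v' _ _ h₁ h₂ => hρ i u v' _ _ h₁ (by omega)) u huv a b
        · exact fun u v a b huv hv => hρ i u v a b huv (by omega)

/-- `r : VRel(α₁, α₂)` for all the variables, up to index `w`. -/
def SEnv.OK {p : ℕ} (ρ : SEnv p) (w : ℕ) : Prop :=
  ∀ i, (ρ i).rel.Mono ∧ (ρ i).rel.IsVRel (ρ i).left (ρ i).right w

theorem SEnv.OK.mono {p : ℕ} {ρ : SEnv p} {w v : ℕ} (h : ρ.OK w) (hv : v ≤ w) : ρ.OK v :=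
  fun i => ⟨(h i).1, fun u hu => (h i).2 u (hu.trans hv)⟩

theorem SEnv.OK.push {p : ℕ} {ρ : SEnv p} {w : ℕ} (h : ρ.OK w) {x : STy} (hx : x.rel.Mono)
    (hx' : x.rel.IsVRel x.left x.right w) : SEnv.OK (FMu.push x ρ) w := by
  intro i
  refine Fin.cases ?_ (fun i => ?_) i
  · exact ⟨hx, hx'⟩
  · exact h i

theorem SEnv.OK.semVal_mono {p : ℕ} {ρ : SEnv p} {w : ℕ} (h : ρ.OK w) (τ : Ty p) :
    (semVal τ ρ).Mono :=
  fun u _ a b huv => FMu.semVal_mono τ (fun i u v a b huv _ => (h i).1 u v a b huv) u huv a b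

theorem SEnv.OK.semVal_valOf {p : ℕ} {ρ : SEnv p} {w : ℕ} (h : ρ.OK w) (τ : Ty p) {a b : Tm 0 0}
    (hab : semVal τ ρ w a b) : ValOf a (τ.subst ρ.left) ∧ ValOf b (τ.subst ρ.right) := by
  cases τ
  case var i => exact (h i).2 w le_rfl a b hab
  case mu => rw [semVal_mu] at hab; exact ⟨hab.1, hab.2.1⟩
  all_goals exact ⟨hab.1, hab.2.1⟩

/-- Value relations are admissible interpretations of type variables. -/
theorem SEnv.OK.semVal_isVRel {p : ℕ} {ρ : SEnv p} {w : ℕ} (h : ρ.OK w) (τ : Ty p) :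
    (semVal τ ρ).IsVRel (τ.subst ρ.left) (τ.subst ρ.right) w :=
  fun _ hv _ _ hab => (h.mono hv).semVal_valOf τ hab

theorem push_liftRen {A : Type} {n n' : ℕ} (x : A) (ρ : Fin n' → A) (f : Fin n → Fin n') :
    (fun i => push x ρ (liftRen f i)) = push x (fun i => ρ (f i)) := by
  funext i
  refine Fin.cases ?_ (fun i => ?_) i <;> simp [liftRen]

theorem semVal_rename {p : ℕ} (τ : Ty p) : ∀ {q : ℕ} (f : Fin p → Fin q) (ρ : SEnv q),
    semVal (τ.rename f) ρ = semVal τ (fun i => ρ (f i)) := by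
  induction τ <;> intro q f ρ
  case var | unit | int | bool => rfl
  all_goals
    simp [Ty.rename, semVal, *, SEnv.left, SEnv.right, Ty.subst, Ty.subst_rename, push_liftRen,
      liftTy_comp_liftRen]
    rfl

/-- The environment in which `τ` means what `τ.subst σ` means in `ρ`. -/
def SEnv.subst {p q : ℕ} (σ : Fin p → Ty q) (ρ : SEnv q) : SEnv p :=
  fun i => ⟨(σ i).subst ρ.left, (σ i).subst ρ.right, semVal (σ i) ρ⟩

theorem SEnv.subst_lift {p q : ℕ} (σ : Fin p → Ty q) (ρ : SEnv q) (x : STy) :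
    SEnv.subst (liftTy σ) (push x ρ) = push x (SEnv.subst σ ρ) := by
  funext i
  refine Fin.cases ?_ (fun i => ?_) i
  · rfl
  · simp [SEnv.subst, liftTy, SEnv.left_push, SEnv.right_push, semVal_rename]

theorem liftTy_push {p q r : ℕ} (σ : Fin p → Ty q) (b : Ty r) (σ' : Fin q → Ty r) :
    (fun i => (liftTy σ i).subst (push b σ')) = push b (fun i => (σ i).subst σ') := by
  funext i
  refine Fin.cases ?_ (fun i => ?_) i <;> simp [liftTy, Ty.subst]

/-- Substituting types composes interpretations. -/
theorem semVal_subst {p : ℕ} (τ : Ty p) : ∀ {q : ℕ} (σ : Fin p → Ty q) (ρ : SEnv q),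
    semVal (τ.subst σ) ρ = semVal τ (SEnv.subst σ ρ) := by
  have hl : ∀ {p q : ℕ} (σ : Fin p → Ty q) (ρ : SEnv q),
      SEnv.left (SEnv.subst σ ρ) = fun i => (σ i).subst ρ.left := fun _ _ => rfl
  have hr : ∀ {p q : ℕ} (σ : Fin p → Ty q) (ρ : SEnv q),
      SEnv.right (SEnv.subst σ ρ) = fun i => (σ i).subst ρ.right := fun _ _ => rfl
  induction τ <;> intro q σ ρ
  case var | unit | int | bool => rfl
  all_goals
    simp [Ty.subst, semVal, *, Ty.subst_subst, SEnv.subst_lift, liftTy_subst, liftTy_push]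

theorem SEnv.subst_push_var {p : ℕ} (τ : Ty p) (ρ : SEnv p) :
    SEnv.subst (push τ .var) ρ =
      push ⟨τ.subst ρ.left, τ.subst ρ.right, semVal τ ρ⟩ ρ := by
  funext i
  refine Fin.cases ?_ (fun i => ?_) i <;> rfl

theorem semVal_inst {p : ℕ} (τ : Ty (p + 1)) (τ' : Ty p) (ρ : SEnv p) :
    semVal (τ.inst τ') ρ =
      semVal τ (push ⟨τ'.subst ρ.left, τ'.subst ρ.right, semVal τ' ρ⟩ ρ) := by
  rw [Ty.inst, semVal_subst, SEnv.subst_push_var]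

/-! ### Properties of the term relation -/

theorem semExp_mono {τ₁ τ₂ : Ty 0} {V : SRel} : (semExp τ₁ τ₂ V).Mono :=
  fun _ _ _ _ huv h => ⟨h.1, h.2.1, fun j v hv => h.2.2 j v (hv.trans huv)⟩

theorem semExp_of_val {τ₁ τ₂ : Ty 0} {V : SRel} (hV : V.Mono) {w : ℕ} {a b : Tm 0 0}
    (ha : ValOf a τ₁) (hb : ValOf b τ₂) (h : V w a b) : semExp τ₁ τ₂ V w a b := by
  refine ⟨ha.1, hb.1, fun j v hv x hx _ => ?_⟩
  obtain ⟨rfl, rfl⟩ := ha.2.stepsN hx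
  exact ⟨b, .refl hb.1, hV v w _ _ (by omega) h⟩

theorem semExp.of_ciu {τ₁ τ₂ : Ty 0} {V : SRel} {w : ℕ} {a b b' : Tm 0 0}
    (h : semExp τ₁ τ₂ V w a b) (hb : CiuClosed b b' τ₂) : semExp τ₁ τ₂ V w a b' :=
  ⟨h.1, hb.2.1, fun j v hv x hx hval =>
    (h.2.2 j v hv x hx hval).imp fun _ h => ⟨h.1.trans hb, h.2⟩⟩

/-- The term relation is closed under expansion. A reduction of the first term labelled `k` uses up
`k` indices; a reduction of the second term is absorbed by ciu approximation. -/
theorem semExp.of_lstep {τ₁ τ₂ : Ty 0} {V : SRel} {w k k' : ℕ} {a a' b b' : Tm 0 0}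
    (ha : HasTy TyCtx.empty a τ₁) (hb : HasTy TyCtx.empty b τ₂) (hsa : LStep k a a')
    (hsb : LStep k' b b') (h : ∀ v, k + v ≤ w → semExp τ₁ τ₂ V v a' b') :
    semExp τ₁ τ₂ V w a b := by
  refine ⟨ha, hb, fun j v hv x hx hval => ?_⟩
  obtain ⟨i, rfl, hx'⟩ := hx.tail_of_lstep hsa hval
  obtain ⟨x₂, h₁, h₂⟩ := (h (i + v) (by omega)).2.2 i v le_rfl x hx' hval
  exact ⟨x₂, h₁.trans (.of_lstep hb hsb), h₂⟩

/-- The term relation is closed under related evaluation contexts. An evaluation of `E[a]` first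
evaluates `a` to some `u`, which is matched by some `u₂`; the evaluation of `E[u]` is then matched
by `E'[u₂]`, and `E'[u₂] ⪯ E'[b]` because ciu approximation is closed under evaluation contexts. -/
theorem semExp.bind {τ₁ τ₂ σ₁ σ₂ : Ty 0} {V V' : SRel} {w : ℕ} {a b : Tm 0 0}
    {E E' : Ctxt 0 0 0 0} (hE : EvalCtxtTy E τ₁ σ₁) (hE' : EvalCtxtTy E' τ₂ σ₂)
    (h : semExp τ₁ τ₂ V w a b)
    (hk : ∀ v ≤ w, ∀ x y, V v x y → semExp σ₁ σ₂ V' v (E.fill x) (E'.fill y)) :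
    semExp σ₁ σ₂ V' w (E.fill a) (E'.fill b) := by
  refine ⟨.fill hE.2 h.1, .fill hE'.2 h.2.1, fun j v hv x hx hval => ?_⟩
  obtain ⟨i, j', u, rfl, h₁, hu, h₂⟩ := hx.of_fill hE.1 hval a rfl
  obtain ⟨u₂, hciu, hV⟩ := h.2.2 i (j' + v) (by omega) u h₁ hu
  obtain ⟨x₂, hx₂, hV'⟩ := (hk _ (by omega) _ _ hV).2.2 j' v le_rfl x h₂ hval
  exact ⟨x₂, hx₂.trans (hciu.fill hE'), hV'⟩

/-! ### Evaluation frames -/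

/-- `f` is filling the hole of an evaluation context of type `τ ⇝ τ'`. -/
def EvalFn (f : Tm 0 0 → Tm 0 0) (τ τ' : Ty 0) : Prop :=
  ∃ E, EvalCtxtTy E τ τ' ∧ ∀ t, E.fill t = f t

theorem CtxtTy.hole_id {n m : ℕ} {Γ : TyCtx n m} {τ : Ty n} :
    CtxtTy Γ τ (.hole id id) Γ τ := by
  have := CtxtTy.hole (Γ := Γ) (τ := τ) (Γ' := Γ) (f := id) (g := id) Function.injective_id
    Function.injective_id (by simp)
  simpa using this

theorem Ctxt.fill_hole_id {n m : ℕ} (t : Tm n m) : Ctxt.fill t (.hole id id) = t := by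
  simp [Ctxt.fill]

section Frames

variable {τ τ₁ τ₂ : Ty 0} {e e₁ e₂ v : Tm 0 0}

theorem EvalFn.primL {o : PrimOp} (h : HasTy TyCtx.empty e₂ .int) :
    EvalFn (fun t => .prim o t e₂) .int o.ty :=
  ⟨_, ⟨.primL .hole, .primL .hole_id h⟩, fun t => by simp [Ctxt.fill]⟩

theorem EvalFn.primR {o : PrimOp} (hv : ValOf v .int) :
    EvalFn (fun t => .prim o v t) .int o.ty :=
  ⟨_, ⟨.primR hv.2 .hole, .primR hv.1 .hole_id⟩, fun t => by simp [Ctxt.fill]⟩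

theorem EvalFn.ite (h₁ : HasTy TyCtx.empty e₁ τ) (h₂ : HasTy TyCtx.empty e₂ τ) :
    EvalFn (fun t => .ite t e₁ e₂) .bool τ :=
  ⟨_, ⟨.ite .hole, .iteC .hole_id h₁ h₂⟩, fun t => by simp [Ctxt.fill]⟩

theorem EvalFn.pairL (h : HasTy TyCtx.empty e₂ τ₂) :
    EvalFn (fun t => .pair t e₂) τ₁ (.prod τ₁ τ₂) :=
  ⟨_, ⟨.pairL .hole, .pairL .hole_id h⟩, fun t => by simp [Ctxt.fill]⟩

theorem EvalFn.pairR (hv : ValOf v τ₁) : EvalFn (fun t => .pair v t) τ₂ (.prod τ₁ τ₂) :=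
  ⟨_, ⟨.pairR hv.2 .hole, .pairR hv.1 .hole_id⟩, fun t => by simp [Ctxt.fill]⟩

theorem EvalFn.fst : EvalFn .fst (.prod τ₁ τ₂) τ₁ :=
  ⟨_, ⟨.fst .hole, .fst .hole_id⟩, fun t => by simp [Ctxt.fill]⟩

theorem EvalFn.snd : EvalFn .snd (.prod τ₁ τ₂) τ₂ :=
  ⟨_, ⟨.snd .hole, .snd .hole_id⟩, fun t => by simp [Ctxt.fill]⟩

theorem EvalFn.inl : EvalFn (.inl (.sum τ₁ τ₂)) τ₁ (.sum τ₁ τ₂) :=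
  ⟨_, ⟨.inl .hole, .inl .hole_id⟩, fun t => by simp [Ctxt.fill]⟩

theorem EvalFn.inr : EvalFn (.inr (.sum τ₁ τ₂)) τ₂ (.sum τ₁ τ₂) :=
  ⟨_, ⟨.inr .hole, .inr .hole_id⟩, fun t => by simp [Ctxt.fill]⟩

theorem EvalFn.case {e₁ e₂ : Tm 0 1} (h₁ : HasTy (TyCtx.empty.bindTm τ₁) e₁ τ)
    (h₂ : HasTy (TyCtx.empty.bindTm τ₂) e₂ τ) : EvalFn (fun t => .case t e₁ e₂) (.sum τ₁ τ₂) τ :=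
  ⟨_, ⟨.case .hole, .caseC .hole_id h₁ h₂⟩, fun t => by simp [Ctxt.fill]⟩

theorem EvalFn.appL (h : HasTy TyCtx.empty e₂ τ₂) : EvalFn (fun t => .app t e₂) (.arr τ₂ τ) τ :=
  ⟨_, ⟨.appL .hole, .appL .hole_id h⟩, fun t => by simp [Ctxt.fill]⟩

theorem EvalFn.appR (hv : ValOf v (.arr τ₂ τ)) : EvalFn (fun t => .app v t) τ₂ τ :=
  ⟨_, ⟨.appR hv.2 .hole, .appR hv.1 .hole_id⟩, fun t => by simp [Ctxt.fill]⟩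

theorem EvalFn.tapp {τ' : Ty 1} : EvalFn (fun t => .tapp t τ₁) (.all τ') (τ'.inst τ₁) :=
  ⟨_, ⟨.tapp .hole, .tapp _ .hole_id⟩, fun t => by simp [Ctxt.fill]⟩

theorem EvalFn.pack {τ' : Ty 1} : EvalFn (fun t => .pack τ₁ t τ') (τ'.inst τ₁) (.ex τ') :=
  ⟨_, ⟨.pack .hole, .pack .hole_id⟩, fun t => by simp [Ctxt.fill]⟩

theorem EvalFn.unpack {τ' : Ty 1} {e₂ : Tm 1 1}
    (h : HasTy (TyCtx.empty.bindTy.bindTm τ') e₂ (τ.rename Fin.succ)) :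
    EvalFn (fun t => .unpack t e₂) (.ex τ') τ :=
  ⟨_, ⟨.unpack .hole, .unpackL .hole_id h⟩, fun t => by simp [Ctxt.fill]⟩

theorem EvalFn.roll {τ' : Ty 1} : EvalFn (.roll (.mu τ')) (τ'.inst (.mu τ')) (.mu τ') :=
  ⟨_, ⟨.roll .hole, .roll .hole_id⟩, fun t => by simp [Ctxt.fill]⟩

theorem EvalFn.unroll {τ' : Ty 1} : EvalFn .unroll (.mu τ') (τ'.inst (.mu τ')) :=
  ⟨_, ⟨.unroll .hole, .unroll .hole_id⟩, fun t => by simp [Ctxt.fill]⟩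

end Frames

/-- `semExp.bind`, with the evaluation contexts given as functions on terms. -/
theorem semExp.bindFn {τ₁ τ₂ σ₁ σ₂ : Ty 0} {V V' : SRel} {w : ℕ} {a b : Tm 0 0}
    {f g : Tm 0 0 → Tm 0 0} (hf : EvalFn f τ₁ σ₁) (hg : EvalFn g τ₂ σ₂)
    (h : semExp τ₁ τ₂ V w a b)
    (hk : ∀ v ≤ w, ∀ x y, V v x y → semExp σ₁ σ₂ V' v (f x) (g y)) :
    semExp σ₁ σ₂ V' w (f a) (g b) := by
  obtain ⟨E, hE, hfE⟩ := hf
  obtain ⟨E', hE', hgE⟩ := hg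
  rw [← hfE, ← hgE]
  exact h.bind hE hE' fun v hv x y hxy => by rw [hfE, hgE]; exact hk v hv x y hxy

/-! ### Logical approximation in semantic form -/

/-- The semantic term relation `ℰ⟦τ⟧ρ`. -/
abbrev semE {p : ℕ} (τ : Ty p) (ρ : SEnv p) : SRel :=
  semExp (τ.subst ρ.left) (τ.subst ρ.right) (semVal τ ρ)

/-- The hypotheses of logical approximation, at index `w`. -/
structure Related {n m : ℕ} (Γ : TyCtx n m) (ρ : SEnv n) (w : ℕ) (γ₁ γ₂ : Fin m → Tm 0 0) :
    Prop where
  ok : ρ.OK w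
  mem : ∀ i, semVal (Γ i) ρ w (γ₁ i) (γ₂ i)

section

variable {n m : ℕ} {Γ : TyCtx n m} {ρ : SEnv n} {w v : ℕ} {γ₁ γ₂ : Fin m → Tm 0 0}

theorem Related.mono (h : Related Γ ρ w γ₁ γ₂) (hv : v ≤ w) : Related Γ ρ v γ₁ γ₂ :=
  ⟨h.ok.mono hv, fun i => h.ok.semVal_mono _ v w _ _ hv (h.mem i)⟩

theorem Related.left (h : Related Γ ρ w γ₁ γ₂) : ClosingSubst Γ ρ.left γ₁ :=
  fun i => (h.ok.semVal_valOf _ (h.mem i)).1.symm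

theorem Related.right (h : Related Γ ρ w γ₁ γ₂) : ClosingSubst Γ ρ.right γ₂ :=
  fun i => (h.ok.semVal_valOf _ (h.mem i)).2.symm

theorem ClosingSubst.hasTy {σ : Fin n → Ty 0} {s : Fin m → Tm 0 0} (h : ClosingSubst Γ σ s)
    {e : Tm n m} {τ : Ty n} (he : HasTy Γ e τ) : HasTy TyCtx.empty (e.subst σ s) (τ.subst σ) :=
  he.subst fun i => (h i).2

theorem Related.bindTm (h : Related Γ ρ w γ₁ γ₂) {τ : Ty n} {a b : Tm 0 0}
    (hab : semVal τ ρ w a b) : Related (Γ.bindTm τ) ρ w (push a γ₁) (push b γ₂) := by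
  refine ⟨h.ok, fun i => ?_⟩
  refine Fin.cases ?_ (fun i => ?_) i
  · exact hab
  · exact h.mem i

theorem semVal_rename_succ {p : ℕ} (τ : Ty p) (x : STy) (ρ : SEnv p) :
    semVal (τ.rename Fin.succ) (push x ρ) = semVal τ ρ := by
  rw [semVal_rename]; rfl

theorem Related.bindTy (h : Related Γ ρ w γ₁ γ₂) {x : STy} (hx : x.rel.Mono)
    (hx' : x.rel.IsVRel x.left x.right w) : Related Γ.bindTy (push x ρ) w γ₁ γ₂ :=
  ⟨h.ok.push hx hx', fun i => by
    rw [TyCtx.bindTy, semVal_rename_succ]; exact h.mem i⟩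

end

/-- Logical approximation in semantic form, between terms of the same type. -/
structure LogRel {n m : ℕ} (Γ : TyCtx n m) (e₁ e₂ : Tm n m) (τ : Ty n) : Prop where
  left : HasTy Γ e₁ τ
  right : HasTy Γ e₂ τ
  rel : ∀ {ρ : SEnv n} {w : ℕ} {γ₁ γ₂ : Fin m → Tm 0 0}, Related Γ ρ w γ₁ γ₂ →
    semE τ ρ w (e₁.subst ρ.left γ₁) (e₂.subst ρ.right γ₂)

/-! ### Compatibility -/

theorem SEnv.OK.semE_of_val {p : ℕ} {ρ : SEnv p} {w : ℕ} (h : ρ.OK w) {τ : Ty p} {a b : Tm 0 0}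
    (hab : semVal τ ρ w a b) : semE τ ρ w a b :=
  semExp_of_val (h.semVal_mono τ) (h.semVal_valOf τ hab).1 (h.semVal_valOf τ hab).2 hab

theorem ValOf.int_inv {v : Tm 0 0} (h : ValOf v .int) : ∃ z, v = .int z := by
  obtain ⟨ht, hv⟩ := h
  cases hv <;> first | exact ⟨_, rfl⟩ | (rename_i i; exact i.elim0) | cases ht

theorem ValOf.bool_inv {v : Tm 0 0} (h : ValOf v .bool) : ∃ b, v = .bool b := by
  obtain ⟨ht, hv⟩ := h
  cases hv <;> first | exact ⟨_, rfl⟩ | (rename_i i; exact i.elim0) | cases ht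

namespace LogRel

variable {n m : ℕ} {Γ : TyCtx n m}

theorem var (i : Fin m) : LogRel Γ (.var i) (.var i) (Γ i) :=
  ⟨.var i, .var i, fun h => h.ok.semE_of_val (h.mem i)⟩

theorem unit : LogRel Γ .unit .unit .unit :=
  ⟨.unit, .unit, fun h => h.ok.semE_of_val ⟨⟨.unit, .unit⟩, ⟨.unit, .unit⟩, rfl⟩⟩

theorem int (z : ℤ) : LogRel Γ (.int z) (.int z) .int :=
  ⟨.int z, .int z, fun h => h.ok.semE_of_val ⟨⟨.int z, .int z⟩, ⟨.int z, .int z⟩, rfl⟩⟩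

theorem bool (b : Bool) : LogRel Γ (.bool b) (.bool b) .bool :=
  ⟨.bool b, .bool b, fun h => h.ok.semE_of_val ⟨⟨.bool b, .bool b⟩, ⟨.bool b, .bool b⟩, rfl⟩⟩

theorem prim {o : PrimOp} {a a' b b' : Tm n m} (ha : LogRel Γ a a' .int)
    (hb : LogRel Γ b b' .int) : LogRel Γ (.prim o a b) (.prim o a' b') o.ty := by
  refine ⟨.prim ha.left hb.left, .prim ha.right hb.right, fun {ρ w γ₁ γ₂} hγ => ?_⟩
  have hty : ∀ σ : Fin n → Ty 0, (o.ty : Ty n).subst σ = o.ty := by cases o <;> intro <;> rfl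
  have hval : ∀ v x y, semVal (o.ty : Ty n) ρ v (o.eval x y) (o.eval x y) := by
    cases o <;> intro v x y <;> exact ⟨⟨by constructor, by constructor⟩,
      ⟨by constructor, by constructor⟩, rfl⟩
  rw [semE, hty, hty]
  refine semExp.bindFn (f := fun t => .prim o t (b.subst ρ.left γ₁))
    (g := fun t => .prim o t (b'.subst ρ.right γ₂))
    (.primL (hb.rel hγ).1) (.primL (hb.rel hγ).2.1) (ha.rel hγ)
    fun v hv x y hxy => ?_
  obtain ⟨hx, -, rfl⟩ := hxy
  refine semExp.bindFn (.primR hx) (.primR hx) (semExp_mono v w _ _ hv (hb.rel hγ))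
    fun u hu x' y' hxy => ?_
  obtain ⟨hx', -, rfl⟩ := hxy
  obtain ⟨z, rfl⟩ := hx.int_inv
  obtain ⟨z', rfl⟩ := hx'.int_inv
  refine semExp.of_lstep (.prim (.int _) (.int _)) (.prim (.int _) (.int _))
    (.head (.prim o z z')) (.head (.prim o z z')) fun u' hu' => ?_
  have := (hγ.ok.mono (hu.trans hv)).mono (v := u') (by omega) |>.semE_of_val (hval u' z z')
  rwa [semE, hty, hty] at this

theorem ite {e e' a a' b b' : Tm n m} {τ : Ty n} (he : LogRel Γ e e' .bool)
    (ha : LogRel Γ a a' τ) (hb : LogRel Γ b b' τ) :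
    LogRel Γ (.ite e a b) (.ite e' a' b') τ := by
  refine ⟨.ite he.left ha.left hb.left, .ite he.right ha.right hb.right,
    fun {ρ w γ₁ γ₂} hγ => ?_⟩
  refine semExp.bindFn (f := fun t => .ite t (a.subst ρ.left γ₁) (b.subst ρ.left γ₁))
    (g := fun t => .ite t (a'.subst ρ.right γ₂) (b'.subst ρ.right γ₂))
    (.ite (ha.rel hγ).1 (hb.rel hγ).1) (.ite (ha.rel hγ).2.1 (hb.rel hγ).2.1)
    (he.rel hγ) fun v hv x y hxy => ?_
  obtain ⟨hx, -, rfl⟩ := hxy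
  obtain ⟨c, rfl⟩ := hx.bool_inv
  cases c
  · exact semExp.of_lstep (.ite (.bool _) (ha.rel hγ).1 (hb.rel hγ).1)
      (.ite (.bool _) (ha.rel hγ).2.1 (hb.rel hγ).2.1) (.head (.iteFalse _ _))
      (.head (.iteFalse _ _)) fun u hu => semExp_mono u w _ _ (by omega) (hb.rel hγ)
  · exact semExp.of_lstep (.ite (.bool _) (ha.rel hγ).1 (hb.rel hγ).1)
      (.ite (.bool _) (ha.rel hγ).2.1 (hb.rel hγ).2.1) (.head (.iteTrue _ _))
      (.head (.iteTrue _ _)) fun u hu => semExp_mono u w _ _ (by omega) (ha.rel hγ)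

theorem pair {a a' b b' : Tm n m} {τ τ' : Ty n} (ha : LogRel Γ a a' τ) (hb : LogRel Γ b b' τ') :
    LogRel Γ (.pair a b) (.pair a' b') (.prod τ τ') := by
  refine ⟨.pair ha.left hb.left, .pair ha.right hb.right, fun {ρ w γ₁ γ₂} hγ => ?_⟩
  refine semExp.bindFn (f := fun t => .pair t (b.subst ρ.left γ₁))
    (g := fun t => .pair t (b'.subst ρ.right γ₂))
    (.pairL (hb.rel hγ).1) (.pairL (hb.rel hγ).2.1) (ha.rel hγ)
    fun v hv x y hxy => ?_
  have hv' := (hγ.ok.mono hv).semVal_valOf _ hxy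
  refine semExp.bindFn (.pairR hv'.1) (.pairR hv'.2) (semExp_mono v w _ _ hv (hb.rel hγ))
    fun u hu x' y' hxy' => ?_
  have hok := hγ.ok.mono (hu.trans hv)
  have hu' := hok.semVal_valOf _ hxy'
  exact hok.semE_of_val (τ := .prod τ τ') ⟨⟨.pair hv'.1.1 hu'.1.1, .pair hv'.1.2 hu'.1.2⟩,
    ⟨.pair hv'.2.1 hu'.2.1, .pair hv'.2.2 hu'.2.2⟩, x, x', y, y', rfl, rfl,
    hok.semVal_mono τ u v _ _ hu hxy, hxy'⟩

theorem fst {e e' : Tm n m} {τ τ' : Ty n} (he : LogRel Γ e e' (.prod τ τ')) :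
    LogRel Γ (.fst e) (.fst e') τ := by
  refine ⟨.fst he.left, .fst he.right, fun {ρ w γ₁ γ₂} hγ => ?_⟩
  refine semExp.bindFn .fst .fst (he.rel hγ) fun v hv x y hxy => ?_
  obtain ⟨⟨ht, hx⟩, ⟨ht', hy⟩, a₁, a₂, b₁, b₂, rfl, rfl, h₁, -⟩ := hxy
  cases hx with
  | pair ha₁ ha₂ => cases hy with
    | pair hb₁ hb₂ =>
      exact semExp.of_lstep (.fst ht) (.fst ht') (.head (.fst ha₁ ha₂)) (.head (.fst hb₁ hb₂))
        fun u hu => semExp_mono u v _ _ (by omega) ((hγ.ok.mono hv).semE_of_val h₁)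

theorem snd {e e' : Tm n m} {τ τ' : Ty n} (he : LogRel Γ e e' (.prod τ τ')) :
    LogRel Γ (.snd e) (.snd e') τ' := by
  refine ⟨.snd he.left, .snd he.right, fun {ρ w γ₁ γ₂} hγ => ?_⟩
  refine semExp.bindFn .snd .snd (he.rel hγ) fun v hv x y hxy => ?_
  obtain ⟨⟨ht, hx⟩, ⟨ht', hy⟩, a₁, a₂, b₁, b₂, rfl, rfl, -, h₂⟩ := hxy
  cases hx with
  | pair ha₁ ha₂ => cases hy with
    | pair hb₁ hb₂ =>
      exact semExp.of_lstep (.snd ht) (.snd ht') (.head (.snd ha₁ ha₂)) (.head (.snd hb₁ hb₂))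
        fun u hu => semExp_mono u v _ _ (by omega) ((hγ.ok.mono hv).semE_of_val h₂)

theorem inl {e e' : Tm n m} {τ τ' : Ty n} (he : LogRel Γ e e' τ) :
    LogRel Γ (.inl (.sum τ τ') e) (.inl (.sum τ τ') e') (.sum τ τ') := by
  refine ⟨.inl he.left, .inl he.right, fun {ρ w γ₁ γ₂} hγ => ?_⟩
  refine semExp.bindFn .inl .inl (he.rel hγ) fun v hv x y hxy => ?_
  have h := (hγ.ok.mono hv).semVal_valOf _ hxy
  exact (hγ.ok.mono hv).semE_of_val (τ := .sum τ τ') ⟨⟨.inl h.1.1, .inl h.1.2⟩,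
    ⟨.inl h.2.1, .inl h.2.2⟩, .inl ⟨x, y, rfl, rfl, hxy⟩⟩

theorem inr {e e' : Tm n m} {τ τ' : Ty n} (he : LogRel Γ e e' τ') :
    LogRel Γ (.inr (.sum τ τ') e) (.inr (.sum τ τ') e') (.sum τ τ') := by
  refine ⟨.inr he.left, .inr he.right, fun {ρ w γ₁ γ₂} hγ => ?_⟩
  refine semExp.bindFn .inr .inr (he.rel hγ) fun v hv x y hxy => ?_
  have h := (hγ.ok.mono hv).semVal_valOf _ hxy
  exact (hγ.ok.mono hv).semE_of_val (τ := .sum τ τ') ⟨⟨.inr h.1.1, .inr h.1.2⟩,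
    ⟨.inr h.2.1, .inr h.2.2⟩, .inr ⟨x, y, rfl, rfl, hxy⟩⟩

theorem case {e e' : Tm n m} {a a' b b' : Tm n (m + 1)} {τ₁ τ₂ τ : Ty n}
    (he : LogRel Γ e e' (.sum τ₁ τ₂)) (ha : LogRel (Γ.bindTm τ₁) a a' τ)
    (hb : LogRel (Γ.bindTm τ₂) b b' τ) : LogRel Γ (.case e a b) (.case e' a' b') τ := by
  refine ⟨.case he.left ha.left hb.left, .case he.right ha.right hb.right,
    fun {ρ w γ₁ γ₂} hγ => ?_⟩
  have hl := fun i => (hγ.left i).2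
  have hr := fun i => (hγ.right i).2
  refine semExp.bindFn
    (.case (ha.left.subst (HasTy.liftTm hl _)) (hb.left.subst (HasTy.liftTm hl _)))
    (.case (ha.right.subst (HasTy.liftTm hr _)) (hb.right.subst (HasTy.liftTm hr _)))
    (he.rel hγ) fun v hv x y hxy => ?_
  obtain ⟨⟨ht, hx⟩, ⟨ht', hy⟩, ⟨x, y, rfl, rfl, h⟩ | ⟨x, y, rfl, rfl, h⟩⟩ := hxy
  · cases hx with
    | inl hx => cases hy with
      | inl hy =>
        refine semExp.of_lstep
          (.case ht (ha.left.subst (HasTy.liftTm hl _)) (hb.left.subst (HasTy.liftTm hl _)))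
          (.case ht' (ha.right.subst (HasTy.liftTm hr _)) (hb.right.subst (HasTy.liftTm hr _)))
          (.head (.caseInl _ _ hx)) (.head (.caseInl _ _ hy)) fun u hu => ?_
        rw [Tm.subst_lift_push, Tm.subst_lift_push]
        exact semExp_mono u v _ _ (by omega) (ha.rel ((hγ.mono hv).bindTm h))
  · cases hx with
    | inr hx => cases hy with
      | inr hy =>
        refine semExp.of_lstep
          (.case ht (ha.left.subst (HasTy.liftTm hl _)) (hb.left.subst (HasTy.liftTm hl _)))
          (.case ht' (ha.right.subst (HasTy.liftTm hr _)) (hb.right.subst (HasTy.liftTm hr _)))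
          (.head (.caseInr _ _ hx)) (.head (.caseInr _ _ hy)) fun u hu => ?_
        rw [Tm.subst_lift_push, Tm.subst_lift_push]
        exact semExp_mono u v _ _ (by omega) (hb.rel ((hγ.mono hv).bindTm h))

theorem lam {e e' : Tm n (m + 1)} {τ τ' : Ty n} (he : LogRel (Γ.bindTm τ) e e' τ') :
    LogRel Γ (.lam τ e) (.lam τ e') (.arr τ τ') := by
  refine ⟨.lam he.left, .lam he.right, fun {ρ w γ₁ γ₂} hγ => ?_⟩
  have hl := hγ.left.hasTy (HasTy.lam he.left)
  have hr := hγ.right.hasTy (HasTy.lam he.right)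
  refine hγ.ok.semE_of_val (τ := .arr τ τ') ⟨⟨hl, .lam _ _⟩, ⟨hr, .lam _ _⟩,
    fun y₁ y₂ v hv hy => ?_⟩
  have h := (hγ.ok.mono hv).semVal_valOf _ hy
  refine semExp.of_lstep (.app hl h.1.1) (.app hr h.2.1) (.head (.app _ h.1.2))
    (.head (.app _ h.2.2)) fun u hu => ?_
  rw [Tm.subst_lift_push, Tm.subst_lift_push]
  exact semExp_mono u v _ _ (by omega) (he.rel ((hγ.mono hv).bindTm hy))

theorem app {f f' a a' : Tm n m} {τ τ' : Ty n} (hf : LogRel Γ f f' (.arr τ τ'))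
    (ha : LogRel Γ a a' τ) : LogRel Γ (.app f a) (.app f' a') τ' := by
  refine ⟨.app hf.left ha.left, .app hf.right ha.right, fun {ρ w γ₁ γ₂} hγ => ?_⟩
  refine semExp.bindFn (f := fun t => .app t (a.subst ρ.left γ₁))
    (g := fun t => .app t (a'.subst ρ.right γ₂))
    (.appL (ha.rel hγ).1) (.appL (ha.rel hγ).2.1) (hf.rel hγ)
    fun v hv x y hxy => ?_
  exact semExp.bindFn (.appR hxy.1) (.appR hxy.2.1) (semExp_mono v w _ _ hv (ha.rel hγ))
    fun u hu x' y' hxy' => hxy.2.2 x' y' u hu hxy'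

theorem tlam {e e' : Tm (n + 1) m} {τ : Ty (n + 1)} (he : LogRel Γ.bindTy e e' τ) :
    LogRel Γ (.tlam e) (.tlam e') (.all τ) := by
  refine ⟨.tlam he.left, .tlam he.right, fun {ρ w γ₁ γ₂} hγ => ?_⟩
  have hl := hγ.left.hasTy (HasTy.tlam he.left)
  have hr := hγ.right.hasTy (HasTy.tlam he.right)
  refine hγ.ok.semE_of_val (τ := .all τ) ⟨⟨hl, .tlam _⟩, ⟨hr, .tlam _⟩,
    fun α₁ α₂ S hS v hv hSv => ?_⟩
  refine semExp.of_lstep ?_ ?_ (.head (.tapp _ _)) (.head (.tapp _ _)) fun u hu => ?_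
  · rw [← Ty.subst_lift_inst]; exact .tapp _ hl
  · rw [← Ty.subst_lift_inst]; exact .tapp _ hr
  · have h := he.rel ((hγ.mono hv).bindTy (x := ⟨α₁, α₂, S⟩) hS hSv)
    rw [Tm.subst_liftTy_push, Tm.subst_liftTy_push]
    rw [semE, SEnv.left_push, SEnv.right_push] at h
    exact semExp_mono u v _ _ (by omega) h

/-- The relation chosen for the type argument is its own value relation. -/
theorem tapp {e e' : Tm n m} {τ : Ty (n + 1)} (τ₁ : Ty n) (he : LogRel Γ e e' (.all τ)) :
    LogRel Γ (.tapp e τ₁) (.tapp e' τ₁) (τ.inst τ₁) := by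
  refine ⟨.tapp _ he.left, .tapp _ he.right, fun {ρ w γ₁ γ₂} hγ => ?_⟩
  rw [semE, Ty.inst_subst, Ty.inst_subst]
  refine semExp.bindFn .tapp .tapp (he.rel hγ) fun v hv x y hxy => ?_
  have hok := hγ.ok.mono hv
  -- `semVal_inst` turns the value relation of the instance into the one obtained here
  have h := hxy.2.2 (τ₁.subst ρ.left) (τ₁.subst ρ.right) (semVal τ₁ ρ) (hok.semVal_mono τ₁) v
    le_rfl (hok.semVal_isVRel τ₁)
  rwa [Ty.subst_lift_inst, Ty.subst_lift_inst, semVal_inst]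

theorem pack {e e' : Tm n m} {τ₁ : Ty n} {τ : Ty (n + 1)} (he : LogRel Γ e e' (τ.inst τ₁)) :
    LogRel Γ (.pack τ₁ e τ) (.pack τ₁ e' τ) (.ex τ) := by
  refine ⟨.pack he.left, .pack he.right, fun {ρ w γ₁ γ₂} hγ => ?_⟩
  have h := he.rel hγ
  rw [semE, Ty.inst_subst, Ty.inst_subst] at h
  refine semExp.bindFn .pack .pack h fun v hv x y hxy => ?_
  have hok := hγ.ok.mono hv
  have hval := hok.semVal_valOf _ hxy
  rw [Ty.inst_subst, Ty.inst_subst] at hval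
  rw [semVal_inst] at hxy
  exact hok.semE_of_val (τ := .ex τ) ⟨⟨.pack hval.1.1, .pack hval.1.2⟩,
    ⟨.pack hval.2.1, .pack hval.2.2⟩, τ₁.subst ρ.left, τ₁.subst ρ.right, x, y, semVal τ₁ ρ,
    hok.semVal_mono τ₁, hok.semVal_isVRel τ₁, rfl, rfl, hxy⟩

theorem unpack {e e' : Tm n m} {b b' : Tm (n + 1) (m + 1)} {τ₁ : Ty (n + 1)} {τ : Ty n}
    (he : LogRel Γ e e' (.ex τ₁)) (hb : LogRel (Γ.bindTy.bindTm τ₁) b b' (τ.rename Fin.succ)) :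
    LogRel Γ (.unpack e b) (.unpack e' b') τ := by
  refine ⟨.unpack he.left hb.left, .unpack he.right hb.right, fun {ρ w γ₁ γ₂} hγ => ?_⟩
  have hl := hb.left.subst (HasTy.liftTm (HasTy.shiftTm fun i => (hγ.left i).2) τ₁)
  have hr := hb.right.subst (HasTy.liftTm (HasTy.shiftTm fun i => (hγ.right i).2) τ₁)
  rw [Ty.subst_succ_liftTy] at hl hr
  refine semExp.bindFn (.unpack hl) (.unpack hr) (he.rel hγ) fun v hv x y hxy => ?_
  obtain ⟨⟨ht, hx⟩, ⟨ht', hy⟩, α₁, α₂, x, y, S, hS, hSv, rfl, rfl, h⟩ := hxy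
  cases hx with
  | pack hx => cases hy with
    | pack hy =>
      refine semExp.of_lstep (.unpack ht hl) (.unpack ht' hr) (.head (.unpack _ hx))
        (.head (.unpack _ hy)) fun u hu => ?_
      have hrel := hb.rel (((hγ.mono hv).bindTy (x := ⟨α₁, α₂, S⟩) hS hSv).bindTm h)
      rw [semE, SEnv.left_push, SEnv.right_push, Ty.subst_rename_succ, Ty.subst_rename_succ,
        semVal_rename_succ] at hrel
      rw [Tm.subst_liftBoth_push, Tm.subst_liftBoth_push]
      exact semExp_mono u v _ _ (by omega) hrel

theorem roll {e e' : Tm n m} {τ : Ty (n + 1)} (he : LogRel Γ e e' (τ.inst (.mu τ))) :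
    LogRel Γ (.roll (.mu τ) e) (.roll (.mu τ) e') (.mu τ) := by
  refine ⟨.roll he.left, .roll he.right, fun {ρ w γ₁ γ₂} hγ => ?_⟩
  have h := he.rel hγ
  rw [semE, Ty.inst_subst, Ty.inst_subst] at h
  refine semExp.bindFn .roll .roll h fun v hv x y hxy => ?_
  have hok := hγ.ok.mono hv
  have hval := hok.semVal_valOf _ hxy
  rw [Ty.inst_subst, Ty.inst_subst] at hval
  refine hok.semE_of_val (τ := .mu τ) ((semVal_mu _ _ _ _ _).2 ⟨⟨.roll hval.1.1, .roll hval.1.2⟩,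
    ⟨.roll hval.2.1, .roll hval.2.2⟩, x, y, rfl, rfl, ?_⟩)
  cases v with
  | zero => trivial
  | succ v =>
    rw [← semVal_inst]
    exact hok.semVal_mono _ v (v + 1) _ _ (by omega) hxy

/-- The unrolled values are only related one index later, which the unroll-roll reduction pays
for. -/
theorem unroll {e e' : Tm n m} {τ : Ty (n + 1)} (he : LogRel Γ e e' (.mu τ)) :
    LogRel Γ (.unroll e) (.unroll e') (τ.inst (.mu τ)) := by
  refine ⟨.unroll he.left, .unroll he.right, fun {ρ w γ₁ γ₂} hγ => ?_⟩
  rw [semE, Ty.inst_subst, Ty.inst_subst]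
  refine semExp.bindFn .unroll .unroll (he.rel hγ) fun v hv x y hxy => ?_
  rw [semVal_mu] at hxy
  obtain ⟨⟨ht, hx⟩, ⟨ht', hy⟩, x, y, rfl, rfl, h⟩ := hxy
  cases hx with
  | roll hx => cases hy with
    | roll hy =>
      refine semExp.of_lstep (.unroll ht) (.unroll ht') (.head (.unroll hx))
        (.head (.unroll hy)) fun u hu => ?_
      obtain ⟨v, rfl⟩ : ∃ v', v = v' + 1 := ⟨v - 1, by omega⟩
      rw [SRel.later, ← semVal_inst] at h
      have hrel := (hγ.ok.mono (v := v) (by omega)).semE_of_val h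
      rw [semE, Ty.inst_subst, Ty.inst_subst] at hrel
      exact semExp_mono u v _ _ (by omega) hrel

/-- Renaming is what filling the hole of a context amounts to under the binders of the context. -/
theorem rename {e e' : Tm n m} {τ : Ty n} (h : LogRel Γ e e' τ) {n' m' : ℕ} {Γ' : TyCtx n' m'}
    {f : Fin n → Fin n'} {g : Fin m → Fin m'} (hΓ : ∀ i, Γ' (g i) = (Γ i).rename f) :
    LogRel Γ' (e.rename f g) (e'.rename f g) (τ.rename f) := by
  refine ⟨h.left.rename hΓ, h.right.rename hΓ, fun {ρ w γ₁ γ₂} hγ => ?_⟩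
  have : Related Γ (fun i => ρ (f i)) w (fun i => γ₁ (g i)) (fun i => γ₂ (g i)) :=
    ⟨fun i => hγ.ok (f i), fun i => by rw [← semVal_rename, ← hΓ]; exact hγ.mem (g i)⟩
  have := h.rel this
  rw [semE, semVal_rename, Ty.subst_rename, Ty.subst_rename, Tm.subst_rename, Tm.subst_rename]
  exact this

/-- The fundamental theorem: logical approximation is reflexive. -/
theorem refl {n m : ℕ} {Γ : TyCtx n m} {e : Tm n m} {τ : Ty n} (h : HasTy Γ e τ) :
    LogRel Γ e e τ := by
  induction h with
  | var i => exact var i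
  | unit => exact unit
  | int z => exact int z
  | prim _ _ ih₁ ih₂ => exact prim ih₁ ih₂
  | bool b => exact bool b
  | ite _ _ _ ih ih₁ ih₂ => exact ite ih ih₁ ih₂
  | pair _ _ ih₁ ih₂ => exact pair ih₁ ih₂
  | fst _ ih => exact fst ih
  | snd _ ih => exact snd ih
  | inl _ ih => exact inl ih
  | inr _ ih => exact inr ih
  | case _ _ _ ih ih₁ ih₂ => exact case ih ih₁ ih₂
  | lam _ ih => exact lam ih
  | app _ _ ih₁ ih₂ => exact app ih₁ ih₂
  | tlam _ ih => exact tlam ih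
  | tapp τ₁ _ ih => exact tapp τ₁ ih
  | pack _ ih => exact pack ih
  | unpack _ _ ih₁ ih₂ => exact unpack ih₁ ih₂
  | roll _ ih => exact roll ih
  | unroll _ ih => exact unroll ih

/-- Logical approximation is a precongruence. -/
theorem fill {n m : ℕ} {Γ : TyCtx n m} {e e' : Tm n m} {τ : Ty n} (he : LogRel Γ e e' τ)
    {n' m' : ℕ} {C : Ctxt n m n' m'} {Γ' : TyCtx n' m'} {τ' : Ty n'}
    (hC : CtxtTy Γ τ C Γ' τ') : LogRel Γ' (C.fill e) (C.fill e') τ' := by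
  induction hC with
  | hole _ _ hΓ => exact he.rename hΓ
  | primL _ h ih => exact prim ih (refl h)
  | primR h _ ih => exact prim (refl h) ih
  | iteC _ h₁ h₂ ih => exact ite ih (refl h₁) (refl h₂)
  | iteT h _ h₂ ih => exact ite (refl h) ih (refl h₂)
  | iteE h h₁ _ ih => exact ite (refl h) (refl h₁) ih
  | pairL _ h ih => exact pair ih (refl h)
  | pairR h _ ih => exact pair (refl h) ih
  | fst _ ih => exact fst ih
  | snd _ ih => exact snd ih
  | inl _ ih => exact inl ih
  | inr _ ih => exact inr ih
  | caseC _ h₁ h₂ ih => exact case ih (refl h₁) (refl h₂)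
  | caseL h _ h₂ ih => exact case (refl h) ih (refl h₂)
  | caseR h h₁ _ ih => exact case (refl h) (refl h₁) ih
  | lam _ ih => exact lam ih
  | appL _ h ih => exact app ih (refl h)
  | appR h _ ih => exact app (refl h) ih
  | tlam _ ih => exact tlam ih
  | tapp τ₁ _ ih => exact tapp τ₁ ih
  | pack _ ih => exact pack ih
  | unpackL _ h ih => exact unpack ih (refl h)
  | unpackR h _ ih => exact unpack (refl h) ih
  | roll _ ih => exact roll ih
  | unroll _ ih => exact unroll ih

/-- Adequacy: the number of unroll-roll reductions of the first term is the index to start from. -/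
theorem terminates {e e' : Tm 0 0} {τ : Ty 0} (h : LogRel TyCtx.empty e e' τ)
    (ht : Terminates e) : Terminates e' := by
  obtain ⟨v, hs, hv⟩ := ht
  obtain ⟨j, hs⟩ := steps_iff_stepsN.1 hs
  have hok : SEnv.OK (Fin.elim0 : SEnv 0) j := fun i => i.elim0
  have hrel := h.rel (ρ := Fin.elim0) (w := j) (γ₁ := Fin.elim0) (γ₂ := Fin.elim0)
    ⟨hok, fun i => i.elim0⟩
  rw [Tm.subst_closed, Tm.subst_closed] at hrel
  obtain ⟨x, hciu, hV⟩ := hrel.2.2 j 0 le_rfl v hs hv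
  have hx : Terminates x := ⟨x, .refl, ((hok.mono (Nat.zero_le _)).semVal_valOf _ hV).2.2⟩
  -- ciu approximation in the empty evaluation context
  have := hciu.2.2 (.hole id id) _ ⟨.hole, .hole_id⟩
  rw [Ctxt.fill_hole_id, Ctxt.fill_hole_id] at this
  exact this hx

theorem ctxApprox {e e' : Tm n m} {τ : Ty n} (h : LogRel Γ e e' τ) : CtxApprox Γ e e' τ :=
  fun _ _ hC => (h.fill hC).terminates

end LogRel

/-- The term relation absorbs ciu approximation on the right. -/
theorem CiuApprox.logRel {n m : ℕ} {Γ : TyCtx n m} {e e' : Tm n m} {τ : Ty n}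
    (he : HasTy Γ e τ) (he' : HasTy Γ e' τ) (h : CiuApprox Γ e e' τ) : LogRel Γ e e' τ :=
  ⟨he, he', fun hγ => ((LogRel.refl he).rel hγ).of_ciu (h _ _ hγ.right)⟩

/-! ### Contextual approximation implies ciu approximation -/

theorem CiuClosed.lstep {k : ℕ} {e e' : Tm 0 0} {τ : Ty 0} (ht : HasTy TyCtx.empty e τ)
    (h : LStep k e e') : CiuClosed e e' τ :=
  ⟨ht, ht.sstep (lstep_iff_sstep.1 h), fun _ _ hE hT => hT.lstep (h.fill hE.1)⟩

theorem CiuClosed.of_evalFn {f : Tm 0 0 → Tm 0 0} {τ τ' : Ty 0} (hf : EvalFn f τ τ')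
    {a b : Tm 0 0} (h : CiuClosed a b τ) : CiuClosed (f a) (f b) τ' := by
  obtain ⟨E, hE, hfE⟩ := hf
  rw [← hfE, ← hfE]
  exact h.fill hE

/-- Applied to a value `v`, the abstraction takes one step to the body with `v` for its variable. -/
theorem CiuApprox.of_lam {n m : ℕ} {Γ : TyCtx n m} {e₁ e₂ : Tm n (m + 1)} {τ τ' : Ty n}
    (h : CiuApprox Γ (.lam τ e₁) (.lam τ e₂) (.arr τ τ')) :
    CiuApprox (Γ.bindTm τ) e₁ e₂ τ' := by
  intro σ s hs
  obtain ⟨v, s, rfl⟩ : ∃ v s', s = push v s' := ⟨s 0, Fin.tail s, (Fin.cons_self_tail s).symm⟩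
  have hv : IsVal v ∧ HasTy TyCtx.empty v (τ.subst σ) := hs 0
  have happ := CiuClosed.of_evalFn (f := fun t => .app t v) (.appL hv.2)
    (h σ s fun i => hs i.succ)
  have h₁ := CiuClosed.of_lstep happ.1 (.head (.app _ hv.1))
  have h₂ := CiuClosed.lstep happ.2.1 (.head (.app _ hv.1))
  rw [Tm.subst_lift_push] at h₁ h₂
  exact (h₁.trans happ).trans h₂

theorem CiuApprox.of_tlam {n m : ℕ} {Γ : TyCtx n m} {e₁ e₂ : Tm (n + 1) m} {τ : Ty (n + 1)}
    (h : CiuApprox Γ (.tlam e₁) (.tlam e₂) (.all τ)) : CiuApprox Γ.bindTy e₁ e₂ τ := by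
  intro σ s hs
  obtain ⟨τ', σ, rfl⟩ : ∃ τ' σ', σ = push τ' σ' := ⟨σ 0, Fin.tail σ, (Fin.cons_self_tail σ).symm⟩
  have happ := CiuClosed.of_evalFn (.tapp (τ₁ := τ')) (h σ s fun i => by
    have := hs i
    rwa [TyCtx.bindTy, Ty.subst_rename_succ] at this)
  have h₁ := CiuClosed.of_lstep happ.1 (.head (.tapp _ _))
  have h₂ := CiuClosed.lstep happ.2.1 (.head (.tapp _ _))
  rw [Tm.subst_liftTy_push, Ty.subst_lift_inst] at h₁ h₂
  rw [Ty.subst_lift_inst] at happ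
  exact (h₁.trans happ).trans h₂

/-- All variables of `Γ'` are abstracted around `C`, term variables first; the resulting closed
context can be surrounded by any evaluation context. -/
theorem CtxApprox.ciuApprox_fill {p q : ℕ} {Γ : TyCtx p q} {e₁ e₂ : Tm p q} {τ : Ty p}
    (h₁ : HasTy Γ e₁ τ) (h₂ : HasTy Γ e₂ τ) (h : CtxApprox Γ e₁ e₂ τ) :
    ∀ {n m : ℕ} {Γ' : TyCtx n m} {C : Ctxt p q n m} {τ' : Ty n}, CtxtTy Γ τ C Γ' τ' →
      CiuApprox Γ' (C.fill e₁) (C.fill e₂) τ' := by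
  intro n m
  induction m with
  | succ m ih =>
    intro Γ' C τ' hC
    obtain ⟨τ₁, Γ', rfl⟩ : ∃ τ₁ Γ'', Γ' = TyCtx.bindTm Γ'' τ₁ :=
      ⟨Γ' 0, Fin.tail Γ', (Fin.cons_self_tail Γ').symm⟩
    exact (ih hC.lam).of_lam
  | zero =>
    induction n with
    | succ n ih =>
      intro Γ' C τ' hC
      obtain rfl : Γ' = TyCtx.bindTy Fin.elim0 := Subsingleton.elim _ _
      exact (ih hC.tlam).of_tlam
    | zero =>
      intro Γ' C τ' hC σ s _
      obtain rfl : Γ' = TyCtx.empty := Subsingleton.elim _ _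
      rw [Tm.subst_closed, Tm.subst_closed, Ty.subst_closed]
      refine ⟨.fill hC h₁, .fill hC h₂, fun E τ'' hE => ?_⟩
      rw [← hE.1.fill_plug, ← hE.1.fill_plug]
      exact h _ _ (hE.1.ctxtTy_plug hE.2 hC)

theorem CtxApprox.ciuApprox {n m : ℕ} {Γ : TyCtx n m} {e₁ e₂ : Tm n m} {τ : Ty n}
    (h₁ : HasTy Γ e₁ τ) (h₂ : HasTy Γ e₂ τ) (h : CtxApprox Γ e₁ e₂ τ) : CiuApprox Γ e₁ e₂ τ := by
  have := h.ciuApprox_fill h₁ h₂ .hole_id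
  rwa [Ctxt.fill_hole_id, Ctxt.fill_hole_id] at this

/-! ### The two forms of logical approximation -/

theorem curry_interp_expRel {p n m : ℕ} {Δ : List ℕ} (τ : Ty p) (ρ : TyEnv p n m Δ)
    (σ : Fin n → Ty 0) (s : Fin m → Tm 0 0) (δ : REnv Δ) :
    WRel.curry ((expRel τ ρ).interp σ s δ) = semE τ (ρ.interp σ s δ) := by
  rw [expRel, Rel.curry_interp_termRel, curry_interp_valRel, TyEnv.substL_subst,
    TyEnv.substR_subst]

section

variable {n m : ℕ} {Γ : TyCtx n m} {e₁ e₂ : Tm n m} {τ : Ty n}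

/-- The hypotheses of logical approximation in world `w + 1` are those of `Related` at `w`. -/
theorem logHyps_iff_related {σ : Fin (n + n) → Ty 0} {s : Fin (m + m) → Tm 0 0}
    {δ : REnv (List.replicate n 2)} (hδ : ∀ k (r : RVar _ k), (δ k r).Mono) (w : ℕ) :
    (∀ Q ∈ logHyps Γ, Q.interp σ s δ (w + 1) Fin.elim0) ↔
      Related Γ ((logEnv n (m + m)).interp σ s δ) w (fun j => s (Fin.castAdd m j))
        (fun j => s (Fin.natAdd m j)) := by
  have hV : ∀ i : Fin n, (Rel.isVRel (.var (relVar i)) (.var (Fin.castAdd n i))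
      (.var (Fin.natAdd n i))).interp σ s δ (w + 1) Fin.elim0 ↔
      (WRel.curry (δ 2 (relVar i))).IsVRel (σ (Fin.castAdd n i)) (σ (Fin.natAdd n i)) w := by
    intro i
    rw [Rel.interp_isVRel, curry_interp_var]
    rfl
  have hM : ∀ j : Fin m, (Rel.mem ![.var (Fin.castAdd m j), .var (Fin.natAdd m j)]
      (valRel (Γ j) (logEnv n (m + m)))).interp σ s δ (w + 1) Fin.elim0 ↔
      semVal (Γ j) ((logEnv n (m + m)).interp σ s δ) w (s (Fin.castAdd m j))
        (s (Fin.natAdd m j)) := by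
    intro j
    rw [Rel.interp_mem₂, curry_interp_valRel]
    rfl
  constructor
  · intro h
    refine ⟨?_, fun j => (hM j).1 (h _ (.inr ⟨j, rfl⟩))⟩
    rw [logEnv_interp]
    exact fun i => ⟨(hδ _ _).curry, (hV i).1 (h _ (.inl ⟨i, rfl⟩))⟩
  · rintro ⟨hok, hmem⟩ Q (⟨i, rfl⟩ | ⟨j, rfl⟩)
    · rw [logEnv_interp] at hok
      exact (hV i).2 (hok i).2
    · exact (hM j).2 (hmem j)

/-- The conclusion of logical approximation in world `w + 1`. -/
theorem interp_logConclusion (σ : Fin (n + n) → Ty 0) (s : Fin (m + m) → Tm 0 0)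
    (δ : REnv (List.replicate n 2)) (w : ℕ) :
    (Rel.mem ![e₁.subst (fun i => (logEnv n (m + m) i).left) (fun j => .var (Fin.castAdd m j)),
        e₂.subst (fun i => (logEnv n (m + m) i).right) (fun j => .var (Fin.natAdd m j))]
      (expRel τ (logEnv n (m + m)))).interp σ s δ (w + 1) Fin.elim0 ↔
    semE τ ((logEnv n (m + m)).interp σ s δ) w
      (e₁.subst ((logEnv n (m + m)).interp σ s δ).left fun j => s (Fin.castAdd m j))
      (e₂.subst ((logEnv n (m + m)).interp σ s δ).right fun j => s (Fin.natAdd m j)) := by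
  rw [Rel.interp_mem₂, curry_interp_expRel, Tm.subst_subst, Tm.subst_subst]
  rfl

theorem LogRel.logApprox (h : LogRel Γ e₁ e₂ τ) : LogApprox Γ e₁ e₂ τ := by
  intro w σ s δ hδ hP
  cases w with
  -- everything holds in world `0`
  | zero => simp
  | succ w => exact (interp_logConclusion σ s δ w).2 (h.rel ((logHyps_iff_related hδ w).1 hP))

theorem LogApprox.logRel (h₁ : HasTy Γ e₁ τ) (h₂ : HasTy Γ e₂ τ) (h : LogApprox Γ e₁ e₂ τ) :
    LogRel Γ e₁ e₂ τ := by
  refine ⟨h₁, h₂, fun {ρ w γ₁ γ₂} hγ => ?_⟩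
  have hδ := relEnv_mono fun i => (hγ.ok i).1.uncurry
  -- the closing interpretation that denotes `ρ`, `γ₁` and `γ₂`
  have key := h (w + 1) (Fin.append ρ.left ρ.right) (Fin.append γ₁ γ₂) _ hδ
    ((logHyps_iff_related hδ w).2 (by
      rw [logEnv_interp_append]
      simpa only [Fin.append_left, Fin.append_right] using hγ))
  have key := (interp_logConclusion _ _ _ w).1 key
  rw [logEnv_interp_append] at key
  simpa only [Fin.append_left, Fin.append_right] using key

end

end FMu

theorem mainTheorem1 {n m : ℕ} (Γ : FMu.TyCtx n m) (e₁ e₂ : FMu.Tm n m) (τ : FMu.Ty n)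
    (h₁ : FMu.HasTy Γ e₁ τ) (h₂ : FMu.HasTy Γ e₂ τ) :
    (FMu.CtxApprox Γ e₁ e₂ τ ↔ FMu.CiuApprox Γ e₁ e₂ τ) ∧
    (FMu.CiuApprox Γ e₁ e₂ τ ↔ FMu.LogApprox Γ e₁ e₂ τ) := by
  have ctx_ciu : FMu.CtxApprox Γ e₁ e₂ τ → FMu.CiuApprox Γ e₁ e₂ τ := fun h =>
    h.ciuApprox h₁ h₂
  have ciu_log : FMu.CiuApprox Γ e₁ e₂ τ → FMu.LogApprox Γ e₁ e₂ τ := fun h =>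
    (h.logRel h₁ h₂).logApprox
  have log_ctx : FMu.LogApprox Γ e₁ e₂ τ → FMu.CtxApprox Γ e₁ e₂ τ := fun h =>
    (h.logRel h₁ h₂).ctxApprox
  exact ⟨⟨ctx_ciu, log_ctx ∘ ciu_log⟩, ⟨ciu_log, ctx_ciu ∘ log_ctx⟩⟩
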